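/- Digraphs are finite, have at least one vertex, and may have loops and multiple edges; $n$ denotes the number of vertices of the input digraph $D$, which is given by its matrix of edge multiplicities. The model of computation is the random access machine with uniform cost, whose arithmetic operations are addition and (truncated) subtraction of natural numbers. **Definitions.** A strong component of a digraph is a maximal strongly connected induced subdigraph. For $T \subseteq V(D)$ and a non-negative integer $r$, a $(T,r)$-balanced separator is a set $Z \subseteq V(D)$ such that every strong component of $D \setminus Z$ contains at most $r$ vertices of $T$; $T$ is $(k,r)$-linked if every $(T,r)$-balanced separator has size at least $k+1$. For $Z \subseteq V(D)$, a set $S \subseteq V(D) \setminus Z$ is $Z$-guarded if no walk in $D \setminus Z$ with first and last vertex in $S$ uses a vertex outside $S$. An arborescence is an orientation $R$ of a tree that has a vertex (the root) from which every vertex can be reached by a path of $R$. For a vertex $r$ and an edge $e$ of $R$, write $r > e$ if $R$ contains a path from the head of $e$ to $r$, and $e \sim r$ if $r$ is the head or the tail of $e$. An arboreal decomposition of $D$ is a triple $(R, \{X_e\}_{e \in E(R)}, \{W_r\}_{r \in V(R)})$, where $R$ is an arborescence and the $X_e$ and $W_r$ are subsets of $V(D)$, such that (i) the sets $W_r$ form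 a partition of $V(D)$ into non-empty sets, and (ii) for every $e \in E(R)$, the set $\bigcup_{r > e} W_r$ is $X_e$-guarded. It is nice if, moreover, (iii) for every $e \in E(R)$, the set $\bigcup_{r > e} W_r$ induces a strong component of $D \setminus X_e$, and (iv) for every $r \in V(R)$ with out-neighbours $r_1, \dots, r_\ell$ in $R$, $\bigl(\bigcup_{i} W_{r_i}\bigr) \cap \bigl(\bigcup_{e \sim r} X_e\bigr) = \emptyset$. Its width is the least integer $w$ such that $\bigl|W_r \cup \bigcup_{e \sim r} X_e\bigr| \le w+1$ for all $r \in V(R)$. **Theorem.** There is an algorithm that, given a digraph $D$ and a positive integer $k$, runs in time $2^{O(k \log k)} \cdot n^{O(1)}$ and outputs either a nice arboreal decomposition of $D$ of width at most $3k-2$, or a $(k-1,k-1)$-linked set $T \subseteq V(D)$ with $|T| = 2k-1$. In the second case $D$ has no $(T,k-1)$-balanced separator of size at most $k-1$. -/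

import Mathlib

/-! ### Random access machines with a step count -/

namespace RAM

/-- The memory of the machine consists of arrays of natural numbers; `m a i` is the content of
cell `i` of array `a`. A program mentions only finitely many arrays, by constant names, and
addresses their cells by computed indices. -/
abbrev Mem : Type := ℕ → ℕ → ℕ

/-- Expressions: constants, reading a cell at a computed index, addition, truncated subtraction.
There is no multiplication: in `t` steps numbers grow by at most `O(t)` bits, so the uniform cost
below agrees with Turing machine time up to a polynomial. -/
inductive Expr : Type where
  | const (c : ℕ) : Expr
  | read (a : ℕ) (i : Expr) : Expr
  | add (x y : Expr) : Expr
  | sub (x y : Expr) : Expr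

/-- The value of an expression. -/
def Expr.eval (m : Mem) : Expr → ℕ
  | .const c => c
  | .read a i => m a (i.eval m)
  | .add x y => x.eval m + y.eval m
  | .sub x y => x.eval m - y.eval m

/-- The number of steps for evaluating an expression: one for each operation. -/
def Expr.cost : Expr → ℕ
  | .const _ => 1
  | .read _ i => i.cost + 1
  | .add x y => x.cost + y.cost + 1
  | .sub x y => x.cost + y.cost + 1

/-- Programs. A test `e` counts as true if the value of `e` is nonzero. -/
inductive Prog : Type where
  | skip : Prog
  | write (a : ℕ) (i e : Expr) : Prog
  | seq (p q : Prog) : Prog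
  | ite (e : Expr) (p q : Prog) : Prog
  | loop (e : Expr) (p : Prog) : Prog

/-- The memory after writing `x` into cell `i` of array `a`. -/
def Mem.set (m : Mem) (a i x : ℕ) : Mem :=
  fun b j => if b = a ∧ j = i then x else m b j

/-- `Exec p m t m'`: started with memory `m`, the program `p` halts after exactly `t` steps with
memory `m'`. (At most one pair `(t, m')` has this property; `loop e p` is
`while e ≠ 0 do p`.) -/
inductive Exec : Prog → Mem → ℕ → Mem → Prop where
  | skip (m : Mem) : Exec .skip m 1 m
  | write (a : ℕ) (i e : Expr) (m : Mem) :
      Exec (.write a i e) m (i.cost + e.cost + 1) (m.set a (i.eval m) (e.eval m))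
  | seq {p q : Prog} {m m' m'' : Mem} {t t' : ℕ} :
      Exec p m t m' → Exec q m' t' m'' → Exec (.seq p q) m (t + t') m''
  | ite_true {e : Expr} {p q : Prog} {m m' : Mem} {t : ℕ} :
      e.eval m ≠ 0 → Exec p m t m' → Exec (.ite e p q) m (e.cost + 1 + t) m'
  | ite_false {e : Expr} {p q : Prog} {m m' : Mem} {t : ℕ} :
      e.eval m = 0 → Exec q m t m' → Exec (.ite e p q) m (e.cost + 1 + t) m'
  | loop_true {e : Expr} {p : Prog} {m m' m'' : Mem} {t t' : ℕ} :
      e.eval m ≠ 0 → Exec p m t m' → Exec (.loop e p) m' t' m'' →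
        Exec (.loop e p) m (e.cost + 1 + t + t') m''
  | loop_false {e : Expr} {p : Prog} {m : Mem} :
      e.eval m = 0 → Exec (.loop e p) m (e.cost + 1) m

end RAM

/-! ### Walks, strong components, guarded sets, balanced separators

Loops are allowed. Parallel edges do not matter for any of these notions, so they are
stated for the adjacency relation. -/

namespace DirectedTreewidth

variable {V N : Type*}

/-- `l` is (the vertex sequence of) a walk of `D` from `u` to `v` with all its vertices in `A`,
that is, a walk from `u` to `v` in the subdigraph of `D` induced by `A`. -/
def IsWalkIn (D : Digraph V) (A : Set V) (u v : V) (l : List V) : Prop :=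
  l.head? = some u ∧ l.getLast? = some v ∧ l.IsChain D.Adj ∧ ∀ x ∈ l, x ∈ A

/-- The subdigraph of `D` induced by `A` is strongly connected. -/
def StronglyConnectedOn (D : Digraph V) (A : Set V) : Prop :=
  ∀ u ∈ A, ∀ v ∈ A, ∃ l, IsWalkIn D A u v l

/-- `C` is the vertex set of a strong component of `D \ Z`: a maximal nonempty set of vertices
of `D \ Z` inducing a strongly connected subdigraph. -/
def IsStrongComponent (D : Digraph V) (Z C : Set V) : Prop :=
  Maximal (fun A : Set V => A.Nonempty ∧ Disjoint A Z ∧ StronglyConnectedOn D A) C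

/-- `S` is `Z`-guarded in `D`: `S` is disjoint from `Z`, and every walk of `D \ Z` with first and
last vertex in `S` stays in `S`. -/
def IsGuarded (D : Digraph V) (Z S : Set V) : Prop :=
  Disjoint S Z ∧ ∀ u ∈ S, ∀ v ∈ S, ∀ l, IsWalkIn D Zᶜ u v l → ∀ x ∈ l, x ∈ S

/-- `Z` is a `(T, r)`-balanced separator of `D`. -/
def IsBalancedSeparator (D : Digraph V) (T : Set V) (r : ℕ) (Z : Set V) : Prop :=
  ∀ C, IsStrongComponent D Z C → (C ∩ T).ncard ≤ r

/-- `T` is `(k, r)`-linked in `D`: every `(T, r)`-balanced separator has at least `k + 1`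
elements. -/
def IsLinked (D : Digraph V) (k r : ℕ) (T : Set V) : Prop :=
  ∀ Z, IsBalancedSeparator D T r Z → k + 1 ≤ Z.ncard

/-! ### Arboreal decompositions -/

/-- `R` is an arborescence with root `r₀`: an orientation of a tree in which every vertex can be
reached from `r₀`. -/
def IsArborescence (R : Digraph N) (r₀ : N) : Prop :=
  R.toSimpleGraphInclusive.IsTree ∧ (∀ a b, R.Adj a b → ¬ R.Adj b a) ∧
    ∀ r, ∃ l, IsWalkIn R Set.univ r₀ r l

/-- The data `(R, 𝒳, 𝒲)` of a decomposition of a digraph with vertex type `V`, with `N` the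
vertex type of `R`. The guard of the edge `(a, b)` of `R` is `X a b`; the values of `X` at pairs
that are not edges are never used. -/
structure TreeData (V N : Type*) where
  R : Digraph N
  X : N → N → Set V
  W : N → Set V

namespace TreeData

variable (β : TreeData V N)

/-- The union of the bags `W r` over all `r > e`, for an edge `e` of `R` with head `b`;
`r > e` means that `R` contains a path from `b` to `r`. -/
def below (b : N) : Set V :=
  ⋃ r ∈ {r | ∃ l, IsWalkIn β.R Set.univ b r l}, β.W r

/-- The union of the guards `X e` over all edges `e` of `R` with head or tail `r`. -/
def guardsAt (r : N) : Set V :=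
  ⋃ (a : N) (b : N) (_ : β.R.Adj a b ∧ (a = r ∨ b = r)), β.X a b

/-- `β` is an arboreal decomposition of `D`. -/
def IsArborealDecomposition (D : Digraph V) : Prop :=
  (∃ r₀, IsArborescence β.R r₀) ∧
  ((∀ r, (β.W r).Nonempty) ∧ (∀ r r', r ≠ r' → Disjoint (β.W r) (β.W r')) ∧
    (⋃ r, β.W r) = Set.univ) ∧
  ∀ a b, β.R.Adj a b → IsGuarded D (β.X a b) (β.below b)

/-- The two conditions that make an arboreal decomposition of `D` a nice one. -/
def IsNice (D : Digraph V) : Prop :=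
  (∀ a b, β.R.Adj a b → IsStrongComponent D (β.X a b) (β.below b)) ∧
  ∀ r, Disjoint (⋃ b ∈ {b | β.R.Adj r b}, β.W b) (β.guardsAt r)

/-- The width: the least integer `w` such that `W r ∪ ⋃_{e ∼ r} X e` has at most `w + 1` elements
for all vertices `r` of `R`. -/
noncomputable def width [Fintype N] : ℤ :=
  ((Finset.univ.sup fun r => (β.W r ∪ β.guardsAt r).ncard : ℕ) : ℤ) - 1

end TreeData

/-! ### Input and output formats -/

/-- The digraph with vertex set `Fin n`, loops and parallel edges allowed, that has `μ u v` edges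
from `u` to `v`; its adjacency relation. -/
def ofMult {n : ℕ} (μ : Fin n → Fin n → ℕ) : Digraph (Fin n) where
  Adj u v := μ u v ≠ 0

/-- The memory before the computation. Array `0` holds `n` and `k` in its cells `0` and `1`,
array `1` holds the `n × n` matrix of edge multiplicities row by row, all other cells are `0`. -/
def input (n k : ℕ) (μ : Fin n → Fin n → ℕ) : RAM.Mem := fun a i =>
  if a = 0 then (if i = 0 then n else if i = 1 then k else 0)
  else if a = 1 then
    (if h : i < n * n then μ (Fin.divNat ⟨i, h⟩) (Fin.modNat ⟨i, h⟩) else 0)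
  else 0

/-- The cell `2, 0` announces the kind of output: `0` for a set of vertices, `1` for a
decomposition. -/
def outputKind (m : RAM.Mem) : ℕ := m 2 0

/-- The output read as a set of vertices: array `3` is its characteristic vector. -/
def outputSet (n : ℕ) (m : RAM.Mem) : Set (Fin n) := {v | m 3 v ≠ 0}

/-- The output read as a decomposition: the cell `2, 1` holds the number of vertices of `R`, which
are `0, 1, …` with root `0`; array `4` gives the tail of the edge with head `b ≠ 0`, array `5` the
vertex `r` of `R` with `v ∈ W r`, and array `6`, row by row, the characteristic vectors of the guards
of the edges with head `b`. -/
def outputTree (n : ℕ) (m : RAM.Mem) : TreeData (Fin n) (Fin (m 2 1)) where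
  R := { Adj := fun a b => (b : ℕ) ≠ 0 ∧ m 4 b = a }
  X := fun _ b => {v | m 6 (b * n + v) ≠ 0}
  W := fun r => {v | m 5 v = r}

end DirectedTreewidth

/-!
The algorithm refines a rooted tree with bags `W r` and guards `X e`, starting from the tree with a
single node. Let `r` be a leaf and let `X` be the guard of the edge with head `r`, where
`|X| ≤ 2 * k - 1`. If `|W r ∪ X| < 3 * k`, then `r` is finished. Otherwise there is a set `T` with
`X ⊆ T ⊆ X ∪ W r` and `|T| = 2 * k - 1`. If `T` has no `(T, k - 1)`-balanced separator with at most
`k - 1` vertices, then `T` is the linked set that is asked for. If it has such a separator `Z`, let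
`Z'` be the union of `Z` and one vertex of `W r`. For every strong component `C` of the digraph
without `Z'` that meets `W r`, the node `r` gets children with guard `Z' ∪ (C ∩ X)`: one for each
strong component of the digraph without this guard that meets `C ∩ W r`, and with this strong
component as its bag. The guard has at most `k + (k - 1)` elements (`BagTree.ncard_newGuard_le`),
the bag is contained in `W r` (`BagTree.IsPartial.scc_subset_bag`), and it avoids `Z' ∪ X`. What
remains of `W r` is contained in `Z'`, so that `r` with its guards lies in `Z' ∪ X`, which has at
most `3 * k - 1` elements. Hence `r` is finished, and the conditions on the other nodes are
preserved (`BagTree.IsAdd.isPartial`). Since bags are not empty, there are at most `n` nodes.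

The separators are found by guessing `8 * k` digits in base `3`. A balanced separator splits `T`
into three parts with at most `k - 1` vertices each, such that without the separator no vertex of an
earlier part is reachable from one of a later part (`GoodSep.exists_labels`); the first `2 * k - 1`
digits guess these parts. It then remains to find two vertex cuts, one separating the last part from
the others and one separating the middle part from the first one. The cut that the separator
provides for the first of these tasks may be replaced by any cut that is not larger and lies further
from the vertices of the last part (`exists_candidate`). Such a cut is found by a search of `3 * k`
steps: augment the flow if possible, and otherwise take the furthest minimum cut and decide by the
next digit whether the head of an edge leaving it is to become a source or a sink. By submodularity,
the right digits keep the search inside a maximal cut containing the given one without a larger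
capacity, and in this case `3 * k` steps suffice (`exists_digits`). Every candidate is tested before
it is used, so the analysis of the search concerns only completeness.

The program is written in a language `Cmd` all of whose loops are counting loops with bounds that
depend on the part of the memory that holds `n`, `k` and `3 ^ (8 * k)`. Its effect is a function
`Cmd.run`, its translation to the machine is faithful (`Cmd.exec_compile`), and the number of steps
is polynomial in the largest bound of a loop (`Cmd.exists_time_le`), which is at most
`8 * (n + k) + 3 ^ (8 * k)`. This is within `2 ^ O(k log k) * n ^ O(1)` (`time_bound`); for `k = 1`,
where `k log k` vanishes, the powers of `3` are constants.
-/

/-! ### A loop language for random access machines -/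

namespace RAM

instance : Add Expr := ⟨Expr.add⟩
instance : Sub Expr := ⟨Expr.sub⟩
instance (c : ℕ) : OfNat Expr c := ⟨Expr.const c⟩

namespace Expr

/-- The scalar variable with name `a`: cell `0` of array `a`. -/
abbrev var (a : ℕ) : Expr := .read a 0

@[simp] theorem eval_lit (m : Mem) (c : ℕ) : Expr.eval m (no_index (OfNat.ofNat c) : Expr) =
    OfNat.ofNat c := rfl
@[simp] theorem eval_read (m : Mem) (a : ℕ) (i : Expr) : (read a i).eval m = m a (i.eval m) := rfl
@[simp] theorem eval_add (m : Mem) (x y : Expr) : (x + y).eval m = x.eval m + y.eval m := rfl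
@[simp] theorem eval_sub (m : Mem) (x y : Expr) : (x - y).eval m = x.eval m - y.eval m := rfl

/-- `1` if the two expressions have the same value and `0` otherwise. -/
def eq (x y : Expr) : Expr := 1 - ((x - y) + (y - x))

theorem eval_eq (m : Mem) (x y : Expr) :
    (eq x y).eval m = if x.eval m = y.eval m then 1 else 0 := by
  simp only [eq, eval_sub, eval_add, eval_lit]; split_ifs <;> omega

/-- All cells that the expression reads belong to array `0`. -/
def pure0 : Expr → Bool
  | .const _ => true
  | .read a i => a == 0 && i.pure0
  | .add x y => x.pure0 && y.pure0
  | .sub x y => x.pure0 && y.pure0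

theorem eval_pure0 {e : Expr} (h : e.pure0 = true) (m : Mem) :
    e.eval m = e.eval (fun _ => m 0) := by
  induction e with
  | const c => rfl
  | read a i ih =>
    simp only [pure0, Bool.and_eq_true, beq_iff_eq] at h
    obtain ⟨rfl, h⟩ := h
    change m 0 (i.eval m) = m 0 _
    rw [ih h]
  | add x y hx hy =>
    simp only [pure0, Bool.and_eq_true] at h
    simp [Expr.eval, hx h.1, hy h.2]
  | sub x y hx hy =>
    simp only [pure0, Bool.and_eq_true] at h
    simp [Expr.eval, hx h.1, hy h.2]

end Expr

namespace Mem

@[simp] theorem set_self (m : Mem) (a i x : ℕ) : (m.set a i x) a = Function.update (m a) i x := by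
  funext j; simp [Mem.set, Function.update_apply]

@[simp] theorem set_of_ne (m : Mem) {a b : ℕ} (i x : ℕ) (h : b ≠ a) : (m.set a i x) b = m b := by
  funext j; simp [Mem.set, h]

end Mem

/-- Programs all of whose loops are counting loops: `forTo i b p` executes `p` for the values
`0, 1, …, b - 1` of the variable `i`. -/
inductive Cmd : Type where
  | skip : Cmd
  | write (a : ℕ) (i e : Expr) : Cmd
  | seq (p q : Cmd) : Cmd
  | ite (e : Expr) (p q : Cmd) : Cmd
  | forTo (i : ℕ) (b : Expr) (p : Cmd) : Cmd

infixr:60 " ;; " => Cmd.seq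

namespace Cmd

/-- Assignment to a scalar variable. -/
abbrev assign (a : ℕ) (e : Expr) : Cmd := .write a 0 e

/-- The translation into programs of the machine. -/
def compile : Cmd → Prog
  | .skip => .skip
  | .write a i e => .write a i e
  | .seq p q => .seq p.compile q.compile
  | .ite e p q => .ite e p.compile q.compile
  | .forTo i b p => .seq (.write i 0 0)
      (.loop (b - Expr.var i) (.seq p.compile (.write i 0 (Expr.var i + 1))))

/-- The effect of a program on the memory, the bound of a loop being evaluated once, before the
loop. -/
def run : Cmd → Mem → Mem
  | .skip, m => m
  | .write a i e, m => m.set a (i.eval m) (e.eval m)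
  | .seq p q, m => q.run (p.run m)
  | .ite e p q, m => if e.eval m ≠ 0 then p.run m else q.run m
  | .forTo i b p, m =>
      Nat.rec (m.set i 0 0) (fun j m' => (p.run m').set i 0 (j + 1)) (b.eval m)

@[simp] theorem run_skip (m : Mem) : skip.run m = m := rfl
@[simp] theorem run_write (a : ℕ) (i e : Expr) (m : Mem) :
    (write a i e).run m = m.set a (i.eval m) (e.eval m) := rfl
@[simp] theorem run_seq (p q : Cmd) (m : Mem) : (p ;; q).run m = q.run (p.run m) := rfl
@[simp] theorem run_ite (e : Expr) (p q : Cmd) (m : Mem) :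
    (ite e p q).run m = if e.eval m ≠ 0 then p.run m else q.run m := rfl

theorem run_ite_apply (e : Expr) (p q : Cmd) (m : Mem) (a : ℕ) :
    (ite e p q).run m a = if e.eval m ≠ 0 then p.run m a else q.run m a := by
  rw [run_ite]; split_ifs <;> rfl

theorem run_ite_apply₂ (e : Expr) (p q : Cmd) (m : Mem) (a i : ℕ) :
    (ite e p q).run m a i = if e.eval m ≠ 0 then p.run m a i else q.run m a i := by
  rw [run_ite]; split_ifs <;> rfl

/-- The arrays that a program may write. -/
def writes : Cmd → List ℕ
  | .skip => []
  | .write a _ _ => [a]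
  | .seq p q => p.writes ++ q.writes
  | .ite _ p q => p.writes ++ q.writes
  | .forTo i _ p => i :: p.writes

theorem run_frame {p : Cmd} {a : ℕ} (h : a ∉ p.writes) (m : Mem) : p.run m a = m a := by
  induction p generalizing m with
  | skip => rfl
  | write b i e => simp [writes] at h; simp [h]
  | seq p q hp hq => simp [writes] at h; simp [hp h.1, hq h.2]
  | ite e p q hp hq => simp [writes] at h; simp only [run_ite]; split_ifs <;> simp [hp h.1, hq h.2]
  | forTo i b p hp =>
    simp [writes] at h
    have : ∀ j : ℕ, (Nat.rec (m.set i 0 0) (fun j m' => (p.run m').set i 0 (j + 1)) j : Mem) a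
        = m a := by
      intro j
      induction j with
      | zero => simp [h.1]
      | succ j ih => simp only [Mem.set_of_ne _ _ _ h.1, hp h.2, ih]
    exact this _

/-- The invariant rule for counting loops. The frame condition is supplied to the induction
step. -/
theorem run_forTo {i : ℕ} {b : Expr} {p : Cmd} {m : Mem} (I : ℕ → Mem → Prop)
    (h0 : I 0 (m.set i 0 0))
    (hs : ∀ j m', j < b.eval m → m' i 0 = j → (∀ a, a ≠ i → a ∉ p.writes → m' a = m a) →
      I j m' → I (j + 1) ((p.run m').set i 0 (j + 1))) :
    I (b.eval m) ((forTo i b p).run m) := by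
  have : ∀ j : ℕ, j ≤ b.eval m →
      I j (Nat.rec (m.set i 0 0) (fun j m' => (p.run m').set i 0 (j + 1)) j : Mem) ∧
      (Nat.rec (m.set i 0 0) (fun j m' => (p.run m').set i 0 (j + 1)) j : Mem) i 0 = j ∧
      ∀ a, a ≠ i → a ∉ p.writes →
        (Nat.rec (m.set i 0 0) (fun j m' => (p.run m').set i 0 (j + 1)) j : Mem) a = m a := by
    intro j
    induction j with
    | zero => exact fun _ => ⟨h0, by simp, fun a h _ => by simp [h]⟩
    | succ j ih =>
      intro hj
      obtain ⟨h1, h2, h3⟩ := ih (by omega)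
      refine ⟨hs j _ (by omega) h2 h3 h1, by simp, fun a h h' => ?_⟩
      simp only [Mem.set_of_ne _ _ _ h, run_frame h']
      exact h3 a h h'
  exact (this _ le_rfl).1

/-- A loop whose `j`-th round only changes cell `j` of array `a` and the variables `i` and those
in `s`. -/
theorem run_forTo_pointwise {i : ℕ} {b : Expr} {p : Cmd} {m : Mem} (a : ℕ) (F : ℕ → ℕ → ℕ)
    (hai : a ≠ i)
    (hp : ∀ j m', j < b.eval m → m' i 0 = j → (∀ c, c ≠ i → c ∉ p.writes → m' c = m c) →
      (p.run m') a = Function.update (m' a) j (F j (m' a j))) (x : ℕ) :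
    ((forTo i b p).run m) a x = if x < b.eval m then F x (m a x) else m a x := by
  refine run_forTo (I := fun t m' => ∀ x, m' a x = if x < t then F x (m a x) else m a x)
    (by simp [hai]) ?_ x
  intro j m' hj hi hf ih x
  rw [Mem.set_of_ne _ _ _ hai, hp j m' hj hi hf, Function.update_apply]
  split_ifs with h1 h2 h2
  · subst h1; rw [ih]; simp
  · omega
  · rw [ih, if_pos (by omega)]
  · rw [ih, if_neg (by omega)]

/-- A loop whose `j`-th round adds `1` to the variable `s` if `P j` holds. -/
theorem run_forTo_count {i : ℕ} {b : Expr} {p : Cmd} {m : Mem} (s : ℕ) (P : ℕ → Prop)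
    [DecidablePred P] (hsi : s ≠ i)
    (hp : ∀ j m', j < b.eval m → m' i 0 = j → (∀ c, c ≠ i → c ∉ p.writes → m' c = m c) →
      (p.run m') s 0 = m' s 0 + if P j then 1 else 0) :
    ((forTo i b p).run m) s 0 = m s 0 + ((Finset.range (b.eval m)).filter P).card := by
  refine run_forTo (I := fun t m' => m' s 0 = m s 0 + ((Finset.range t).filter P).card)
    (by simp [hsi]) ?_
  intro j m' hj hi hf ih
  rw [Mem.set_of_ne _ _ _ hsi, hp j m' hj hi hf, ih, Finset.range_add_one, Finset.filter_insert]
  split_ifs <;> simp [add_assoc]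

/-- The syntactic condition under which the translation of a program is faithful: the bounds of
loops depend on array `0` only, array `0` may be written by the last instruction only, and no
loop writes its own counter. -/
def wf : Cmd → Bool
  | .skip => true
  | .write _ _ _ => true
  | .seq p q => !p.writes.contains 0 && p.wf && q.wf
  | .ite _ p q => p.wf && q.wf
  | .forTo i b p => i != 0 && !p.writes.contains i && !p.writes.contains 0 && b.pure0 && p.wf

/-- All loop bounds are at most `S` if array `0` has the contents `z`. -/
def BoundsLe (S : ℕ) (z : ℕ → ℕ) : Cmd → Prop
  | .skip => True
  | .write _ _ _ => True
  | .seq p q => p.BoundsLe S z ∧ q.BoundsLe S z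
  | .ite _ p q => p.BoundsLe S z ∧ q.BoundsLe S z
  | .forTo _ b p => b.eval (fun _ => z) ≤ S ∧ p.BoundsLe S z

/-- An upper bound for the number of steps if all loop bounds are at most `S`. -/
def time (S : ℕ) : Cmd → ℕ
  | .skip => 1
  | .write _ i e => i.cost + e.cost + 1
  | .seq p q => p.time S + q.time S
  | .ite e p q => e.cost + 1 + (p.time S + q.time S)
  | .forTo _ b p => 10 + b.cost + S * (p.time S + b.cost + 20)

theorem exists_time_le (p : Cmd) : ∃ K d : ℕ, ∀ S, p.time S ≤ K * (S + 1) ^ d := by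
  induction p with
  | skip => exact ⟨1, 0, fun S => by simp [time]⟩
  | write a i e => exact ⟨i.cost + e.cost + 1, 0, fun S => by simp [time]⟩
  | seq p q hp hq =>
    obtain ⟨K, d, h⟩ := hp
    obtain ⟨K', d', h'⟩ := hq
    refine ⟨K + K', d + d', fun S => ?_⟩
    have h1 : (S + 1) ^ d ≤ (S + 1) ^ (d + d') := Nat.pow_le_pow_right (by omega) (by omega)
    have h2 : (S + 1) ^ d' ≤ (S + 1) ^ (d + d') := Nat.pow_le_pow_right (by omega) (by omega)
    calc time S (p ;; q) ≤ K * (S + 1) ^ d + K' * (S + 1) ^ d' := add_le_add (h S) (h' S)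
      _ ≤ K * (S + 1) ^ (d + d') + K' * (S + 1) ^ (d + d') := by gcongr
      _ = _ := by ring
  | ite e p q hp hq =>
    obtain ⟨K, d, h⟩ := hp
    obtain ⟨K', d', h'⟩ := hq
    refine ⟨(e.cost + 1) + (K + K'), d + d', fun S => ?_⟩
    have h0 : 1 ≤ (S + 1) ^ (d + d') := Nat.one_le_pow _ _ (by omega)
    have h1 : (S + 1) ^ d ≤ (S + 1) ^ (d + d') := Nat.pow_le_pow_right (by omega) (by omega)
    have h2 : (S + 1) ^ d' ≤ (S + 1) ^ (d + d') := Nat.pow_le_pow_right (by omega) (by omega)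
    calc time S (ite e p q)
        ≤ (e.cost + 1) * 1 + (K * (S + 1) ^ d + K' * (S + 1) ^ d') := by
          rw [mul_one]; exact Nat.add_le_add_left (add_le_add (h S) (h' S)) _
      _ ≤ (e.cost + 1) * (S + 1) ^ (d + d') +
          (K * (S + 1) ^ (d + d') + K' * (S + 1) ^ (d + d')) := by gcongr
      _ = _ := by ring
  | forTo i b p hp =>
    obtain ⟨K, d, h⟩ := hp
    refine ⟨(10 + b.cost) + (K + b.cost + 20), d + 1, fun S => ?_⟩
    have h0 : 1 ≤ (S + 1) ^ (d + 1) := Nat.one_le_pow _ _ (by omega)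
    have h1 : 1 ≤ (S + 1) ^ d := Nat.one_le_pow _ _ (by omega)
    calc time S (forTo i b p)
        ≤ (10 + b.cost) * 1 + (S + 1) * (K * (S + 1) ^ d + (b.cost + 20) * 1) := by
          simp only [time, mul_one]
          have := h S
          have h3 : S * (p.time S + b.cost + 20) ≤ (S + 1) * (K * (S + 1) ^ d + (b.cost + 20)) :=
            Nat.mul_le_mul (by omega) (by omega)
          omega
      _ ≤ (10 + b.cost) * (S + 1) ^ (d + 1) +
          (S + 1) * (K * (S + 1) ^ d + (b.cost + 20) * (S + 1) ^ d) := by gcongr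
      _ = _ := by ring

/-- The translation is faithful, and its number of steps is bounded by `time`. -/
theorem exec_compile {p : Cmd} {S : ℕ} {m : Mem} (hp : p.wf = true) (hb : p.BoundsLe S (m 0)) :
    ∃ t, Exec p.compile m t (p.run m) ∧ t ≤ p.time S := by
  induction p generalizing m with
  | skip => exact ⟨1, .skip m, le_rfl⟩
  | write a i e => exact ⟨_, .write a i e m, le_rfl⟩
  | seq p q ihp ihq =>
    simp only [wf, Bool.and_eq_true, Bool.not_eq_true', List.contains_eq_mem,
      decide_eq_false_iff_not] at hp
    obtain ⟨t, h1, h2⟩ := ihp hp.1.2 hb.1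
    obtain ⟨t', h1', h2'⟩ := ihq (m := p.run m) hp.2 (by rw [run_frame hp.1.1]; exact hb.2)
    exact ⟨t + t', .seq h1 h1', add_le_add h2 h2'⟩
  | ite e p q ihp ihq =>
    simp only [wf, Bool.and_eq_true] at hp
    obtain ⟨t, h1, h2⟩ := ihp hp.1 hb.1
    obtain ⟨t', h1', h2'⟩ := ihq hp.2 hb.2
    by_cases he : e.eval m ≠ 0
    · exact ⟨_, by rw [run_ite, if_pos he]; exact .ite_true he h1, by simp only [time]; omega⟩
    · rw [not_not] at he
      exact ⟨_, by rw [run_ite, if_neg (not_not.2 he)]; exact .ite_false he h1',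
        by simp only [time]; omega⟩
  | forTo i b p ih =>
    simp only [wf, Bool.and_eq_true, bne_iff_ne, ne_eq, Bool.not_eq_true',
      List.contains_eq_mem, decide_eq_false_iff_not] at hp
    obtain ⟨⟨⟨⟨hi, hiw⟩, h0w⟩, hb0⟩, hpw⟩ := hp
    set B := b.eval m with hB
    -- `M j` is the memory after `j` rounds
    set M : ℕ → Mem := fun j =>
      Nat.rec (m.set i 0 0) (fun j m' => (p.run m').set i 0 (j + 1)) j with hM
    have hM0 : ∀ j, M j 0 = m 0 ∧ M j i 0 = j := by
      intro j
      induction j with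
      | zero => simp [hM, Ne.symm hi]
      | succ j ihj =>
        change ((p.run (M j)).set i 0 (j + 1)) 0 = m 0 ∧ ((p.run (M j)).set i 0 (j + 1)) i 0 = j + 1
        simp [Ne.symm hi, run_frame h0w, ihj.1]
    have hbe : ∀ j, b.eval (M j) = B := fun j => by
      rw [Expr.eval_pure0 hb0, (hM0 j).1, ← Expr.eval_pure0 hb0]
    have hcond : ∀ j, (b - Expr.var i).eval (M j) = B - j := fun j => by
      simp [hbe, (hM0 j).2]
    have hcost : (b - Expr.var i).cost = b.cost + 3 := by
      change b.cost + (1 + 1) + 1 = _; omega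
    have key : ∀ r j, j + r = B → ∃ t, Exec (.loop (b - Expr.var i)
        (.seq p.compile (.write i 0 (Expr.var i + 1)))) (M j) t (M B) ∧
        t ≤ r * (p.time S + b.cost + 20) + (b.cost + 5) := by
      intro r
      induction r with
      | zero =>
        rintro j rfl
        exact ⟨_, .loop_false (by rw [hcond]; omega), by rw [hcost]; omega⟩
      | succ r ihr =>
        intro j hj
        obtain ⟨t, h1, h2⟩ := ih (m := M j) hpw (by rw [(hM0 j).1]; exact hb.2)
        obtain ⟨t', h1', h2'⟩ := ihr (j + 1) (by omega)
        have hstep : Exec (.write i 0 (Expr.var i + 1)) (p.run (M j)) 6 (M (j + 1)) := by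
          have := Exec.write i 0 (Expr.var i + 1) (p.run (M j))
          simp only [Expr.eval_add, Expr.eval_read, Expr.eval_lit, run_frame hiw, (hM0 j).2] at this
          exact this
        refine ⟨_, .loop_true (by rw [hcond]; omega) (.seq h1 hstep) h1', ?_⟩
        rw [hcost, Nat.succ_mul]
        omega
    obtain ⟨t, h1, h2⟩ := key B 0 (by omega)
    refine ⟨_, .seq (.write i 0 0 m) h1, ?_⟩
    have hBS : B ≤ S := by rw [hB, Expr.eval_pure0 hb0]; exact hb.1
    have := Nat.mul_le_mul_right (p.time S + b.cost + 20) hBS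
    have h3 : (0 : Expr).cost = 1 := rfl
    simp only [time, h3]
    omega

end Cmd

end RAM

/-! ### Cuts in capacitated digraphs -/

namespace DirectedTreewidth

open Finset Relation

open Classical in
/-- The capacity of the edges that leave `A`, for the capacity function `c` on `{0, …, N - 1}`. -/
noncomputable def cutVal (N : ℕ) (c : ℕ → ℕ → ℕ) (A : Set ℕ) : ℕ :=
  ∑ x ∈ range N, ∑ y ∈ range N, if x ∈ A ∧ y ∉ A then c x y else 0

theorem cutVal_submodular (N : ℕ) (c : ℕ → ℕ → ℕ) (A B : Set ℕ) :
    cutVal N c (A ∪ B) + cutVal N c (A ∩ B) ≤ cutVal N c A + cutVal N c B := by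
  classical
  simp only [cutVal, ← Finset.sum_add_distrib]
  refine Finset.sum_le_sum fun x _ => Finset.sum_le_sum fun y _ => ?_
  by_cases h1 : x ∈ A <;> by_cases h2 : x ∈ B <;> by_cases h3 : y ∈ A <;> by_cases h4 : y ∈ B <;>
    simp [h1, h2, h3, h4]

theorem le_cutVal {N : ℕ} (c : ℕ → ℕ → ℕ) {A : Set ℕ} {x y : ℕ} (hx : x < N) (hy : y < N)
    (hxA : x ∈ A) (hyA : y ∉ A) : c x y ≤ cutVal N c A := by
  classical
  calc c x y = if x ∈ A ∧ y ∉ A then c x y else 0 := by simp [hxA, hyA]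
    _ ≤ ∑ y ∈ range N, if x ∈ A ∧ y ∉ A then c x y else 0 :=
      Finset.single_le_sum (f := fun y => if x ∈ A ∧ y ∉ A then c x y else 0)
        (fun _ _ => Nat.zero_le _) (mem_range.2 hy)
    _ ≤ cutVal N c A :=
      Finset.single_le_sum (f := fun x => ∑ y ∈ range N, if x ∈ A ∧ y ∉ A then c x y else 0)
        (fun _ _ => Nat.zero_le _) (mem_range.2 hx)

theorem cutVal_eq_zero_iff {N : ℕ} {c : ℕ → ℕ → ℕ} {A : Set ℕ} :
    cutVal N c A = 0 ↔ ∀ x < N, ∀ y < N, x ∈ A → y ∉ A → c x y = 0 := by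
  classical
  simp only [cutVal, Finset.sum_eq_zero_iff, mem_range]
  refine forall₄_congr fun x _ y _ => ?_
  by_cases h1 : x ∈ A <;> by_cases h2 : y ∈ A <;> simp [h1, h2]

/-- The residual capacities after sending one unit of flow along the edge `(u, v)`. -/
def push (r : ℕ → ℕ → ℕ) (u v : ℕ) : ℕ → ℕ → ℕ := fun x y =>
  if x = u ∧ y = v then r x y - 1 else if x = v ∧ y = u then r x y + 1 else r x y

open Classical in
/-- Sending a unit of flow from `u` to `v` lowers the capacity of a cut by `1` if the edge leaves
the cut and raises it by `1` if the edge enters it. The equation is arranged so that it can be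
summed along a path. -/
theorem cutVal_push {N : ℕ} {r : ℕ → ℕ → ℕ} {u v : ℕ} (hu : u < N) (hv : v < N) (huv : u ≠ v)
    (hr : 0 < r u v) (A : Set ℕ) :
    cutVal N (push r u v) A + (if u ∈ A then 1 else 0) =
      cutVal N r A + (if v ∈ A then 1 else 0) := by
  have key : ∀ x y, (if x ∈ A ∧ y ∉ A then push r u v x y else 0) +
      (if x = u then if y = v then if u ∈ A ∧ v ∉ A then 1 else 0 else 0 else 0) =
      (if x ∈ A ∧ y ∉ A then r x y else 0) +
      (if x = v then if y = u then if v ∈ A ∧ u ∉ A then 1 else 0 else 0 else 0) := by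
    intro x y
    unfold push
    by_cases h1 : x = u
    · subst h1
      by_cases h2 : y = v
      · subst h2
        simp only [true_and, if_true, if_neg huv]
        split_ifs <;> omega
      · simp [h2, huv]
    · by_cases h2 : x = v
      · subst h2
        by_cases h3 : y = u
        · subst h3
          simp only [true_and, if_true, if_neg h1]
          split_ifs <;> omega
        · simp [h1, h3]
      · simp [h1, h2]
  have h := Finset.sum_congr rfl fun x (_ : x ∈ range N) =>
    Finset.sum_congr rfl fun y (_ : y ∈ range N) => key x y
  simp only [Finset.sum_add_distrib, Finset.sum_ite_eq', Finset.sum_ite_irrel,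
    Finset.sum_const_zero, mem_range, hu, hv, if_true] at h
  unfold cutVal
  by_cases h1 : u ∈ A <;> by_cases h2 : v ∈ A <;>
    simp only [h1, h2, not_true, not_false_eq_true, and_true, and_false, if_true, if_false]
      at h ⊢ <;>
    omega

/-! ### Searching for the furthest minimum cut that lies inside a given cut -/

/-- A cut problem with the capacities of all cuts reduced by the value of a flow found so far. -/
structure CutState where
  /-- vertices that have to belong to the cut -/
  src : Set ℕ
  /-- vertices that must not belong to the cut -/
  snk : Set ℕ
  /-- the value of the flow -/
  val : ℕ

namespace CutState

/-- `A` separates the sources from the sinks. -/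
def Valid (N : ℕ) (σ : CutState) (A : Set ℕ) : Prop :=
  (∀ x ∈ A, x < N) ∧ (∀ x ∈ σ.src, x ∈ A) ∧ ∀ x ∈ σ.snk, x ∉ A

/-- `A` is a cut whose capacity does not exceed the value of the flow. -/
def Tight (N : ℕ) (c : ℕ → ℕ → ℕ) (σ : CutState) (A : Set ℕ) : Prop :=
  σ.Valid N A ∧ cutVal N c A ≤ σ.val

/-- The union of all tight cuts. If the value of the flow is at most the capacity of every cut,
this is the largest minimum cut. -/
def furthest (N : ℕ) (c : ℕ → ℕ → ℕ) (σ : CutState) : Set ℕ :=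
  {x | ∃ A, σ.Tight N c A ∧ x ∈ A}

theorem Valid.union {N : ℕ} {σ : CutState} {A B : Set ℕ} (hA : σ.Valid N A) (hB : σ.Valid N B) :
    σ.Valid N (A ∪ B) :=
  ⟨fun x hx => hx.elim (hA.1 x) (hB.1 x), fun x hx => Or.inl (hA.2.1 x hx),
    fun x hx h => h.elim (hA.2.2 x hx) (hB.2.2 x hx)⟩

theorem Valid.inter {N : ℕ} {σ : CutState} {A B : Set ℕ} (hA : σ.Valid N A) (hB : σ.Valid N B) :
    σ.Valid N (A ∩ B) :=
  ⟨fun x hx => hA.1 x hx.1, fun x hx => ⟨hA.2.1 x hx, hB.2.1 x hx⟩,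
    fun x hx h => hA.2.2 x hx h.1⟩

theorem Tight.union {N : ℕ} {c : ℕ → ℕ → ℕ} {σ : CutState} {A B : Set ℕ}
    (hσ : ∀ A, σ.Valid N A → σ.val ≤ cutVal N c A)
    (hA : σ.Tight N c A) (hB : σ.Tight N c B) : σ.Tight N c (A ∪ B) := by
  have h1 := cutVal_submodular N c A B
  have h2 := hσ _ (hA.1.inter hB.1)
  have h3 := hA.2
  have h4 := hB.2
  exact ⟨hA.1.union hB.1, by omega⟩

theorem tight_furthest {N : ℕ} {c : ℕ → ℕ → ℕ} {σ : CutState}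
    (hσ : ∀ A, σ.Valid N A → σ.val ≤ cutVal N c A) (h : ∃ A, σ.Tight N c A) :
    σ.Tight N c (σ.furthest N c) := by
  -- a tight cut with the largest number of elements contains all tight cuts
  have hfin : {A | σ.Tight N c A}.Finite :=
    (Set.finite_Iio N).finite_subsets.subset fun A hA x hx => hA.1.1 x hx
  obtain ⟨A, hA, hmax⟩ := hfin.exists_maximal (h.imp fun _ h => h)
  have : σ.furthest N c = A := by
    ext x
    refine ⟨fun ⟨B, hB, hx⟩ => ?_, fun hx => ⟨A, hA, hx⟩⟩
    exact hmax (Tight.union hσ hA hB) Set.subset_union_left (Or.inr hx)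
  rw [this]; exact hA

end CutState

open Classical in
/-- One more than the largest `j < n` with `P j`, or `0` if there is none. -/
noncomputable def lastSucc (P : ℕ → Prop) : ℕ → ℕ
  | 0 => 0
  | j + 1 => if P j then j + 1 else lastSucc P j

theorem lastSucc_spec (P : ℕ → Prop) (n : ℕ) :
    (lastSucc P n = 0 ∧ ∀ j < n, ¬ P j) ∨ ∃ j < n, lastSucc P n = j + 1 ∧ P j := by
  induction n with
  | zero => exact Or.inl ⟨rfl, by simp⟩
  | succ n ih =>
    by_cases h : P n
    · exact Or.inr ⟨n, by omega, by simp [lastSucc, h], h⟩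
    · rcases ih with ⟨h1, h2⟩ | ⟨j, h1, h2, h3⟩
      · refine Or.inl ⟨by simp [lastSucc, h, h1], fun j hj => ?_⟩
        rcases Nat.lt_succ_iff_lt_or_eq.1 hj with h' | rfl
        exacts [h2 j h', h]
      · exact Or.inr ⟨j, by omega, by simp [lastSucc, h, h2], h3⟩

open Classical in
/-- The capacities for vertex cuts. Every vertex `v < n` is split into the edge from `v` to `n + v`,
of capacity `1`, or `0` if `v` belongs to the set `Z` of deleted vertices; an edge from `u` to `v`
becomes an edge from `n + u` to `v` whose capacity exceeds that of all relevant cuts. -/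
noncomputable def splitCap (n : ℕ) (adj : ℕ → ℕ → Prop) (Z : Set ℕ) (x y : ℕ) : ℕ :=
  if x < n then (if y = n + x ∧ x ∉ Z then 1 else 0) else if y < n ∧ adj (x - n) y then n + 1 else 0

/-- The vertices of the split graph on which the search branches: the heads `n + x` of the edges
leaving the furthest minimum cut, except for those that are already known to be outside. -/
def Branch (n : ℕ) (Z : Set ℕ) (R snk : Set ℕ) (x : ℕ) : Prop :=
  x ∈ R ∧ n + x ∉ R ∧ n + x ∉ snk ∧ x ∉ Z

open Classical in
/-- One step of the search: the flow is augmented if that is possible; otherwise a head of an edge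
leaving the furthest minimum cut becomes a source or a sink, as the digit `b` tells. -/
noncomputable def cutStep (n : ℕ) (adj : ℕ → ℕ → Prop) (Z : Set ℕ) (b : ℕ) (σ : CutState) :
    CutState :=
  if ∃ A, σ.Tight (2 * n) (splitCap n adj Z) A then
    match lastSucc (Branch n Z (σ.furthest (2 * n) (splitCap n adj Z)) σ.snk) n with
    | 0 => σ
    | x + 1 => if b ≠ 0 then { σ with src := insert (n + x) σ.src }
        else { σ with snk := insert (n + x) σ.snk }
  else { σ with val := σ.val + 1 }

/-- The state of the search after `j` steps with the digits `δ`. -/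
noncomputable def cutRun (n : ℕ) (adj : ℕ → ℕ → Prop) (Z : Set ℕ) (δ : ℕ → ℕ) (σ : CutState) :
    ℕ → CutState
  | 0 => σ
  | j + 1 => cutStep n adj Z (δ j) (cutRun n adj Z δ σ j)

/-- The vertices `v` for which the cut `A` of the split graph contains the edge from `v` to
`n + v`. -/
def cutVerts (n : ℕ) (A : Set ℕ) : Set ℕ := {v | v < n ∧ v ∈ A ∧ n + v ∉ A}

theorem cutVerts_finite (n : ℕ) (A : Set ℕ) : (cutVerts n A).Finite :=
  (Set.finite_Iio n).subset fun _ h => h.1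

theorem ncard_cutVerts_le (n : ℕ) (adj : ℕ → ℕ → Prop) (Z A : Set ℕ) :
    (cutVerts n A \ Z).ncard ≤ cutVal (2 * n) (splitCap n adj Z) A := by
  classical
  have h1 : (cutVerts n A \ Z) =
      ((range n).filter fun v => (v ∈ A ∧ n + v ∉ A) ∧ v ∉ Z : Finset ℕ) := by
    ext v; simp [cutVerts]; tauto
  rw [h1, Set.ncard_coe_finset, Finset.card_filter]
  unfold cutVal
  calc ∑ v ∈ range n, (if (v ∈ A ∧ n + v ∉ A) ∧ v ∉ Z then 1 else 0)
      ≤ ∑ x ∈ range n, ∑ y ∈ range (2 * n), if x ∈ A ∧ y ∉ A then splitCap n adj Z x y else 0 := by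
        refine Finset.sum_le_sum fun v hv => ?_
        have hv' := mem_range.1 hv
        refine le_trans ?_ (Finset.single_le_sum (f := fun y => if v ∈ A ∧ y ∉ A then
          splitCap n adj Z v y else 0) (fun _ _ => Nat.zero_le _)
          (mem_range.2 (by omega : n + v < 2 * n)))
        split_ifs with h1 <;> simp_all [splitCap]
    _ ≤ _ := Finset.sum_le_sum_of_subset (range_subset_range.2 (by omega))

theorem cutVal_le_ncard {n : ℕ} {adj : ℕ → ℕ → Prop} {Z A : Set ℕ}
    (h : ∀ u < n, ∀ v < n, adj u v → n + u ∈ A → v ∈ A) :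
    cutVal (2 * n) (splitCap n adj Z) A ≤ (cutVerts n A \ Z).ncard := by
  classical
  have h1 : (cutVerts n A \ Z) =
      ((range n).filter fun v => (v ∈ A ∧ n + v ∉ A) ∧ v ∉ Z : Finset ℕ) := by
    ext v; simp [cutVerts]; tauto
  rw [h1, Set.ncard_coe_finset, Finset.card_filter]
  have h2 : ∀ x ∈ range (2 * n), (∑ y ∈ range (2 * n), if x ∈ A ∧ y ∉ A then splitCap n adj Z x y
      else 0) ≤ if x ∈ range n then (if (x ∈ A ∧ n + x ∉ A) ∧ x ∉ Z then 1 else 0) else 0 := by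
    intro x hx
    have hx' := mem_range.1 hx
    by_cases hxn : x < n
    · rw [if_pos (mem_range.2 hxn)]
      calc _ ≤ ∑ y ∈ range (2 * n), if y = n + x then
            (if (x ∈ A ∧ n + x ∉ A) ∧ x ∉ Z then 1 else 0) else 0 := by
            refine Finset.sum_le_sum fun y _ => ?_
            by_cases hy : y = n + x
            · subst hy; by_cases h3 : x ∈ A <;> by_cases h4 : n + x ∈ A <;> by_cases h5 : x ∈ Z <;>
                simp [splitCap, hxn, h3, h4, h5]
            · simp [splitCap, hxn, hy]
        _ ≤ _ := by rw [Finset.sum_ite_eq']; split_ifs <;> simp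
    · rw [if_neg (by simpa using hxn)]
      refine (Finset.sum_eq_zero fun y _ => ?_).le
      split_ifs with h3
      · simp only [splitCap, if_neg hxn]
        rw [if_neg]
        rintro ⟨h4, h5⟩
        exact h3.2 (h (x - n) (by omega) y h4 h5
          (by rw [Nat.add_sub_cancel' (by omega)]; exact h3.1))
      · rfl
  refine (Finset.sum_le_sum h2).trans ?_
  rw [← Finset.sum_filter, Finset.filter_mem_eq_inter,
    Finset.inter_eq_right.2 (range_subset_range.2 (by omega))]

/-- A cut of small capacity is not left by the edges that correspond to edges of the digraph. -/
theorem closed_of_cutVal_le {n : ℕ} {adj : ℕ → ℕ → Prop} {Z A : Set ℕ}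
    (h : cutVal (2 * n) (splitCap n adj Z) A ≤ n) {u v : ℕ} (hu : u < n) (hv : v < n)
    (huv : adj u v) (huA : n + u ∈ A) : v ∈ A := by
  by_contra hvA
  have h1 := le_cutVal (N := 2 * n) (splitCap n adj Z) (by omega) (by omega) huA hvA
  have h2 : splitCap n adj Z (n + u) v = n + 1 := by simp [splitCap, hv, huv]
  omega

/-! ### Correct digits for the search -/

/-- The cut problem in the split graph for separating the vertices in `S` from those in `T`. -/
def initCut (n : ℕ) (S T : Set ℕ) : CutState :=
  ⟨S, {x | ∃ v ∈ T, x = n + v}, 0⟩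

theorem cutStep_of_not_tight {n : ℕ} {adj : ℕ → ℕ → Prop} {Z : Set ℕ} {b : ℕ} {σ : CutState}
    (h : ¬ ∃ A, σ.Tight (2 * n) (splitCap n adj Z) A) :
    cutStep n adj Z b σ = { σ with val := σ.val + 1 } := by
  rw [cutStep, if_neg h]

theorem cutStep_of_stuck {n : ℕ} {adj : ℕ → ℕ → Prop} {Z : Set ℕ} {b : ℕ} {σ : CutState}
    (h : ∃ A, σ.Tight (2 * n) (splitCap n adj Z) A)
    (h' : lastSucc (Branch n Z (σ.furthest (2 * n) (splitCap n adj Z)) σ.snk) n = 0) :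
    cutStep n adj Z b σ = σ := by
  rw [cutStep, if_pos h, h']

theorem cutStep_of_branch {n : ℕ} {adj : ℕ → ℕ → Prop} {Z : Set ℕ} {b x : ℕ} {σ : CutState}
    (h : ∃ A, σ.Tight (2 * n) (splitCap n adj Z) A)
    (h' : lastSucc (Branch n Z (σ.furthest (2 * n) (splitCap n adj Z)) σ.snk) n = x + 1) :
    cutStep n adj Z b σ = if b ≠ 0 then { σ with src := insert (n + x) σ.src }
        else { σ with snk := insert (n + x) σ.snk } := by
  rw [cutStep, if_pos h, h']

/-- The search finds, with suitable digits, a cut that is at least as good as the cut given by `P`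
and `Q`: it contains that cut and its capacity is not larger. Here `Q` consists of vertices
reachable from `S`, and `P` of the vertices of `S` and the out-neighbours of `Q`.

The digits are those that keep the search inside a cut `A'` that is maximal among the cuts
containing the given one whose capacity is not larger. By submodularity the furthest minimum cut
stays inside `A'`, and in every step twice the value of the flow plus the number of new sinks,
plus `1` if the flow is not maximum, increases, until there is nothing left to branch on. -/
theorem exists_digits {n k : ℕ} {adj : ℕ → ℕ → Prop} {Z S T P Q : Set ℕ} (hkn : k ≤ n)
    (hP : ∀ v ∈ P, v < n) (hQP : Q ⊆ P) (hSP : S ⊆ P)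
    (hQT : ∀ v ∈ Q, v ∉ T) (hQZ : ∀ v ∈ Q, v ∉ Z)
    (hcl : ∀ u ∈ Q, ∀ v < n, adj u v → v ∈ P)
    (hconn : ∀ R : Set ℕ, S ⊆ R → (∀ u ∈ Q, u ∈ R → ∀ v < n, adj u v → v ∈ R) → P ⊆ R)
    (hcard : ((P \ Q) \ Z).ncard < k) :
    ∃ δ : ℕ → ℕ, (∀ j, δ j ≤ 1) ∧
      (∃ A, (cutRun n adj Z δ (initCut n S T) (3 * k)).Tight (2 * n) (splitCap n adj Z) A) ∧
      ∃ R, R = (cutRun n adj Z δ (initCut n S T) (3 * k)).furthest (2 * n) (splitCap n adj Z) ∧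
        S ⊆ R ∧ (∀ v ∈ T, n + v ∉ R) ∧
        (∀ u < n, ∀ v < n, adj u v → n + u ∈ R → v ∈ R) ∧ P ⊆ R ∧ (∀ u ∈ Q, n + u ∈ R) ∧
        (cutVerts n R \ Z).ncard ≤ ((P \ Q) \ Z).ncard := by
  classical
  set N := 2 * n with hN
  set c := splitCap n adj Z with hc
  set σ₀ := initCut n S T with hσ₀
  set A₀ : Set ℕ := P ∪ {x | ∃ v ∈ Q, x = n + v} with hA₀
  have hmem : ∀ v < n, (v ∈ A₀ ↔ v ∈ P) := by
    intro v hv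
    refine ⟨fun h => h.elim id ?_, Or.inl⟩
    rintro ⟨w, -, rfl⟩; omega
  have hmem' : ∀ v, (n + v ∈ A₀ ↔ v ∈ Q) := by
    intro v
    refine ⟨fun h => h.elim (fun h => ?_) ?_, fun h => Or.inr ⟨v, h, rfl⟩⟩
    · have := hP _ h; omega
    · rintro ⟨w, hw, h⟩; rwa [Nat.add_left_cancel h]
  have hvalid₀ : σ₀.Valid N A₀ := by
    refine ⟨?_, fun x hx => Or.inl (hSP hx), ?_⟩
    · rintro x (hx | ⟨v, hv, rfl⟩)
      · have := hP _ hx; omega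
      · have := hP _ (hQP hv); omega
    · rintro x ⟨v, hv, rfl⟩ h
      exact hQT v ((hmem' v).1 h) hv
  have hcut₀ : cutVal N c A₀ ≤ ((P \ Q) \ Z).ncard := by
    refine (cutVal_le_ncard fun u hu v hv huv h => Or.inl (hcl u ((hmem' u).1 h) v hv huv)).trans ?_
    refine Set.ncard_le_ncard ?_ ((Set.finite_Iio n).subset fun v hv => hP v hv.1.1)
    rintro v ⟨⟨h1, h2, h3⟩, h4⟩
    exact ⟨⟨(hmem v h1).1 h2, fun h => h3 ((hmem' v).2 h)⟩, h4⟩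
  -- the maximal cut `A'`
  have hfin : {A | σ₀.Valid N A ∧ cutVal N c A ≤ cutVal N c A₀ ∧ A₀ ⊆ A}.Finite :=
    (Set.finite_Iio N).finite_subsets.subset fun A hA x hx => hA.1.1 x hx
  obtain ⟨A', ⟨hA'v, hA'c, hA'A⟩, hmax⟩ := hfin.exists_maximal ⟨A₀, hvalid₀, le_rfl, subset_rfl⟩
  set W := cutVerts n A' \ Z with hW
  have hWfin : W.Finite := (cutVerts_finite n A').subset Set.sdiff_subset
  have hWc : W.ncard ≤ cutVal N c A' := ncard_cutVerts_le n adj Z A'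
  -- `Inv` is the invariant of the run; `O σ` consists of those vertices of the cut `A'` whose heads
  -- have become sinks, and `Φ` is the potential that increases
  let Inv : CutState → Prop := fun σ => σ.Valid N A' ∧ σ₀.src ⊆ σ.src ∧ σ₀.snk ⊆ σ.snk ∧
    ∀ A, σ.Valid N A → σ.val ≤ cutVal N c A
  let O : CutState → Set ℕ := fun σ => {x ∈ W | n + x ∈ σ.snk}
  let Φ : CutState → ℕ := fun σ =>
    2 * σ.val + (O σ).ncard + if ∃ A, σ.Tight N c A then 0 else 1
  have hfur : ∀ σ, Inv σ → (∃ A, σ.Tight N c A) → σ.furthest N c ⊆ A' := by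
    rintro σ ⟨h1, h2, h3, h4⟩ ht
    have hR := CutState.tight_furthest h4 ht
    have hun : σ.Valid N (A' ∪ σ.furthest N c) := h1.union hR.1
    have := cutVal_submodular N c A' (σ.furthest N c)
    have := h4 _ (h1.inter hR.1)
    have := hR.2
    exact Set.subset_union_right.trans (hmax ⟨⟨hun.1, fun x hx => hun.2.1 x (h2 hx),
      fun x hx => hun.2.2 x (h3 hx)⟩, by omega, hA'A.trans Set.subset_union_left⟩
      Set.subset_union_left)
  -- the digit `bit σ` tells whether the head that is chosen belongs to `A'`
  let pick : CutState → ℕ := fun σ => lastSucc (Branch n Z (σ.furthest N c) σ.snk) n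
  let bit : CutState → ℕ := fun σ => if n + (pick σ - 1) ∈ A' then 1 else 0
  let Stuck : CutState → Prop := fun σ => (∃ A, σ.Tight N c A) ∧ pick σ = 0
  have hstep : ∀ σ, Inv σ → Inv (cutStep n adj Z (bit σ) σ) ∧
      (Stuck σ ∨ Φ σ + 1 ≤ Φ (cutStep n adj Z (bit σ) σ)) := by
    rintro σ hσ
    have hσ' := hσ
    obtain ⟨h1, h2, h3, h4⟩ := hσ'
    by_cases ht : ∃ A, σ.Tight N c A
    · have hR := CutState.tight_furthest h4 ht
      have hRA := hfur σ hσ ht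
      rcases lastSucc_spec (Branch n Z (σ.furthest N c) σ.snk) n with ⟨h5, h6⟩ | ⟨x, hx, h5, h6⟩
      · rw [cutStep_of_stuck ht h5]
        exact ⟨hσ, Or.inl ⟨ht, h5⟩⟩
      · rw [cutStep_of_branch ht h5]
        have hbit : bit σ = if n + x ∈ A' then 1 else 0 := by
          simp only [bit, pick, h5, Nat.add_sub_cancel]
        rw [hbit]
        by_cases hxA : n + x ∈ A'
        · -- the new source is outside the furthest minimum cut: the flow is no longer maximum
          simp only [if_pos hxA, ne_eq, one_ne_zero, not_false_eq_true, if_true]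
          have hsub : ∀ A, ({ σ with src := insert (n + x) σ.src } : CutState).Valid N A →
              σ.Valid N A ∧ n + x ∈ A := fun A hA =>
            ⟨⟨hA.1, fun y hy => hA.2.1 y (Or.inr hy), hA.2.2⟩, hA.2.1 _ (Or.inl rfl)⟩
          refine ⟨⟨⟨h1.1, ?_, h1.2.2⟩, h2.trans (Set.subset_insert _ _), h3,
            fun A hA => h4 A (hsub A hA).1⟩, Or.inr ?_⟩
          · rintro y (rfl | hy)
            exacts [hxA, h1.2.1 y hy]
          · have hnt : ¬ ∃ A, ({ σ with src := insert (n + x) σ.src } : CutState).Tight N c A := by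
              rintro ⟨A, hA, hA'⟩
              exact h6.2.1 ⟨A, ⟨(hsub A hA).1, hA'⟩, (hsub A hA).2⟩
            simp only [Φ, if_pos ht, if_neg hnt]
            exact le_rfl
        · -- the head of an edge that leaves `A'` becomes a sink
          simp only [if_neg hxA, ne_eq, not_true_eq_false, if_false]
          have hsub : ∀ A, ({ σ with snk := insert (n + x) σ.snk } : CutState).Valid N A →
              σ.Valid N A := fun A hA => ⟨hA.1, hA.2.1, fun y hy => hA.2.2 y (Or.inr hy)⟩
          refine ⟨⟨⟨h1.1, h1.2.1, ?_⟩, h2, h3.trans (Set.subset_insert _ _),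
            fun A hA => h4 A (hsub A hA)⟩, Or.inr ?_⟩
          · rintro y (rfl | hy)
            exacts [hxA, h1.2.2 y hy]
          · have hlt : (O σ).ncard < (O { σ with snk := insert (n + x) σ.snk }).ncard := by
              refine Set.ncard_lt_ncard ⟨fun y hy => ⟨hy.1, Or.inr hy.2⟩, fun h => ?_⟩
                (hWfin.subset fun y hy => hy.1)
              have hx' : x ∈ O { σ with snk := insert (n + x) σ.snk } :=
                ⟨⟨⟨hx, hRA h6.1, hxA⟩, h6.2.2.2⟩, Or.inl rfl⟩
              exact h6.2.2.1 (h hx').2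
            simp only [Φ, if_pos ht]
            omega
    · rw [cutStep_of_not_tight ht]
      refine ⟨⟨h1, h2, h3, fun A hA => ?_⟩, Or.inr ?_⟩
      · by_contra h
        exact ht ⟨A, hA, by simpa using h⟩
      · have hO : O { σ with val := σ.val + 1 } = O σ := rfl
        simp only [Φ, if_neg ht, hO]
        omega
  -- the run that follows `A'`
  let run : ℕ → CutState := fun j => (fun σ => cutStep n adj Z (bit σ) σ)^[j] σ₀
  have hrun : ∀ j, run (j + 1) = cutStep n adj Z (bit (run j)) (run j) := fun j =>
    Function.iterate_succ_apply' _ _ _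
  have hinv : ∀ j, Inv (run j) ∧ (Stuck (run j) ∨ j ≤ Φ (run j)) := by
    intro j
    induction j with
    | zero => exact ⟨⟨hA'v, subset_rfl, subset_rfl, fun A _ => Nat.zero_le _⟩,
        Or.inr (Nat.zero_le _)⟩
    | succ j ih =>
      obtain ⟨h1, h2⟩ := hstep _ ih.1
      rw [hrun]
      refine ⟨h1, ?_⟩
      have hst : Stuck (run j) → Stuck (cutStep n adj Z (bit (run j)) (run j)) := fun h => by
        rw [cutStep_of_stuck h.1 h.2]; exact h
      rcases h2 with h2 | h2
      · exact Or.inl (hst h2)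
      · rcases ih.2 with h3 | h3
        · exact Or.inl (hst h3)
        · exact Or.inr (by omega)
  have hcr : ∀ j, cutRun n adj Z (fun j => bit (run j)) σ₀ j = run j := by
    intro j
    induction j with
    | zero => rfl
    | succ j ih => rw [hrun, cutRun, ih]
  refine ⟨fun j => bit (run j), fun j => by simp only [bit]; split_ifs <;> omega, ?_⟩
  rw [hcr]
  obtain ⟨hI, hS⟩ := hinv (3 * k)
  set σ := run (3 * k) with hσ
  -- the potential is at most twice the capacity of the cut plus the number of its vertices
  have hstuck : Stuck σ := by
    refine hS.resolve_right fun h => ?_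
    have h5 := hI.2.2.2 _ hI.1
    have h6 : (O σ).ncard ≤ W.ncard := Set.ncard_le_ncard (fun y hy => hy.1) hWfin
    have h7 : ¬ (∃ A, σ.Tight N c A) → σ.val < cutVal N c A' := fun h => by
      by_contra h'
      exact h ⟨A', hI.1, by omega⟩
    simp only [Φ] at h
    split_ifs at h with h8
    · omega
    · have := h7 h8
      omega
  obtain ⟨h1, h2, h3, h4⟩ := hI
  have hR := CutState.tight_furthest h4 hstuck.1
  set R := σ.furthest N c with hRdef
  have hRc : cutVal N c R ≤ ((P \ Q) \ Z).ncard := by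
    have := hR.2
    have := h4 _ h1
    omega
  have hRcl : ∀ u < n, ∀ v < n, adj u v → n + u ∈ R → v ∈ R := fun u hu v hv huv h =>
    closed_of_cutVal_le (by change cutVal N c R ≤ n; omega) hu hv huv h
  have hQR : ∀ u ∈ Q, u ∈ R → n + u ∈ R := by
    intro u hu huR
    by_contra h
    rcases lastSucc_spec (Branch n Z R σ.snk) n with ⟨h5, h6⟩ | ⟨x, hx, h5, h6⟩
    · exact h6 u (hP u (hQP hu)) ⟨huR, h, fun h' => h1.2.2 _ h' (hA'A ((hmem' u).2 hu)), hQZ u hu⟩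
    · have : lastSucc (Branch n Z R σ.snk) n = 0 := hstuck.2
      omega
  have hSR : S ⊆ R := fun s hs => hR.1.2.1 s (h2 hs)
  have hPR : P ⊆ R := hconn R hSR fun u hu huR v hv huv =>
    hRcl u (hP u (hQP hu)) v hv huv (hQR u hu huR)
  exact ⟨hstuck.1, R, rfl, hSR, fun v hv => hR.1.2.2 _ (h3 ⟨v, hv, rfl⟩), hRcl, hPR,
    fun u hu => hQR u hu (hPR (hQP hu)), (ncard_cutVerts_le n adj Z R).trans hRc⟩

/-! ### Balanced separators from two cuts -/

/-- The edges of the digraph without the vertices in `Z`. -/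
def AvoidAdj (adj : ℕ → ℕ → Prop) (Z : Set ℕ) (u v : ℕ) : Prop := adj u v ∧ u ∉ Z ∧ v ∉ Z

/-- Reachability in the digraph without the vertices in `Z`. -/
abbrev Reach (adj : ℕ → ℕ → Prop) (Z : Set ℕ) : ℕ → ℕ → Prop := ReflTransGen (AvoidAdj adj Z)

theorem Reach.mono {adj : ℕ → ℕ → Prop} {Z Z' : Set ℕ} (h : Z ⊆ Z') {u v : ℕ}
    (huv : Reach adj Z' u v) : Reach adj Z u v :=
  ReflTransGen.mono (p := AvoidAdj adj Z)
    (fun _ _ h' => ⟨h'.1, fun hh => h'.2.1 (h hh), fun hh => h'.2.2 (h hh)⟩) _ _ huv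

theorem Reach.notMem {adj : ℕ → ℕ → Prop} {Z : Set ℕ} {u v : ℕ}
    (huv : Reach adj Z u v) (hv : v ∉ Z) : u ∉ Z := by
  rcases huv.cases_head with rfl | ⟨w, hw, -⟩
  exacts [hv, hw.2.1]

theorem Reach.notMem' {adj : ℕ → ℕ → Prop} {Z : Set ℕ} {u v : ℕ}
    (huv : Reach adj Z u v) (hu : u ∉ Z) : v ∉ Z := by
  rcases huv.cases_tail with rfl | ⟨w, -, hw⟩
  exacts [hu, hw.2.2]

/-- `Z` is a `(T, r)`-balanced separator of a digraph with vertices `0, …, n - 1`. -/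
def GoodSep (n : ℕ) (adj : ℕ → ℕ → Prop) (T : Set ℕ) (r : ℕ) (Z : Set ℕ) : Prop :=
  ∀ v < n, v ∉ Z → {u | u ∈ T ∧ Reach adj Z u v ∧ Reach adj Z v u}.ncard ≤ r

/-- A balanced separator splits `T` into three parts, ordered by reachability. The last part is
`T ∩ B` for a maximal set `B` closed under reachability that contains at most `k - 1` vertices
of `T`, and the middle part is the trace of a strong component that can be added to `B`. -/
theorem GoodSep.exists_labels {n k : ℕ} {adj : ℕ → ℕ → Prop} {T Z : Set ℕ} (hk : 1 ≤ k)
    (hadj : ∀ u v, adj u v → u < n ∧ v < n) (hT : ∀ v ∈ T, v < n) (hTc : T.ncard = 2 * k - 1)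
    (hZn : ∀ v ∈ Z, v < n) (hZ : Z.ncard ≤ k - 1) (h : GoodSep n adj T (k - 1) Z) :
    ∃ lab : ℕ → ℕ, (∀ v, lab v ≤ 2) ∧ (∀ i, {v | v ∈ T ∧ lab v = i}.ncard ≤ k - 1) ∧
      ∀ u ∈ T, ∀ v ∈ T, u ∉ Z → v ∉ Z → Reach adj Z u v → lab u ≤ lab v := by
  classical
  have hTf : T.Finite := (Set.finite_Iio n).subset hT
  have hZf : Z.Finite := (Set.finite_Iio n).subset hZn
  let V : Set ℕ := {v | v < n ∧ v ∉ Z}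
  let Closed : Set ℕ → Prop := fun B => B ⊆ V ∧ ∀ u ∈ B, ∀ v, AvoidAdj adj Z u v → v ∈ B
  have hclR : ∀ B, Closed B → ∀ u ∈ B, ∀ v, Reach adj Z u v → v ∈ B := by
    intro B hB u hu v huv
    induction huv with
    | refl => exact hu
    | tail _ h2 ih => exact hB.2 _ ih _ h2
  have hfin : ∀ p : Set ℕ → Prop, {B | Closed B ∧ p B}.Finite := fun p =>
    (Set.finite_Iio n).finite_subsets.subset fun B hB x hx => (hB.1.1 hx).1
  obtain ⟨B, ⟨hB, hBc⟩, hmax⟩ := (hfin fun B => (T ∩ B).ncard ≤ k - 1).exists_maximal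
    ⟨∅, ⟨Set.empty_subset _, fun u hu => hu.elim⟩, by simp⟩
  have hV : Closed V := ⟨subset_rfl, fun u _ v h => ⟨(hadj u v h.1).2, h.2.2⟩⟩
  by_cases hBV : V ⊆ B
  · refine ⟨fun v => if v ∈ B then 2 else 0, fun v => by dsimp only; split_ifs <;> omega,
      fun i => ?_, ?_⟩
    · by_cases hi : i = 2
      · refine (Set.ncard_le_ncard ?_ (hTf.inter_of_left B)).trans hBc
        rintro v ⟨h1, h2⟩
        refine ⟨h1, ?_⟩
        by_contra h3
        simp only [if_neg h3] at h2
        omega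
      · refine (Set.ncard_le_ncard ?_ hZf).trans hZ
        rintro v ⟨h1, h2⟩
        by_contra h3
        have : v ∈ B := hBV ⟨hT v h1, h3⟩
        simp only [if_pos this] at h2
        omega
    · intro u hu v hv _ hvZ _
      have : v ∈ B := hBV ⟨hT v hv, hvZ⟩
      simp only [if_pos this]
      split_ifs <;> omega
  · obtain ⟨B', ⟨hB', hBB', hB'B⟩, hmin⟩ := (hfin fun B' => B ⊆ B' ∧ ¬ B' ⊆ B).exists_minimal
      ⟨V, hV, hB.1, hBV⟩
    -- any two vertices of `B' \ B` are in the same strong component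
    have hstr : ∀ v ∈ B', v ∉ B → ∀ x ∈ B', x ∉ B → Reach adj Z v x := by
      intro v hv hvB x hx hxB
      have hsub : B ∪ {y | Reach adj Z v y} ⊆ B' :=
        Set.union_subset hBB' fun y hy => hclR B' hB' v hv y hy
      have hcl : Closed (B ∪ {y | Reach adj Z v y}) := by
        refine ⟨hsub.trans hB'.1, ?_⟩
        rintro u (hu | hu) w huw
        · exact Or.inl (hB.2 u hu w huw)
        · exact Or.inr (ReflTransGen.tail hu huw)
      have := hmin ⟨hcl, Set.subset_union_left, fun h' => hvB (h' (Or.inr .refl))⟩ hsub hx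
      exact this.resolve_left hxB
    have hB'c : k ≤ (T ∩ B').ncard := by
      by_contra hlt
      exact hB'B (hmax ⟨hB', by omega⟩ hBB')
    refine ⟨fun v => if v ∈ B then 2 else if v ∈ B' then 1 else 0,
      fun v => by dsimp only; split_ifs <;> omega, fun i => ?_, ?_⟩
    · by_cases hi : i = 2
      · refine (Set.ncard_le_ncard ?_ (hTf.inter_of_left B)).trans hBc
        rintro v ⟨h1, h2⟩
        refine ⟨h1, ?_⟩
        by_contra h3
        simp only [if_neg h3] at h2
        split_ifs at h2 <;> omega
      by_cases hi1 : i = 1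
      · obtain ⟨v₀, hv₀, hv₀B⟩ := Set.not_subset.1 hB'B
        refine (Set.ncard_le_ncard ?_ (hTf.subset fun v hv => hv.1)).trans
          (h v₀ (hB'.1 hv₀).1 (hB'.1 hv₀).2)
        rintro v ⟨h1, h2⟩
        have h3 : v ∉ B ∧ v ∈ B' := by
          dsimp only at h2
          split_ifs at h2 with h3 h4
          · omega
          · exact ⟨h3, h4⟩
          · omega
        exact ⟨h1, hstr v h3.2 h3.1 v₀ hv₀ hv₀B, hstr v₀ hv₀ hv₀B v h3.2 h3.1⟩
      · have h1 : {v | v ∈ T ∧ (if v ∈ B then 2 else if v ∈ B' then 1 else 0) = i} ⊆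
            T \ (T ∩ B') := by
          rintro v ⟨h1, h2⟩
          refine ⟨h1, fun h3 => ?_⟩
          simp only [if_pos h3.2] at h2
          split_ifs at h2 <;> omega
        have h2 := Set.ncard_sdiff (Set.inter_subset_left : T ∩ B' ⊆ T) (hTf.inter_of_left B')
        exact (Set.ncard_le_ncard h1 hTf.sdiff).trans (by omega)
    · intro u hu v hv _ _ huv
      dsimp only
      by_cases h1 : u ∈ B
      · rw [if_pos h1, if_pos (hclR B hB u h1 v huv)]
      · rw [if_neg h1]
        by_cases h2 : u ∈ B'
        · rw [if_pos h2, if_pos (hclR B' hB' u h2 v huv)]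
          split_ifs <;> omega
        · simp [h2]

/-! ### Candidates for balanced separators -/

/-- The set of vertices that the search finds with the digits `δ` when it separates `S` from `T`
after deleting `Z`. -/
noncomputable def foundCut (n k : ℕ) (adj : ℕ → ℕ → Prop) (Z S T : Set ℕ) (δ : ℕ → ℕ) : Set ℕ :=
  cutVerts n ((cutRun n adj Z δ (initCut n S T) (3 * k)).furthest (2 * n) (splitCap n adj Z))

/-- The search ended with a tight cut. -/
def CutFound (n k : ℕ) (adj : ℕ → ℕ → Prop) (Z S T : Set ℕ) (δ : ℕ → ℕ) : Prop :=
  ∃ A, (cutRun n adj Z δ (initCut n S T) (3 * k)).Tight (2 * n) (splitCap n adj Z) A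

/-- The search finds a cut that is not larger than a given cut `Y` and that lies further from
the sources: its far side `R` is closed under reachability and contains the vertices of `Y` that
are needed, here collected in `Y'`. -/
theorem exists_foundCut {n k : ℕ} {adj : ℕ → ℕ → Prop} {Z S T Y : Set ℕ} (hkn : k ≤ n)
    (hadj : ∀ u v, adj u v → u < n ∧ v < n) (hS : ∀ v ∈ S, v < n)
    (hYn : ∀ v ∈ Y, v < n) (hY : Y.ncard < k)
    (hsep : ∀ s ∈ S, ∀ t ∈ T, s ∉ Z ∪ Y → ¬ Reach adj (Z ∪ Y) s t) :
    ∃ δ : ℕ → ℕ, (∀ j, δ j ≤ 1) ∧ CutFound n k adj Z S T δ ∧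
      (∀ s ∈ S, ∀ t ∈ T, s ∉ Z ∪ foundCut n k adj Z S T δ → t ∉ Z ∪ foundCut n k adj Z S T δ →
        ¬ Reach adj (Z ∪ foundCut n k adj Z S T δ) s t) ∧
      ∃ Y' ⊆ Z ∪ Y, (foundCut n k adj Z S T δ \ Z).ncard ≤ (Y' \ Z).ncard ∧
        ∃ R : Set ℕ, (∀ v ∈ R, v < n → v ∉ foundCut n k adj Z S T δ → n + v ∈ R) ∧
          (∀ u v, adj u v → n + u ∈ R → v ∈ R) ∧ Y' ⊆ R ∧ ∀ v ∈ T, n + v ∉ R := by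
  -- `Q` is the set of vertices reachable in spite of the cut, and `P` adds the vertices at which
  -- the cut stops the search
  set Q : Set ℕ := {x | ∃ s ∈ S, s ∉ Z ∪ Y ∧ Reach adj (Z ∪ Y) s x} with hQ
  set P : Set ℕ := S ∪ Q ∪ {v | ∃ u ∈ Q, adj u v} with hP
  have hQn : ∀ v ∈ Q, v < n := by
    rintro v ⟨s, hs, -, hsv⟩
    rcases hsv.cases_tail with rfl | ⟨w, -, hw⟩
    exacts [hS _ hs, (hadj _ _ hw.1).2]
  have hQZ : ∀ v ∈ Q, v ∉ Z ∪ Y := fun v ⟨s, hs, hs', hsv⟩ => hsv.notMem' hs'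
  have hPn : ∀ v ∈ P, v < n := by
    rintro v ((hv | hv) | ⟨u, -, hu⟩)
    exacts [hS v hv, hQn v hv, (hadj _ _ hu).2]
  have hPQ : P \ Q ⊆ Z ∪ Y := by
    rintro v ⟨(hv | hv) | ⟨u, hu, huv⟩, hvQ⟩
    · by_contra h
      exact hvQ ⟨v, hv, h, .refl⟩
    · exact absurd hv hvQ
    · by_contra h
      obtain ⟨s, hs, hs', hsu⟩ := hu
      exact hvQ ⟨s, hs, hs', hsu.tail ⟨huv, hsu.notMem' hs', h⟩⟩
  have hYf : Y.Finite := (Set.finite_Iio n).subset hYn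
  have hsub : (P \ Q) \ Z ⊆ Y := fun v hv => (hPQ hv.1).resolve_left hv.2
  obtain ⟨δ, hδ, hF, R, hR, h1, h2, h3, h4, h5, h6⟩ := exists_digits (n := n) (k := k) (adj := adj)
    (Z := Z) (S := S) (T := T) (P := P) (Q := Q) hkn hPn (fun v hv => Or.inl (Or.inr hv))
    (fun v hv => Or.inl (Or.inl hv)) (fun v ⟨s, hs, hs', hsv⟩ hv => hsep s hs v hv hs' hsv)
    (fun v hv h => hQZ v hv (Or.inl h)) (fun u hu v _ huv => Or.inr ⟨u, hu, huv⟩)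
    (by
      intro R hSR hR
      have hQR : Q ⊆ R := by
        rintro v ⟨s, hs, hs', hsv⟩
        induction hsv with
        | refl => exact hSR hs
        | tail hb hbc ih => exact hR _ ⟨s, hs, hs', hb⟩ ih _ (hadj _ _ hbc.1).2 hbc.1
      rintro v ((hv | hv) | ⟨u, hu, huv⟩)
      exacts [hSR hv, hQR hv, hR u hu (hQR hu) v (hadj _ _ huv).2 huv])
    ((Set.ncard_le_ncard hsub hYf).trans_lt hY)
  have hfound : foundCut n k adj Z S T δ = cutVerts n R := by rw [hR]; rfl
  have hRcl : ∀ u v, adj u v → n + u ∈ R → v ∈ R := fun u v huv h =>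
    h3 u (hadj u v huv).1 v (hadj u v huv).2 huv h
  have hout : ∀ v ∈ R, v < n → v ∉ cutVerts n R → n + v ∈ R := fun v hv hvn hvc => by
    by_contra h
    exact hvc ⟨hvn, hv, h⟩
  refine ⟨δ, hδ, hF, ?_⟩
  rw [hfound]
  refine ⟨?_, P \ Q, hPQ, h6, R, hout, hRcl, fun v hv => h4 hv.1, h2⟩
  · intro s hs t ht hsZ htZ hst
    have : ∀ x, Reach adj (Z ∪ cutVerts n R) s x → n + x ∈ R := by
      intro x hx
      induction hx with
      | refl => exact hout s (h1 hs) (hS s hs) fun h => hsZ (Or.inr h)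
      | tail _ hbc ih =>
        exact hout _ (hRcl _ _ hbc.1 ih) (hadj _ _ hbc.1).2 fun h => hbc.2.2 (Or.inr h)
    exact h2 t ht (this t hst)

/-- The separator that is found with the labels `lab` and the digits `δ₁`, `δ₂`. The first search
separates the vertices with label `2` from those with a smaller label, the second one those with
label `1` from those with label `0`. -/
noncomputable def candidate (n k : ℕ) (adj : ℕ → ℕ → Prop) (lab δ₁ δ₂ : ℕ → ℕ) : Set ℕ :=
  let Z := foundCut n k adj ∅ {v | v < n ∧ lab v = 2} {v | v < n ∧ lab v < 2} δ₁
  Z ∪ foundCut n k adj Z {v | v < n ∧ lab v = 1} {v | v < n ∧ lab v < 1} δ₂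

/-- Both searches ended with tight cuts. -/
def CandidateFound (n k : ℕ) (adj : ℕ → ℕ → Prop) (lab δ₁ δ₂ : ℕ → ℕ) : Prop :=
  let Z := foundCut n k adj ∅ {v | v < n ∧ lab v = 2} {v | v < n ∧ lab v < 2} δ₁
  CutFound n k adj ∅ {v | v < n ∧ lab v = 2} {v | v < n ∧ lab v < 2} δ₁ ∧
  CutFound n k adj Z {v | v < n ∧ lab v = 1} {v | v < n ∧ lab v < 1} δ₂

theorem candidate_lt {n k : ℕ} {adj : ℕ → ℕ → Prop} {lab δ₁ δ₂ : ℕ → ℕ} :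
    ∀ v ∈ candidate n k adj lab δ₁ δ₂, v < n := by
  rintro v (h | h) <;> exact h.1

/-- If there is a balanced separator with at most `k - 1` vertices, then one is found. With the
labels of `GoodSep.exists_labels`, the part of the separator that is used for cutting off the
vertices with label `2` can be replaced by a cut lying further away from them: a path that gets
through because of this replacement would meet the far side of the new cut, which no path can
leave. -/
theorem exists_candidate {n k : ℕ} {adj : ℕ → ℕ → Prop} {T Z : Set ℕ} (hk : 1 ≤ k) (hkn : k ≤ n)
    (hadj : ∀ u v, adj u v → u < n ∧ v < n) (hT : ∀ v ∈ T, v < n) (hTc : T.ncard = 2 * k - 1)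
    (hZn : ∀ v ∈ Z, v < n) (hZ : Z.ncard ≤ k - 1) (h : GoodSep n adj T (k - 1) Z) :
    ∃ lab δ₁ δ₂ : ℕ → ℕ, (∀ v ∈ T, lab v ≤ 2) ∧ (∀ v, v ∉ T → lab v = 3) ∧
      (∀ j, δ₁ j ≤ 1) ∧ (∀ j, δ₂ j ≤ 1) ∧ CandidateFound n k adj lab δ₁ δ₂ ∧
      (candidate n k adj lab δ₁ δ₂).ncard ≤ k - 1 ∧
      GoodSep n adj T (k - 1) (candidate n k adj lab δ₁ δ₂) := by
  classical
  obtain ⟨lab₀, hl2, hlc, hlr⟩ := h.exists_labels hk hadj hT hTc hZn hZ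
  have hZf : Z.Finite := (Set.finite_Iio n).subset hZn
  have hTf : T.Finite := (Set.finite_Iio n).subset hT
  set lab : ℕ → ℕ := fun v => if v ∈ T then lab₀ v else 3 with hlab
  have hlT : ∀ v ∈ T, lab v = lab₀ v := fun v hv => if_pos hv
  have hlT' : ∀ v, lab v ≤ 2 → v ∈ T := fun v hv => by
    by_contra h'
    simp only [hlab, if_neg h'] at hv
    omega
  have hlr' : ∀ u v, lab u ≤ 2 → lab v ≤ 2 → u ∉ Z → v ∉ Z → Reach adj Z u v → lab u ≤ lab v := by
    intro u v hu hv
    rw [hlT u (hlT' u hu), hlT v (hlT' v hv)]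
    exact hlr u (hlT' u hu) v (hlT' v hv)
  set S₁ : Set ℕ := {v | v < n ∧ lab v = 2} with hS₁
  set T₁ : Set ℕ := {v | v < n ∧ lab v < 2} with hT₁
  set S₂ : Set ℕ := {v | v < n ∧ lab v = 1} with hS₂
  set T₂ : Set ℕ := {v | v < n ∧ lab v < 1} with hT₂
  obtain ⟨δ₁, hδ₁, hF₁, hsep₁, Y, hYZ, hYc, R, hR1, hR2, hR4, hR5⟩ :=
    exists_foundCut (n := n) (k := k) (adj := adj) (Z := ∅) (S := S₁) (T := T₁) (Y := Z) hkn hadj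
      (fun v hv => hv.1) hZn (by omega) (by
        rw [Set.empty_union]
        rintro s ⟨-, hs⟩ t ⟨-, ht⟩ hsZ hst
        have := hlr' s t (by omega) (by omega) hsZ (hst.notMem' hsZ) hst
        omega)
  rw [Set.empty_union] at hYZ hsep₁
  rw [Set.sdiff_empty, Set.sdiff_empty] at hYc
  set Z₁ := foundCut n k adj ∅ S₁ T₁ δ₁ with hZ₁
  have hYf : Y.Finite := hZf.subset hYZ
  have hZYc : (Z \ Y).ncard = Z.ncard - Y.ncard := Set.ncard_sdiff hYZ hYf
  have hYle : Y.ncard ≤ Z.ncard := Set.ncard_le_ncard hYZ hZf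
  obtain ⟨δ₂, hδ₂, hF₂, hsep₂, Y₂, hY₂Z, hY₂c, -⟩ :=
    exists_foundCut (n := n) (k := k) (adj := adj) (Z := Z₁) (S := S₂) (T := T₂) (Y := Z \ Y) hkn
      hadj (fun v hv => hv.1) (fun v hv => hZn v hv.1) (by omega) (by
        rintro s ⟨hsn, hs⟩ t ⟨htn, ht⟩ hsZ hst
        -- a path from `s` avoids `Z` until it meets the far side of the first cut
        have key : ∀ x, Reach adj (Z₁ ∪ Z \ Y) s x →
            (s ∉ Z ∧ x ∉ Z ∧ Reach adj Z s x) ∨ n + x ∈ R := by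
          intro x hx
          induction hx with
          | refl =>
            by_cases hsZ' : s ∈ Z
            · have hsY : s ∈ Y := by
                by_contra h'
                exact hsZ (Or.inr ⟨hsZ', h'⟩)
              exact Or.inr (hR1 s (hR4 hsY) hsn fun h' => hsZ (Or.inl h'))
            · exact Or.inl ⟨hsZ', hsZ', .refl⟩
          | @tail b x _ hbc ih =>
            have hxn := (hadj _ _ hbc.1).2
            have hx1 : x ∉ Z₁ := fun h' => hbc.2.2 (Or.inl h')
            rcases ih with ⟨h1, h2, h3⟩ | h1
            · by_cases hxZ : x ∈ Z
              · have hxY : x ∈ Y := by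
                  by_contra h'
                  exact hbc.2.2 (Or.inr ⟨hxZ, h'⟩)
                exact Or.inr (hR1 x (hR4 hxY) hxn hx1)
              · exact Or.inl ⟨h1, hxZ, h3.tail ⟨hbc.1, h2, hxZ⟩⟩
            · exact Or.inr (hR1 x (hR2 _ _ hbc.1 h1) hxn hx1)
        rcases key t hst with ⟨h1, h2, h3⟩ | h1
        · have := hlr' s t (by omega) (by omega) h1 h2 h3
          omega
        · exact hR5 t ⟨htn, by omega⟩ h1)
  set Z₂ := foundCut n k adj Z₁ S₂ T₂ δ₂ with hZ₂
  have hcand : candidate n k adj lab δ₁ δ₂ = Z₁ ∪ Z₂ := rfl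
  have hZ₁f : Z₁.Finite := cutVerts_finite _ _
  have hZ₂f : Z₂.Finite := cutVerts_finite _ _
  refine ⟨lab, δ₁, δ₂, fun v hv => by rw [hlT v hv]; exact hl2 v, fun v hv => if_neg hv, hδ₁, hδ₂,
    ⟨hF₁, hF₂⟩, ?_, ?_⟩
  · rw [hcand, ← Set.union_sdiff_self]
    have h1 := Set.ncard_union_le Z₁ (Z₂ \ Z₁)
    have h2 : (Y₂ \ Z₁).ncard ≤ (Z \ Y).ncard :=
      Set.ncard_le_ncard (fun v hv => (hY₂Z hv.1).resolve_left hv.2) hZf.sdiff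
    omega
  · rw [hcand]
    intro v _ hvZ
    -- all vertices of `T` in the strong component of `v` have the same label
    by_cases hne : ∃ w, w ∈ T ∧ Reach adj (Z₁ ∪ Z₂) w v ∧ Reach adj (Z₁ ∪ Z₂) v w
    · obtain ⟨w, hwT, hwv, hvw⟩ := hne
      have hlabel : ∀ x ∈ T, ∀ y ∈ T, Reach adj (Z₁ ∪ Z₂) x y → x ∉ Z₁ ∪ Z₂ → y ∉ Z₁ ∪ Z₂ →
          lab₀ x ≤ lab₀ y := by
        intro x hx y hy hxy hxZ hyZ
        by_contra hlt
        have hx2 := hl2 x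
        by_cases hx' : lab₀ x = 2
        · exact hsep₁ x ⟨hT x hx, by rw [hlT x hx, hx']⟩ y ⟨hT y hy, by rw [hlT y hy]; omega⟩
            (fun h' => hxZ (Or.inl h')) (fun h' => hyZ (Or.inl h'))
            (hxy.mono Set.subset_union_left)
        · exact hsep₂ x ⟨hT x hx, by rw [hlT x hx]; omega⟩ y ⟨hT y hy, by rw [hlT y hy]; omega⟩
            hxZ hyZ hxy
      refine (Set.ncard_le_ncard ?_ (hTf.subset fun u hu => hu.1)).trans (hlc (lab₀ w))
      rintro u ⟨huT, huv, hvu⟩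
      refine ⟨huT, le_antisymm ?_ ?_⟩
      · exact hlabel u huT w hwT (huv.trans hvw) (huv.notMem hvZ) (hwv.notMem hvZ)
      · exact hlabel w hwT u huT (hwv.trans hvu) (hwv.notMem hvZ) (huv.notMem hvZ)
    · have : {u | u ∈ T ∧ Reach adj (Z₁ ∪ Z₂) u v ∧ Reach adj (Z₁ ∪ Z₂) v u} = ∅ := by
        ext u
        simp only [Set.mem_ofPred_eq, Set.mem_empty_iff_false, iff_false]
        exact fun h' => hne ⟨u, h'⟩
      rw [this, Set.ncard_empty]
      omega

/-! ### The memory layout and backward reachability -/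

open RAM RAM.Cmd RAM.Expr

-- Names of arrays. Array `0` holds `n`, `k` and the number of digit sequences; `MAT`, `OUT`,
-- `TSET`, `PAR`, `COMP` and `GRD` are the arrays of the input and output formats. During the
-- computation `TSET` holds the set of terminals, and `PAR`, `COMP` and `GRD` hold the tree found
-- so far. `ROW` and `ROW2` are tables for the multiplication by `n` and by `2 * n`. For the
-- backward search, `RES` is the matrix of the graph with `2 * n` vertices, `VIS` marks the visited
-- vertices, and `NXT` holds their successors. All arrays are denoted by their numbers; numbers
-- without a name belong to loop counters: `24` to `27`, `34`, `55` and `60` to `62`, where `60` is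
-- the node that is processed and `61` the vertex whose strong component is split off. Further
-- scalar variables are `63`, the vertex that is kept in a bag, and `64`, an accumulator.
notation "MAT" => 1
notation "OUT" => 2
notation "TSET" => 3
notation "PAR" => 4
notation "COMP" => 5
notation "GRD" => 6
notation "ROW" => 10
notation "ROW2" => 11
notation "VIS" => 20
notation "NXT" => 21
notation "RES" => 22

/-- The number of vertices, as an expression. -/
abbrev eN : Expr := .read 0 0
/-- The parameter, as an expression. -/
abbrev eK : Expr := .read 0 1

/-- The part of the memory that does not change after the initialization: the input, the number
of digit sequences, and tables for the multiplication by `n` and `2 * n`. -/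
structure Env (n k : ℕ) (adj : ℕ → ℕ → Prop) (m : Mem) : Prop where
  n_eq : m 0 0 = n
  k_eq : m 0 1 = k
  pow_eq : m 0 2 = 3 ^ (8 * k)
  mat : ∀ u < n, ∀ v < n, (m MAT (u * n + v) ≠ 0 ↔ adj u v)
  row : ∀ u < n, m ROW u = u * n
  row2 : ∀ x < 2 * n, m ROW2 x = x * (2 * n)

variable {n k : ℕ} {adj : ℕ → ℕ → Prop}

theorem Env.congr {m m' : Mem} (h : Env n k adj m) (h0 : m' 0 = m 0) (h1 : m' MAT = m MAT)
    (h2 : m' ROW = m ROW) (h3 : m' ROW2 = m ROW2) : Env n k adj m' where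
  n_eq := by rw [h0, h.n_eq]
  k_eq := by rw [h0, h.k_eq]
  pow_eq := by rw [h0, h.pow_eq]
  mat := by rw [h1]; exact h.mat
  row := by rw [h2]; exact h.row
  row2 := by rw [h3]; exact h.row2

/-- The arrays of the fixed part of the memory are not written. -/
def KeepsEnv (l : List ℕ) : Prop := 0 ∉ l ∧ 1 ∉ l ∧ 10 ∉ l ∧ 11 ∉ l

instance (l : List ℕ) : Decidable (KeepsEnv l) := inferInstanceAs (Decidable (_ ∧ _))

theorem Env.frame {m m' : Mem} (h : Env n k adj m) {l : List ℕ} (hl : KeepsEnv l)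
    (hf : ∀ a, a ∉ l → m' a = m a) : Env n k adj m' :=
  h.congr (hf _ hl.1) (hf _ hl.2.1) (hf _ hl.2.2.1) (hf _ hl.2.2.2)

theorem Env.run {m : Mem} (h : Env n k adj m) {p : Cmd} (hp : KeepsEnv p.writes) :
    Env n k adj (p.run m) :=
  h.frame hp fun _ ha => run_frame ha m

/-- The entry in row `x` and column `y` of the matrix of residual capacities. -/
def res (n : ℕ) (m : Mem) (x y : ℕ) : ℕ := m RES (x * (2 * n) + y)

theorem index_inj {N x y x' y' : ℕ} (hy : y < N) (hy' : y' < N) :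
    x * N + y = x' * N + y' ↔ x = x' ∧ y = y' := by
  refine ⟨fun h => ?_, by rintro ⟨rfl, rfl⟩; rfl⟩
  have h1 : (x * N + y) / N = x := by
    rw [mul_comm, Nat.mul_add_div (by omega), Nat.div_eq_of_lt hy, add_zero]
  have h2 : (x' * N + y') / N = x' := by
    rw [mul_comm, Nat.mul_add_div (by omega), Nat.div_eq_of_lt hy', add_zero]
  have h3 : x = x' := by rw [← h1, ← h2, h]
  subst h3
  exact ⟨rfl, Nat.add_left_cancel h⟩

/-- The relation of being joined by an edge of positive residual capacity. -/
def Pos (N : ℕ) (E : ℕ → ℕ → ℕ) (x y : ℕ) : Prop := x < N ∧ y < N ∧ E x y ≠ 0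

/-- The invariant of the backward search from the vertices marked in `v₀`: the successors `nxt` of
the visited vertices lead to a vertex marked in `v₀`, as witnessed by a rank function. -/
def SearchInv (N : ℕ) (E : ℕ → ℕ → ℕ) (v₀ vis nxt : ℕ → ℕ) : Prop :=
  (∀ x < N, v₀ x ≠ 0 → vis x ≠ 0) ∧ ∃ ρ : ℕ → ℕ, ∀ x < N, vis x ≠ 0 →
    ρ x < ((range N).filter fun y => vis y ≠ 0).card ∧
    (v₀ x ≠ 0 ∨ (nxt x < N ∧ vis (nxt x) ≠ 0 ∧ E x (nxt x) ≠ 0 ∧ ρ (nxt x) < ρ x))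

theorem SearchInv.init (N : ℕ) (E : ℕ → ℕ → ℕ) (v₀ nxt : ℕ → ℕ) : SearchInv N E v₀ v₀ nxt :=
  ⟨fun _ _ h => h, fun _ => 0, fun x hx h => ⟨Finset.card_pos.2 ⟨x, by simp [hx, h]⟩, Or.inl h⟩⟩

theorem SearchInv.step {N : ℕ} {E : ℕ → ℕ → ℕ} {v₀ vis nxt : ℕ → ℕ}
    (h : SearchInv N E v₀ vis nxt) {x y : ℕ} (hx : x < N) (hy : y < N) (hvy : vis y ≠ 0)
    (hvx : vis x = 0) (hE : E x y ≠ 0) :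
    SearchInv N E v₀ (Function.update vis x 1) (Function.update nxt x y) := by
  obtain ⟨h1, ρ, h2⟩ := h
  have hxy : y ≠ x := by rintro rfl; exact hvy hvx
  have hcard : ((range N).filter fun z => Function.update vis x 1 z ≠ 0).card =
      ((range N).filter fun z => vis z ≠ 0).card + 1 := by
    have : ((range N).filter fun z => Function.update vis x 1 z ≠ 0) =
        insert x ((range N).filter fun z => vis z ≠ 0) := by
      ext z
      by_cases hz : z = x
      · subst hz; simp [hx]
      · simp [hz]
    rw [this, Finset.card_insert_of_notMem (by simp [hvx])]
  refine ⟨fun z hz hv => ?_, Function.update ρ x (ρ y + 1), fun z hz hv => ?_⟩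
  · by_cases hzx : z = x
    · subst hzx; simp
    · simpa [hzx] using h1 z hz hv
  · rw [hcard]
    by_cases hzx : z = x
    · subst hzx
      have := (h2 y hy hvy).1
      refine ⟨by simpa using this, Or.inr ?_⟩
      simp [hy, hvy, hE, hxy]
    · simp only [Function.update_of_ne hzx] at hv ⊢
      obtain ⟨h3, h4⟩ := h2 z hz hv
      refine ⟨by omega, h4.imp_right ?_⟩
      rintro ⟨h5, h6, h7, h8⟩
      have : nxt z ≠ x := by intro h'; rw [h'] at h6; exact h6 hvx
      simp [h5, h6, h7, h8, this]

theorem SearchInv.exists_reach {N : ℕ} {E : ℕ → ℕ → ℕ} {v₀ vis nxt : ℕ → ℕ}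
    (h : SearchInv N E v₀ vis nxt) {x : ℕ} (hx : x < N) (hv : vis x ≠ 0) :
    ∃ y < N, v₀ y ≠ 0 ∧ ReflTransGen (Pos N E) x y := by
  obtain ⟨-, ρ, h2⟩ := h
  induction hr : ρ x using Nat.strong_induction_on generalizing x with
  | _ r ih =>
    subst hr
    rcases (h2 x hx hv).2 with h3 | ⟨h3, h4, h5, h6⟩
    · exact ⟨x, hx, h3, .refl⟩
    · obtain ⟨y, hy, hy', hxy⟩ := ih _ h6 h3 h4 rfl
      exact ⟨y, hy, hy', .head ⟨hx, h3, h5⟩ hxy⟩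

/-- One test of the backward search: `x` is visited if there is an edge to a visited vertex `y`. -/
def bfsBody : Cmd :=
  .ite (.read VIS (var 26)) (.ite (.read VIS (var 25)) .skip
    (.ite (.read RES (.read ROW2 (var 25) + var 26))
      (.write VIS (var 25) 1 ;; .write NXT (var 25) (var 26)) .skip)) .skip

/-- One round of the backward search. -/
def bfsRound : Cmd := .forTo 25 (eN + eN) (.forTo 26 (eN + eN) bfsBody)

/-- Backward search in the graph of positive residual capacities from the vertices marked in
`VIS`. -/
def bfs : Cmd := .forTo 24 (eN + eN) bfsRound

/-- The invariant within a round that starts with the visited vertices `vs`: the edges in `P` have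
been tested. -/
def RoundInv (n : ℕ) (E : ℕ → ℕ → ℕ) (v₀ vs : ℕ → ℕ) (P : ℕ → ℕ → Prop) (m : Mem) : Prop :=
  SearchInv (2 * n) E v₀ (m VIS) (m NXT) ∧ (∀ x < 2 * n, vs x ≠ 0 → m VIS x ≠ 0) ∧
  ∀ x < 2 * n, ∀ y < 2 * n, P x y → vs y ≠ 0 → E x y ≠ 0 → m VIS x ≠ 0

theorem RoundInv.body {E : ℕ → ℕ → ℕ} {v₀ vs : ℕ → ℕ} {P : ℕ → ℕ → Prop} {m : Mem} {X Y : ℕ}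
    (h : RoundInv n E v₀ vs P m) (hX : X < 2 * n) (hY : Y < 2 * n) (hmX : m 25 0 = X)
    (hmY : m 26 0 = Y) (hE : ∀ x < 2 * n, ∀ y < 2 * n, m RES (m ROW2 x + y) = E x y) :
    RoundInv n E v₀ vs (fun x y => P x y ∨ (x = X ∧ y = Y)) (bfsBody.run m) := by
  obtain ⟨h1, h2, h3⟩ := h
  simp only [bfsBody, run_ite, run_skip, run_seq, run_write, eval_read, eval_lit, hmX, hmY,
    eval_add, hE X hX Y hY, ne_eq, ite_not]
  split_ifs with h4 h5 h6
  · refine ⟨h1, h2, fun x hx y hy hP hv hE' => ?_⟩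
    rcases hP with hP | ⟨rfl, rfl⟩
    · exact h3 x hx y hy hP hv hE'
    · exact absurd h4 (h2 y hy hv)
  · refine ⟨h1, h2, fun x hx y hy hP hv hE' => ?_⟩
    rcases hP with hP | ⟨rfl, rfl⟩
    · exact h3 x hx y hy hP hv hE'
    · contradiction
  · refine ⟨?_, ?_, ?_⟩
    · simpa [hmX, hmY] using h1.step hX hY h4 h5 h6
    · intro x hx hv
      by_cases hxX : x = X
      · simp [hxX]
      · simpa [hxX] using h2 x hx hv
    · rintro x hx y hy hP hv hE'
      by_cases hxX : x = X
      · simp [hxX]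
      · simpa [hxX] using h3 x hx y hy (hP.resolve_right fun h => hxX h.1) hv hE'
  · refine ⟨h1, h2, fun x hx y hy hP hv hE' => ?_⟩
    rcases hP with hP | ⟨rfl, rfl⟩
    · exact h3 x hx y hy hP hv hE'
    · assumption

theorem run_bfsRound {m : Mem} (he : Env n k adj m) {v₀ : ℕ → ℕ}
    (h : SearchInv (2 * n) (res n m) v₀ (m VIS) (m NXT)) :
    SearchInv (2 * n) (res n m) v₀ (bfsRound.run m VIS) (bfsRound.run m NXT) ∧
      (∀ x < 2 * n, m VIS x ≠ 0 → bfsRound.run m VIS x ≠ 0) ∧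
      ∀ x < 2 * n, ∀ y < 2 * n, m VIS y ≠ 0 → res n m x y ≠ 0 → bfsRound.run m VIS x ≠ 0 := by
  have hb : ∀ m' : Mem, Env n k adj m' → (eN + eN).eval m' = 2 * n := fun m' h' => by
    simp [h'.n_eq, two_mul]
  have key : RoundInv n (res n m) v₀ (m VIS) (fun x _ => x < (eN + eN).eval m)
      (bfsRound.run m) := by
    refine run_forTo (I := fun t m' => RoundInv n (res n m) v₀ (m VIS) (fun x _ => x < t) m') ?_ ?_
    · exact ⟨by simpa using h, by simp, fun x _ y _ h => absurd h (by omega)⟩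
    · intro X m' hX hmX hf hI
      rw [hb m he] at hX
      have he' : Env n k adj m' :=
        he.congr (hf _ (by decide) (by decide)) (hf _ (by decide) (by decide))
          (hf _ (by decide) (by decide)) (hf _ (by decide) (by decide))
      have hin : RoundInv n (res n m) v₀ (m VIS)
          (fun x y => x < X ∨ (x = X ∧ y < (eN + eN).eval m'))
          ((forTo 26 (eN + eN) bfsBody).run m') := by
        refine run_forTo (I := fun t m'' => RoundInv n (res n m) v₀ (m VIS)
          (fun x y => x < X ∨ (x = X ∧ y < t)) m'') ?_ ?_
        · simpa [RoundInv] using hI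
        · intro Y m'' hY hmY hf' hI'
          rw [hb m' he'] at hY
          have h1 := hI'.body hX hY (by rw [hf' 25 (by decide) (by decide), hmX]) hmY (by
            intro x hx y _
            rw [hf' RES (by decide) (by decide), hf RES (by decide) (by decide),
              hf' ROW2 (by decide) (by decide), he'.row2 x hx]
            rfl)
          obtain ⟨h2, h3, h4⟩ := h1
          refine ⟨by simpa using h2, by simpa using h3, fun x hx y hy hP => ?_⟩
          rw [Mem.set_of_ne _ _ _ (by decide)]
          exact h4 x hx y hy (by omega)
      rw [hb m' he'] at hin
      obtain ⟨h2, h3, h4⟩ := hin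
      refine ⟨by simpa using h2, by simpa using h3, fun x hx y hy hP => ?_⟩
      rw [Mem.set_of_ne _ _ _ (by decide)]
      exact h4 x hx y hy (by omega)
  rw [hb m he] at key
  exact ⟨key.1, key.2.1, fun x hx y hy hv hE => key.2.2 x hx y hy hx hv hE⟩

/-- The visited vertices are those from which a vertex marked at the beginning can be reached. -/
theorem run_bfs {m : Mem} (he : Env n k adj m) :
    SearchInv (2 * n) (res n m) (m VIS) (bfs.run m VIS) (bfs.run m NXT) ∧
      ∀ x < 2 * n, (bfs.run m VIS x ≠ 0 ↔
        ∃ y < 2 * n, m VIS y ≠ 0 ∧ ReflTransGen (Pos (2 * n) (res n m)) x y) := by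
  have hb : (eN + eN).eval m = 2 * n := by simp [he.n_eq, two_mul]
  -- every round visits a new vertex as long as the set of visited vertices is not closed
  have key : SearchInv (2 * n) (res n m) (m VIS) (bfs.run m VIS) (bfs.run m NXT) ∧
      ((∀ x < 2 * n, ∀ y < 2 * n, bfs.run m VIS y ≠ 0 → res n m x y ≠ 0 → bfs.run m VIS x ≠ 0) ∨
        (eN + eN).eval m ≤ ((range (2 * n)).filter fun y => bfs.run m VIS y ≠ 0).card) := by
    refine run_forTo (I := fun t m' => SearchInv (2 * n) (res n m) (m VIS) (m' VIS) (m' NXT) ∧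
      ((∀ x < 2 * n, ∀ y < 2 * n, m' VIS y ≠ 0 → res n m x y ≠ 0 → m' VIS x ≠ 0) ∨
        t ≤ ((range (2 * n)).filter fun y => m' VIS y ≠ 0).card)) ?_ ?_
    · exact ⟨by simpa using SearchInv.init _ _ _ _, Or.inr (Nat.zero_le _)⟩
    · intro t m' _ _ hf ⟨hI1, hI2⟩
      have he' : Env n k adj m' :=
        he.congr (hf _ (by decide) (by decide)) (hf _ (by decide) (by decide))
          (hf _ (by decide) (by decide)) (hf _ (by decide) (by decide))
      have hres : res n m' = res n m := by
        funext x y; simp only [res, hf RES (by decide) (by decide)]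
      rw [← hres] at hI1
      obtain ⟨h1, h2, h3⟩ := run_bfsRound he' hI1
      rw [hres] at h1 h3
      rw [Mem.set_of_ne _ _ _ (by decide : VIS ≠ 24), Mem.set_of_ne _ _ _ (by decide : NXT ≠ 24)]
      refine ⟨h1, ?_⟩
      have hsub : ((range (2 * n)).filter fun y => m' VIS y ≠ 0) ⊆
          ((range (2 * n)).filter fun y => bfsRound.run m' VIS y ≠ 0) := by
        intro x hx
        rw [mem_filter, mem_range] at hx ⊢
        exact ⟨hx.1, h2 x hx.1 hx.2⟩
      rcases (Finset.card_le_card hsub).lt_or_eq with hlt | heq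
      · rcases hI2 with hI2 | hI2
        · left
          intro x hx y hy hvy hE
          -- nothing new can be visited if the set is closed
          have : SearchInv (2 * n) (res n m) (m' VIS) (bfsRound.run m' VIS)
              (bfsRound.run m' NXT) := by
            have := run_bfsRound he' (v₀ := m' VIS) (SearchInv.init _ _ _ _)
            rw [hres] at this
            exact this.1
          obtain ⟨z, hz, hvz, hyz⟩ := this.exists_reach hy hvy
          have hy' : m' VIS y ≠ 0 := by
            clear hvy hE this
            induction hyz using ReflTransGen.head_induction_on with
            | refl => exact hvz
            | head h' _ ih => exact hI2 _ h'.1 _ h'.2.1 (ih h'.2.1) h'.2.2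
          exact h3 x hx y hy hy' hE
        · exact Or.inr (by omega)
      · left
        have heq' := Finset.eq_of_subset_of_card_le hsub heq.ge
        intro x hx y hy hvy hE
        have : y ∈ (range (2 * n)).filter fun y => m' VIS y ≠ 0 := by
          rw [heq']; simp [hy, hvy]
        exact h3 x hx y hy (mem_filter.1 this).2 hE
  obtain ⟨h1, h2⟩ := key
  have hcl : ∀ x < 2 * n, ∀ y < 2 * n, bfs.run m VIS y ≠ 0 → res n m x y ≠ 0 →
      bfs.run m VIS x ≠ 0 := by
    refine h2.elim id fun h2 x hx _ _ _ _ => ?_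
    have h3 : ((range (2 * n)).filter fun y => bfs.run m VIS y ≠ 0) = range (2 * n) :=
      Finset.eq_of_subset_of_card_le (Finset.filter_subset _ _) (by rw [hb] at h2; simpa using h2)
    exact (Finset.filter_eq_self.1 h3) x (mem_range.2 hx)
  refine ⟨h1, fun x hx => ⟨fun h => h1.exists_reach hx h, ?_⟩⟩
  rintro ⟨y, hy, hvy, hxy⟩
  induction hxy using ReflTransGen.head_induction_on with
  | refl => exact h1.1 _ hy hvy
  | head h' _ ih => exact hcl _ h'.1 _ h'.2.1 (ih h'.2.1) h'.2.2

/-! ### Augmenting the flow -/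

-- `SRC` and `SNK` mark the sources and the sinks. `FND` tells whether a visited source was found,
-- and `CUR` is the current vertex on the augmenting path. `PHASE` is the label of the vertices
-- that are being cut off; `DIG` holds the guessed digits, `IDX` the position of the next one, and
-- `LAB` the labels of the vertices. `PCK` is one more than the vertex chosen for branching, or
-- `0`, and `SEP` marks the vertices of the separator.
notation "SRC" => 30
notation "SNK" => 31
notation "CUR" => 32
notation "FND" => 33
notation "PHASE" => 35
notation "IDX" => 36
notation "PCK" => 37
notation "LAB" => 38
notation "DIG" => 39
notation "SEP" => 40

theorem cutVal_congr {N : ℕ} {c c' : ℕ → ℕ → ℕ} (h : ∀ x < N, ∀ y < N, c x y = c' x y)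
    (A : Set ℕ) : cutVal N c A = cutVal N c' A := by
  unfold cutVal
  refine Finset.sum_congr rfl fun x hx => Finset.sum_congr rfl fun y hy => ?_
  rw [h x (mem_range.1 hx) y (mem_range.1 hy)]

theorem res_of_update {m m' : Mem} {x y v : ℕ} (hy : y < 2 * n)
    (h : m' RES = Function.update (m RES) (x * (2 * n) + y) v) {x' y' : ℕ} (hy' : y' < 2 * n) :
    res n m' x' y' = if x' = x ∧ y' = y then v else res n m x' y' := by
  simp only [res, h, Function.update_apply, index_inj hy' hy]

/-- Filling the matrix of residual capacities entry by entry. -/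
theorem run_fill {m : Mem} (he : Env n k adj m) {p : Cmd} (hw : p.writes.all (· == 22) = true)
    (F : ℕ → ℕ → ℕ)
    (hp : ∀ x < 2 * n, ∀ y < 2 * n, ∀ m' : Mem, m' 25 0 = x → m' 26 0 = y →
      (∀ a, a ≠ 25 → a ≠ 26 → a ≠ RES → m' a = m a) →
      p.run m' RES = Function.update (m' RES) (x * (2 * n) + y) (F x y)) :
    ∀ x < 2 * n, ∀ y < 2 * n,
      res n ((forTo 25 (eN + eN) (forTo 26 (eN + eN) p)).run m) x y = F x y := by
  have hw' : ∀ a, a ≠ RES → a ∉ p.writes := fun a ha h => ha (by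
    simpa using List.all_eq_true.1 hw a h)
  have hb : (eN + eN).eval m = 2 * n := by simp [he.n_eq, two_mul]
  have key : ∀ x < 2 * n, ∀ y < 2 * n, x < (eN + eN).eval m →
      res n ((forTo 25 (eN + eN) (forTo 26 (eN + eN) p)).run m) x y = F x y := by
    refine run_forTo (I := fun t m' => ∀ x < 2 * n, ∀ y < 2 * n, x < t → res n m' x y = F x y)
      (by simp) ?_
    intro X m' hX hmX hf hI
    have hf1 : ∀ a, a ≠ 25 → a ≠ 26 → a ≠ RES → m' a = m a := fun a h1 h2 h3 =>
      hf a h1 (by simp [writes, h2, hw' a h3])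
    have hb' : (eN + eN).eval m' = 2 * n := by
      simp [hf1 0 (by decide) (by decide) (by decide), he.n_eq, two_mul]
    rw [hb] at hX
    have key' : ∀ x < 2 * n, ∀ y < 2 * n, x < X ∨ (x = X ∧ y < (eN + eN).eval m') →
        res n ((forTo 26 (eN + eN) p).run m') x y = F x y := by
      refine run_forTo (I := fun t m' => ∀ x < 2 * n, ∀ y < 2 * n, x < X ∨ (x = X ∧ y < t) →
        res n m' x y = F x y) ?_ ?_
      · intro x hx y hy h
        have := hI x hx y hy (by omega)
        simpa [res] using this
      · intro Y m'' hY hmY hf' hI' x hx y hy h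
        rw [hb'] at hY
        have hf2 : ∀ a, a ≠ 26 → a ≠ RES → m'' a = m' a := fun a h1 h2 => hf' a h1 (hw' a h2)
        have h1 := hp X hX Y hY m'' (by rw [hf2 25 (by decide) (by decide), hmX]) hmY
          fun a h1 h2 h3 => (hf2 a h2 h3).trans (hf1 a h1 h2 h3)
        have h2 : res n ((p.run m'').set 26 0 (Y + 1)) x y = res n (p.run m'') x y := by simp [res]
        rw [h2, res_of_update hY h1 hy]
        split_ifs with h3
        · rw [h3.1, h3.2]
        · exact hI' x hx y hy (by omega)
    rw [hb'] at key'
    intro x hx y hy h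
    have := key' x hx y hy (by omega)
    simpa [res] using this
  intro x hx y hy
  exact key x hx y hy (by rw [hb]; exact hx)

/-- Finding a visited source. -/
def findSrc : Cmd :=
  .assign FND 0 ;; .forTo 25 (eN + eN) (.ite (.read SRC (var 25)) (.ite (.read VIS (var 25))
    (.assign CUR (var 25) ;; .assign FND 1) .skip) .skip)

theorem run_findSrc {m : Mem} (he : Env n k adj m) :
    (findSrc.run m FND 0 = 0 ∧ ∀ x < 2 * n, m SRC x ≠ 0 → m VIS x = 0) ∨
    (findSrc.run m FND 0 ≠ 0 ∧ findSrc.run m CUR 0 < 2 * n ∧ m SRC (findSrc.run m CUR 0) ≠ 0 ∧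
      m VIS (findSrc.run m CUR 0) ≠ 0) := by
  have hb : (eN + eN).eval (m.set FND 0 0) = 2 * n := by simp [he.n_eq, two_mul]
  suffices h : (findSrc.run m FND 0 = 0 ∧
      ∀ x < (eN + eN).eval (m.set FND 0 0), m SRC x ≠ 0 → m VIS x = 0) ∨
      (findSrc.run m FND 0 ≠ 0 ∧ findSrc.run m CUR 0 < 2 * n ∧ m SRC (findSrc.run m CUR 0) ≠ 0 ∧
      m VIS (findSrc.run m CUR 0) ≠ 0) by
    rwa [hb] at h
  refine run_forTo (m := m.set FND 0 0) (I := fun t m' => (m' FND 0 = 0 ∧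
      ∀ x < t, m SRC x ≠ 0 → m VIS x = 0) ∨ (m' FND 0 ≠ 0 ∧ m' CUR 0 < 2 * n ∧
      m SRC (m' CUR 0) ≠ 0 ∧ m VIS (m' CUR 0) ≠ 0)) (by simp) ?_
  intro j m' hj hmj hf hI
  rw [hb] at hj
  have h1 : m' SRC = m SRC := (hf _ (by decide) (by decide)).trans (by simp)
  have h2 : m' VIS = m VIS := (hf _ (by decide) (by decide)).trans (by simp)
  simp only [run_ite, run_seq, run_write, run_skip, eval_read, eval_lit, hmj, h1, h2, ne_eq,
    ite_not]
  split_ifs with h3 h4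
  · refine hI.imp (fun h => ⟨by simpa using h.1, fun x hx hs => ?_⟩) (fun h => by simpa using h)
    rcases Nat.lt_succ_iff_lt_or_eq.1 hx with h' | rfl
    exacts [h.2 x h' hs, absurd h3 hs]
  · refine hI.imp (fun h => ⟨by simpa using h.1, fun x hx hs => ?_⟩) (fun h => by simpa using h)
    rcases Nat.lt_succ_iff_lt_or_eq.1 hx with h' | rfl
    exacts [h.2 x h' hs, h4]
  · right
    simp [hj, h3, h4]

/-- One step along the augmenting path: one unit of flow is sent along an edge. -/
def augmentBody : Cmd :=
  .ite (.read SNK (var CUR)) .skip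
    (.write RES (.read ROW2 (var CUR) + .read NXT (var CUR))
      (.read RES (.read ROW2 (var CUR) + .read NXT (var CUR)) - 1) ;;
     .write RES (.read ROW2 (.read NXT (var CUR)) + var CUR)
      (.read RES (.read ROW2 (.read NXT (var CUR)) + var CUR) + 1) ;;
     .assign CUR (.read NXT (var CUR)))

/-- Sending one unit of flow along the path found by the backward search. -/
def augment : Cmd := .forTo 25 (eN + eN) augmentBody

theorem run_augmentBody {m : Mem} (he : Env n k adj m) {x y : ℕ} (hx : m CUR 0 = x)
    (hy : m NXT x = y) (hxn : x < 2 * n) (hyn : y < 2 * n) (hxy : x ≠ y) (hs : m SNK x = 0) :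
    augmentBody.run m CUR 0 = y ∧
      ∀ a < 2 * n, ∀ b < 2 * n, res n (augmentBody.run m) a b = push (res n m) x y a b := by
  have h1 : augmentBody.run m = ((m.set RES (x * (2 * n) + y) (m RES (x * (2 * n) + y) - 1)).set
      RES (y * (2 * n) + x) (m RES (y * (2 * n) + x) + 1)).set CUR 0 y := by
    have hne : y * (2 * n) + x ≠ x * (2 * n) + y := fun h => hxy ((index_inj hxn hyn).1 h).2
    simp [augmentBody, hx, hs, hy, he.row2 x hxn, he.row2 y hyn, Function.update_of_ne hne]
  rw [h1]
  refine ⟨by simp, fun a ha b hb => ?_⟩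
  have hab : ¬ (x = y ∧ y = x) := fun h => hxy h.1
  simp only [res, push, Mem.set_of_ne _ _ _ (by decide : RES ≠ CUR), Mem.set_self,
    Function.update_apply, index_inj hb hxn, index_inj hb hyn]
  by_cases h2 : a = x ∧ b = y
  · obtain ⟨rfl, rfl⟩ := h2
    simp [hxy]
  · by_cases h3 : a = y ∧ b = x
    · obtain ⟨rfl, rfl⟩ := h3
      simp [hxy.symm]
    · simp [h2, h3]

open Classical in
/-- Augmenting lowers the capacity of every cut that separates the source from the sinks by `1`. In
the course of the augmentation, it is lowered by `1` exactly as long as the current vertex of the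
path lies outside the cut. -/
theorem run_augment {m : Mem} (he : Env n k adj m) {E : ℕ → ℕ → ℕ} (hE : res n m = E)
    (hinv : SearchInv (2 * n) E (m SNK) (m VIS) (m NXT)) (hc : m CUR 0 < 2 * n)
    (hv : m VIS (m CUR 0) ≠ 0) {A : Set ℕ} (hcA : m CUR 0 ∈ A)
    (hA : ∀ x < 2 * n, m SNK x ≠ 0 → x ∉ A) :
    cutVal (2 * n) (res n (augment.run m)) A + 1 = cutVal (2 * n) E A := by
  obtain ⟨-, ρ, hρ⟩ := hinv
  have hρn : ∀ x < 2 * n, m VIS x ≠ 0 → ρ x < 2 * n := fun x hx h =>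
    (hρ x hx h).1.trans_le ((Finset.card_filter_le _ _).trans (by simp))
  have hb : (eN + eN).eval m = 2 * n := by simp [he.n_eq, two_mul]
  -- the ranks decrease along the path, so that the edges ahead are still unchanged
  let I : ℕ → Mem → Prop := fun t m' => m' CUR 0 < 2 * n ∧ m VIS (m' CUR 0) ≠ 0 ∧
    (m SNK (m' CUR 0) ≠ 0 ∨ ρ (m' CUR 0) + t ≤ ρ (m CUR 0)) ∧
    cutVal (2 * n) (res n m') A + 1 = cutVal (2 * n) E A + (if m' CUR 0 ∈ A then 1 else 0) ∧
    ∀ x < 2 * n, m VIS x ≠ 0 → m SNK x = 0 → ρ x ≤ ρ (m' CUR 0) → res n m' x (m NXT x) ≠ 0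
  have key : I ((eN + eN).eval m) (augment.run m) := by
    refine run_forTo (I := I) ?_ ?_
    · refine ⟨by simpa using hc, by simpa using hv, Or.inr (by simp), ?_, fun x hx h1 h2 _ => ?_⟩
      · have : res n (m.set 25 0 0) = E := by rw [← hE]; funext x y; simp [res]
        simp [this, hcA]
      · have : res n (m.set 25 0 0) = E := by rw [← hE]; funext x y; simp [res]
        rw [this]
        exact ((hρ x hx h1).2.resolve_left (by simp [h2])).2.2.1
    · intro j m' hj hmj hf ⟨h1, h2, h3, h4, h5⟩
      have he' : Env n k adj m' :=
        he.congr (hf _ (by decide) (by decide)) (hf _ (by decide) (by decide))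
          (hf _ (by decide) (by decide)) (hf _ (by decide) (by decide))
      have hsnk : m' SNK = m SNK := hf _ (by decide) (by decide)
      have hnxt : m' NXT = m NXT := hf _ (by decide) (by decide)
      have hset : ∀ m'' : Mem, res n (m''.set 25 0 (j + 1)) = res n m'' := fun m'' => by
        funext x y; simp [res]
      by_cases hs : m SNK (m' CUR 0) ≠ 0
      · have : augmentBody.run m' = m' := by
          simp only [augmentBody, run_ite, eval_read, eval_lit, hsnk, if_pos hs, run_skip]
        rw [this]
        simp only [I, hset, Mem.set_of_ne _ _ _ (by decide : CUR ≠ 25)]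
        exact ⟨h1, h2, Or.inl hs, h4, h5⟩
      · rw [not_not] at hs
        set x := m' CUR 0 with hx
        obtain ⟨h6, h7, h8, h9⟩ := (hρ x h1 h2).2.resolve_left (by simp [hs])
        have hxy : x ≠ m NXT x := fun h => by rw [← h] at h9; exact lt_irrefl _ h9
        obtain ⟨h10, h11⟩ := run_augmentBody he' hx.symm (congrFun hnxt x) h1 h6 hxy
          (by rw [hsnk, hs])
        have hpush := cutVal_push h1 h6 hxy (Nat.pos_of_ne_zero (h5 x h1 h2 hs le_rfl)) A
        rw [← cutVal_congr h11] at hpush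
        simp only [I, hset, Mem.set_of_ne _ _ _ (by decide : CUR ≠ 25), h10]
        refine ⟨h6, h7, ?_, by omega, fun z hz hz1 hz2 hz3 => ?_⟩
        · have := h3.resolve_left (by simp [hs])
          exact Or.inr (by omega)
        · have hz4 : m NXT z < 2 * n := ((hρ z hz hz1).2.resolve_left (by simp [hz2])).1
          have hzx : z ≠ x := fun h => by rw [h] at hz3; omega
          rw [h11 z hz _ hz4]
          have := h5 z hz hz1 hz2 (by omega)
          unfold push
          rw [if_neg (fun h => hzx h.1)]
          split_ifs <;> omega
  rw [hb] at key
  obtain ⟨h1, h2, h3, h4, -⟩ := key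
  have h5 : m SNK (augment.run m CUR 0) ≠ 0 := h3.resolve_right fun h => by
    have := hρn _ hc hv
    omega
  rw [if_neg (hA _ h1 h5)] at h4
  omega

/-! ### A step of the search -/

theorem res_set (m : Mem) {a : ℕ} (i v : ℕ) (h : RES ≠ a) : res n (m.set a i v) = res n m := by
  funext x y; simp only [res, Mem.set_of_ne _ _ _ h]

/-- The memory holds the state `σ` of the search, and residual capacities for a flow of value
`σ.val`. The flow enters only through its effect on the capacities of the cuts. -/
structure Rep (n : ℕ) (c : ℕ → ℕ → ℕ) (σ : CutState) (m : Mem) : Prop where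
  src_lt : ∀ x ∈ σ.src, x < 2 * n
  src : ∀ x < 2 * n, (m SRC x ≠ 0 ↔ x ∈ σ.src)
  snk : ∀ x < 2 * n, (m SNK x ≠ 0 ↔ x ∈ σ.snk)
  cut : ∀ A, σ.Valid (2 * n) A → cutVal (2 * n) (res n m) A + σ.val = cutVal (2 * n) c A

theorem Rep.congr {c : ℕ → ℕ → ℕ} {σ : CutState} {m m' : Mem} (h : Rep n c σ m)
    (h1 : m' SRC = m SRC) (h2 : m' SNK = m SNK) (h3 : m' RES = m RES) : Rep n c σ m' where
  src_lt := h.src_lt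
  src := by rw [h1]; exact h.src
  snk := by rw [h2]; exact h.snk
  cut := by
    have : res n m' = res n m := by funext x y; simp only [res, h3]
    rw [this]; exact h.cut

theorem SearchInv.congr {N : ℕ} {E : ℕ → ℕ → ℕ} {v₀ v₀' vis nxt : ℕ → ℕ}
    (h : SearchInv N E v₀ vis nxt) (h' : ∀ x < N, v₀ x = v₀' x) : SearchInv N E v₀' vis nxt := by
  obtain ⟨h1, ρ, h2⟩ := h
  refine ⟨fun x hx => by rw [← h' x hx]; exact h1 x hx, ρ, fun x hx hv => ?_⟩
  rw [← h' x hx]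
  exact h2 x hx hv

/-- Looking for a path of positive residual capacities from a source to a sink. -/
def searchPath : Cmd :=
  .forTo 25 (eN + eN) (.write VIS (var 25) (.read SNK (var 25))) ;; bfs ;; findSrc

/-- Either no path exists, some cut is tight, and the vertices that are not visited form the
furthest minimum cut; or a path is found, and no cut is tight. -/
theorem run_searchPath {m : Mem} (he : Env n k adj m) {c : ℕ → ℕ → ℕ} {σ : CutState}
    (h : Rep n c σ m) :
    (searchPath.run m FND 0 = 0 ∧ (∃ A, σ.Tight (2 * n) c A) ∧
      ∀ x < 2 * n, (searchPath.run m VIS x = 0 ↔ x ∈ σ.furthest (2 * n) c)) ∨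
    (searchPath.run m FND 0 ≠ 0 ∧ (¬ ∃ A, σ.Tight (2 * n) c A) ∧
      searchPath.run m CUR 0 < 2 * n ∧ searchPath.run m CUR 0 ∈ σ.src ∧
      searchPath.run m VIS (searchPath.run m CUR 0) ≠ 0 ∧
      SearchInv (2 * n) (res n m) (m SNK) (searchPath.run m VIS) (searchPath.run m NXT)) := by
  have hb : (eN + eN).eval m = 2 * n := by simp [he.n_eq, two_mul]
  set m₁ := (forTo 25 (eN + eN) (.write VIS (var 25) (.read SNK (var 25)))).run m with hm₁
  have hf₁ : ∀ a, a ∉ ([25, 20] : List ℕ) → m₁ a = m a := fun a ha =>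
    run_frame (by simpa [writes] using ha) m
  have hv₁ : ∀ x < 2 * n, m₁ VIS x = m SNK x := by
    intro x hx
    rw [hm₁, run_forTo_pointwise VIS (fun j _ => m SNK j) (by decide), hb, if_pos hx]
    intro j m' _ hmj hf
    simp [hmj, hf SNK (by decide) (by decide)]
  have he₁ : Env n k adj m₁ := he.frame (l := [25, 20]) (by decide) hf₁
  set m₂ := bfs.run m₁ with hm₂
  have hf₂ : ∀ a, a ∉ bfs.writes → m₂ a = m₁ a := fun a ha => run_frame ha m₁
  have he₂ : Env n k adj m₂ := he₁.frame (l := bfs.writes) (by decide) hf₂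
  have hres : res n m₁ = res n m := by
    funext x y; simp only [res, hf₁ RES (by decide)]
  obtain ⟨h1, h2⟩ := run_bfs he₁
  rw [hres] at h1 h2
  have hm₃ : searchPath.run m = findSrc.run m₂ := rfl
  have hV : findSrc.run m₂ VIS = m₂ VIS := run_frame (by decide) _
  have hN : findSrc.run m₂ NXT = m₂ NXT := run_frame (by decide) _
  have hS : m₂ SRC = m SRC := (hf₂ _ (by decide)).trans (hf₁ _ (by decide))
  rw [hm₃, hV, hN]
  -- no edge of positive residual capacity leaves a tight cut
  have htight : ∀ A, σ.Tight (2 * n) c A → ∀ x ∈ A, m₂ VIS x = 0 := by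
    intro A hA x hxA
    have h3 := h.cut A hA.1
    have h4 : cutVal (2 * n) (res n m) A = 0 := by have := hA.2; omega
    rw [cutVal_eq_zero_iff] at h4
    by_contra hvx
    obtain ⟨y, hy, hvy, hxy⟩ := (h2 x (hA.1.1 x hxA)).1 hvx
    have hyA : y ∈ A := by
      clear hvx hvy hy
      induction hxy with
      | refl => exact hxA
      | tail _ hbc ih =>
        by_contra hc
        exact hbc.2.2 (h4 _ hbc.1 _ hbc.2.1 ih hc)
    rw [hv₁ y hy, h.snk y hy] at hvy
    exact hA.1.2.2 y hvy hyA
  rcases run_findSrc he₂ with ⟨h3, h4⟩ | ⟨h3, h4, h5, h6⟩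
  · left
    have hR : σ.Tight (2 * n) c {x | x < 2 * n ∧ m₂ VIS x = 0} := by
      have hval : σ.Valid (2 * n) {x | x < 2 * n ∧ m₂ VIS x = 0} := by
        refine ⟨fun x hx => hx.1, fun x hx => ⟨h.src_lt x hx, ?_⟩, fun x hx hx' => ?_⟩
        · refine h4 x (h.src_lt x hx) ?_
          rw [hS]
          exact (h.src x (h.src_lt x hx)).2 hx
        · refine (h2 x hx'.1).2 ⟨x, hx'.1, ?_, .refl⟩ hx'.2
          rw [hv₁ x hx'.1]
          exact (h.snk x hx'.1).2 hx
      refine ⟨hval, ?_⟩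
      have h5 := h.cut _ hval
      have h6 : cutVal (2 * n) (res n m) {x | x < 2 * n ∧ m₂ VIS x = 0} = 0 := by
        rw [cutVal_eq_zero_iff]
        intro x hx y hy hxA hyA
        by_contra hE
        obtain ⟨z, hz, hvz, hyz⟩ := (h2 y hy).1 fun h' => hyA ⟨hy, h'⟩
        exact (h2 x hx).2 ⟨z, hz, hvz, .head ⟨hx, hy, hE⟩ hyz⟩ hxA.2
      omega
    exact ⟨h3, ⟨_, hR⟩, fun x hx => ⟨fun hx' => ⟨_, hR, hx, hx'⟩, fun ⟨A, hA, hxA⟩ =>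
      htight A hA x hxA⟩⟩
  · right
    rw [hS, h.src _ h4] at h5
    exact ⟨h3, fun ⟨A, hA⟩ => h6 (htight A hA _ (hA.1.2.1 _ h5)), h4, h5, h6, h1.congr hv₁⟩

/-- Choosing the vertex on which the search branches. -/
def pickBranch : Cmd :=
  .assign PCK 0 ;; .forTo 25 eN (.ite (.read VIS (var 25)) .skip (.ite (.read VIS (eN + var 25))
    (.ite (.read SNK (eN + var 25)) .skip (.ite (.read SEP (var 25)) .skip
      (.assign PCK (var 25 + 1)))) .skip))

theorem run_pickBranch {m : Mem} (he : Env n k adj m) {Z R snk : Set ℕ}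
    (hR : ∀ x < 2 * n, (m VIS x = 0 ↔ x ∈ R)) (hs : ∀ x < 2 * n, (m SNK x ≠ 0 ↔ x ∈ snk))
    (hZ : ∀ x < n, (m SEP x ≠ 0 ↔ x ∈ Z)) :
    pickBranch.run m PCK 0 = lastSucc (Branch n Z R snk) n := by
  have hb : eN.eval (m.set PCK 0 0) = n := by simp [he.n_eq]
  have key : pickBranch.run m PCK 0 =
      lastSucc (Branch n Z R snk) (eN.eval (m.set PCK 0 0)) := by
    refine run_forTo (m := m.set PCK 0 0)
      (I := fun t m' => m' PCK 0 = lastSucc (Branch n Z R snk) t) (by simp [lastSucc]) ?_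
    intro j m' hj hmj hf hI
    rw [hb] at hj
    have h1 : m' VIS = m VIS := (hf _ (by decide) (by decide)).trans (by simp)
    have h2 : m' SNK = m SNK := (hf _ (by decide) (by decide)).trans (by simp)
    have h3 : m' SEP = m SEP := (hf _ (by decide) (by decide)).trans (by simp)
    have h4 : m' 0 = m 0 := (hf _ (by decide) (by decide)).trans (by simp)
    have hB : Branch n Z R snk j ↔ (m VIS j = 0 ∧ m VIS (n + j) ≠ 0 ∧ m SNK (n + j) = 0 ∧
        m SEP j = 0) := by
      unfold Branch
      rw [← hR j (by omega), ← hR (n + j) (by omega), ← hs (n + j) (by omega), ← hZ j hj]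
      simp only [ne_eq, not_not]
    simp only [lastSucc, hB, run_ite, run_skip, run_write, eval_read, eval_add, eval_lit, hmj, h1,
      h2, h3, h4, he.n_eq]
    split_ifs <;> simp_all
  rw [key, hb]

/-- One step of the search. -/
def stepCut : Cmd :=
  searchPath ;; .ite (var FND) augment (pickBranch ;; .ite (var PCK)
    (.ite (.read DIG (var IDX)) (.write SRC (eN + var PCK - 1) 1)
      (.write SNK (eN + var PCK - 1) 1)) .skip) ;; .assign IDX (var IDX + 1)

/-- The program simulates `cutStep`, the state being determined by the marks and the capacities. -/
theorem run_stepCut {m : Mem} (he : Env n k adj m) {Z : Set ℕ} {σ : CutState}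
    (h : Rep n (splitCap n adj Z) σ m) (hZ : ∀ x < n, (m SEP x ≠ 0 ↔ x ∈ Z)) :
    Rep n (splitCap n adj Z) (cutStep n adj Z (m DIG (m IDX 0)) σ) (stepCut.run m) ∧
      stepCut.run m IDX 0 = m IDX 0 + 1 := by
  set m₁ := searchPath.run m with hm₁
  have hf₁ : ∀ a, a ∉ searchPath.writes → m₁ a = m a := fun a ha => run_frame ha m
  have he₁ : Env n k adj m₁ := he.run (by decide)
  have hrep₁ : Rep n (splitCap n adj Z) σ m₁ := h.congr (hf₁ _ (by decide)) (hf₁ _ (by decide))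
    (hf₁ _ (by decide))
  have hidx : m₁ IDX = m IDX := hf₁ _ (by decide)
  have hdig : m₁ DIG = m DIG := hf₁ _ (by decide)
  have hres : res n m₁ = res n m := by
    funext x y; simp only [res, hf₁ RES (by decide)]
  rcases run_searchPath he h with ⟨h1, h2, h3⟩ | ⟨h1, h2, h3, h4, h5, h6⟩
  · have hm₂ : stepCut.run m = ((Cmd.ite (var PCK)
        (.ite (.read DIG (var IDX)) (.write SRC (eN + var PCK - 1) 1)
          (.write SNK (eN + var PCK - 1) 1)) .skip) ;;
        .assign IDX (var IDX + 1)).run (pickBranch.run m₁) := by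
      have h1' : m₁ FND 0 = 0 := h1
      simp [stepCut, ← hm₁, h1']
    have hp := run_pickBranch he₁ h3 hrep₁.snk (by rw [hf₁ SEP (by decide)]; exact hZ)
    set m₂ := pickBranch.run m₁ with hm₂'
    have hf₂ : ∀ a, a ∉ pickBranch.writes → m₂ a = m₁ a := fun a ha => run_frame ha m₁
    have hrep₂ : Rep n (splitCap n adj Z) σ m₂ := hrep₁.congr (hf₂ _ (by decide))
      (hf₂ _ (by decide)) (hf₂ _ (by decide))
    have hidx₂ : m₂ IDX = m IDX := (hf₂ _ (by decide)).trans hidx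
    have hdig₂ : m₂ DIG = m DIG := (hf₂ _ (by decide)).trans hdig
    have h0₂ : m₂ 0 0 = n := by rw [hf₂ 0 (by decide), he₁.n_eq]
    rw [hm₂]
    rcases lastSucc_spec (Branch n Z (σ.furthest (2 * n) (splitCap n adj Z)) σ.snk) n with
      ⟨h4, -⟩ | ⟨x, hx, h4, -⟩
    · rw [cutStep_of_stuck h2 h4]
      rw [h4] at hp
      simp only [run_seq, run_ite, eval_read, eval_lit, hp, ne_eq, not_true_eq_false, if_false,
        run_skip, run_write]
      exact ⟨hrep₂.congr (by simp) (by simp) (by simp), by simp [hidx₂]⟩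
    · rw [cutStep_of_branch h2 h4]
      rw [h4] at hp
      have hnx : n + (x + 1) - 1 = n + x := by omega
      simp only [run_seq, run_ite, eval_read, eval_lit, eval_add, eval_sub, hp, ne_eq,
        Nat.succ_ne_zero, not_false_eq_true, if_true, hidx₂, hdig₂, run_write, h0₂, hnx]
      split_ifs with h5
      · refine ⟨⟨hrep₂.src_lt, by simpa using hrep₂.src, fun y hy => ?_, fun A hA => ?_⟩,
          by simp [hidx₂]⟩
        · by_cases hyx : y = n + x
          · simp [hyx]
          · simpa [hyx] using hrep₂.snk y hy
        · have := hrep₂.cut A ⟨hA.1, hA.2.1, fun y hy => hA.2.2 y (Or.inr hy)⟩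
          simpa [res_set] using this
      · refine ⟨⟨?_, fun y hy => ?_, by simpa using hrep₂.snk, fun A hA => ?_⟩,
          by simp [hidx₂]⟩
        · rintro y (rfl | hy)
          exacts [by omega, hrep₂.src_lt y hy]
        · by_cases hyx : y = n + x
          · simp [hyx]
          · simpa [hyx] using hrep₂.src y hy
        · have := hrep₂.cut A ⟨hA.1, fun y hy => hA.2.1 y (Or.inr hy), hA.2.2⟩
          simpa [res_set] using this
  · rw [cutStep_of_not_tight h2]
    have hm₂ : stepCut.run m = (Cmd.assign IDX (var IDX + 1)).run (augment.run m₁) := by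
      have h1' : m₁ FND 0 ≠ 0 := h1
      simp [stepCut, ← hm₁, h1']
    have hf₂ : ∀ a, a ∉ augment.writes → augment.run m₁ a = m₁ a := fun a ha => run_frame ha m₁
    have hS : m₁ SNK = m SNK := hf₁ _ (by decide)
    rw [hm₂]
    refine ⟨⟨h.src_lt, ?_, ?_, fun A hA => ?_⟩, ?_⟩
    · simpa [hf₂ SRC (by decide)] using hrep₁.src
    · simpa [hf₂ SNK (by decide)] using hrep₁.snk
    · have h7 := run_augment he₁ hres (by rw [hS]; exact h6) h3 h5 (A := A) (hA.2.1 _ h4)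
        (fun x hx hx' => hA.2.2 x ((hrep₁.snk x hx).1 hx'))
      have h8 := h.cut A hA
      have h9 : res n ((Cmd.assign IDX (var IDX + 1)).run (augment.run m₁)) =
          res n (augment.run m₁) := by funext x y; simp [res]
      rw [h9]
      change _ + (σ.val + 1) = _
      omega
    · simp [hf₂ IDX (by decide), hidx]

/-! ### The search for a cut and the candidate on the machine -/

/-- Computing the entry of the matrix of capacities in row `25` and column `26`. -/
def capBody : Cmd :=
  .ite (eN - var 25)
    (.ite (eq (var 26) (eN + var 25))
      (.ite (.read SEP (var 25)) (.write RES (.read ROW2 (var 25) + var 26) 0)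
        (.write RES (.read ROW2 (var 25) + var 26) 1))
      (.write RES (.read ROW2 (var 25) + var 26) 0))
    (.ite (eN - var 26)
      (.ite (.read MAT (.read ROW (var 25 - eN) + var 26))
        (.write RES (.read ROW2 (var 25) + var 26) (eN + 1))
        (.write RES (.read ROW2 (var 25) + var 26) 0))
      (.write RES (.read ROW2 (var 25) + var 26) 0))

theorem run_capBody {m : Mem} (he : Env n k adj m) {Z : Set ℕ}
    (hZ : ∀ x < n, (m SEP x ≠ 0 ↔ x ∈ Z)) :
    ∀ x < 2 * n, ∀ y < 2 * n,
      res n ((forTo 25 (eN + eN) (forTo 26 (eN + eN) capBody)).run m) x y =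
        splitCap n adj Z x y := by
  refine run_fill he (by decide) _ fun x hx y hy m' hmx hmy hf => ?_
  have he' : Env n k adj m' := he.congr (hf _ (by decide) (by decide) (by decide))
    (hf _ (by decide) (by decide) (by decide)) (hf _ (by decide) (by decide) (by decide))
    (hf _ (by decide) (by decide) (by decide))
  have hs : m' SEP = m SEP := hf _ (by decide) (by decide) (by decide)
  have h0 : m' 0 0 = n := he'.n_eq
  simp only [capBody, run_ite_apply, run_write, eval_read, eval_add, eval_sub, eval_lit, eval_eq,
    hmx, hmy, hs, h0, he'.row2 x hx, splitCap]
  by_cases hxn : x < n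
  · have h1 : n - x ≠ 0 := by omega
    have h2 := hZ x hxn
    by_cases h3 : y = n + x <;> by_cases h4 : x ∈ Z <;> simp_all
  · have h1 : ¬ n - x ≠ 0 := by omega
    rw [if_neg h1, if_neg hxn]
    by_cases hyn : y < n
    · have h2 : n - y ≠ 0 := by omega
      rw [if_pos h2, he'.row (x - n) (by omega)]
      have h3 := he'.mat (x - n) (by omega) y hyn
      by_cases h4 : adj (x - n) y
      · rw [if_pos (h3.2 h4), if_pos ⟨hyn, h4⟩, Mem.set_self]
      · rw [if_neg (fun h => h4 (h3.1 h)), if_neg (fun h => h4 h.2), Mem.set_self]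
    · have h2 : ¬ n - y ≠ 0 := by omega
      rw [if_neg h2, if_neg (fun h => hyn h.1), Mem.set_self]

/-- Marking the sources and the sinks of a cut problem: the vertices whose label is equal to, or
smaller than, the number of the phase. -/
def initMarks : Cmd := .forTo 25 eN
  (.write SRC (var 25) (eq (.read LAB (var 25)) (var PHASE)) ;; .write SRC (eN + var 25) 0 ;;
    .write SNK (var 25) 0 ;; .write SNK (eN + var 25) (var PHASE - .read LAB (var 25)))

theorem run_initMarks {m : Mem} (he : Env n k adj m) (x : ℕ) (hx : x < n) :
    (initMarks.run m SRC x ≠ 0 ↔ m LAB x = m PHASE 0) ∧ initMarks.run m SRC (n + x) = 0 ∧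
      initMarks.run m SNK x = 0 ∧ (initMarks.run m SNK (n + x) ≠ 0 ↔ m LAB x < m PHASE 0) := by
  have hb : eN.eval m = n := he.n_eq
  have key : ∀ x < eN.eval m,
      (initMarks.run m SRC x ≠ 0 ↔ m LAB x = m PHASE 0) ∧ initMarks.run m SRC (n + x) = 0 ∧
      initMarks.run m SNK x = 0 ∧ (initMarks.run m SNK (n + x) ≠ 0 ↔ m LAB x < m PHASE 0) := by
    refine run_forTo (I := fun t m' => ∀ x < t, (m' SRC x ≠ 0 ↔ m LAB x = m PHASE 0) ∧
      m' SRC (n + x) = 0 ∧ m' SNK x = 0 ∧ (m' SNK (n + x) ≠ 0 ↔ m LAB x < m PHASE 0))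
      (by simp) ?_
    intro j m' hj hmj hf hI x hx
    rw [hb] at hj
    have h0 : m' 0 0 = n := by rw [hf 0 (by decide) (by decide), he.n_eq]
    have h1 : m' LAB = m LAB := hf _ (by decide) (by decide)
    have h2 : m' PHASE = m PHASE := hf _ (by decide) (by decide)
    simp only [run_seq, run_write, eval_read, eval_lit, eval_add, eval_sub, eval_eq, hmj]
    by_cases hxj : x = j
    · subst hxj
      have h3 : x ≠ n + x := by omega
      simp [h0, h1, h2, hmj, Function.update_of_ne h3, Nat.sub_eq_zero_iff_le]
    · have h3 : x ≠ n + j := by omega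
      have h4 : n + x ≠ j := by omega
      have h5 : n + x ≠ n + j := by omega
      simpa [h0, h1, h2, hmj, h3, h4, h5, hxj] using hI x (by omega)
  exact key x (by rw [hb]; exact hx)

/-- Adding the vertices of the cut that was found to the set `SEP`. -/
def collectCut : Cmd := .forTo 25 eN (.ite (.read VIS (var 25)) .skip
  (.ite (.read VIS (eN + var 25)) (.write SEP (var 25) 1) .skip))

/-- The search for a cut. -/
def phase : Cmd :=
  .forTo 25 (eN + eN) (.forTo 26 (eN + eN) capBody) ;; initMarks ;;
    .forTo 34 (eK + eK + eK) stepCut ;; searchPath ;; .ite (var FND) .skip collectCut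

/-- The program adds `foundCut` to the separator if the search ends with a tight cut. Otherwise
nothing is claimed about the separator. -/
theorem run_phase {m : Mem} (he : Env n k adj m) {Z : Set ℕ}
    (hZ : ∀ x < n, (m SEP x ≠ 0 ↔ x ∈ Z)) {S T : Set ℕ}
    (hS : S = {v | v < n ∧ m LAB v = m PHASE 0}) (hT : T = {v | v < n ∧ m LAB v < m PHASE 0})
    {δ : ℕ → ℕ} (hδ : ∀ j < 3 * k, m DIG (m IDX 0 + j) = δ j) :
    phase.run m IDX 0 = m IDX 0 + 3 * k ∧ (CutFound n k adj Z S T δ →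
      ∀ x < n, (phase.run m SEP x ≠ 0 ↔ x ∈ Z ∪ foundCut n k adj Z S T δ)) := by
  set m₁ := (forTo 25 (eN + eN) (forTo 26 (eN + eN) capBody)).run m with hm₁
  have hf₁ : ∀ a, a ∉ ([25, 26, 22] : List ℕ) → m₁ a = m a := fun a ha => run_frame
    (fun h => ha ((by decide : ∀ x ∈ (forTo 25 (eN + eN) (forTo 26 (eN + eN) capBody)).writes,
      x ∈ ([25, 26, 22] : List ℕ)) a h)) m
  have he₁ : Env n k adj m₁ := he.frame (l := [25, 26, 22]) (by decide) hf₁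
  have hcap := run_capBody he hZ
  set m₂ := initMarks.run m₁ with hm₂
  have hf₂ : ∀ a, a ∉ initMarks.writes → m₂ a = m₁ a := fun a ha => run_frame ha m₁
  have he₂ : Env n k adj m₂ := he₁.run (by decide)
  have hres₂ : res n m₂ = res n m₁ := by
    funext x y; simp only [res, hf₂ RES (by decide)]
  have hrep : Rep n (splitCap n adj Z) (initCut n S T) m₂ := by
    have hmk := run_initMarks he₁
    rw [hf₁ LAB (by decide), hf₁ PHASE (by decide)] at hmk
    refine ⟨?_, fun x hx => ?_, fun x hx => ?_, fun A _ => ?_⟩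
    · intro x hx
      rw [hS] at hx
      have := hx.1
      omega
    · change _ ↔ x ∈ S
      rw [hS]
      by_cases hxn : x < n
      · rw [(hmk x hxn).1]
        exact ⟨fun h => ⟨hxn, h⟩, fun h => h.2⟩
      · obtain ⟨y, rfl⟩ := Nat.exists_eq_add_of_le (not_lt.1 hxn)
        exact ⟨fun h => absurd (hmk y (by omega)).2.1 h, fun h => absurd h.1 hxn⟩
    · change _ ↔ ∃ v ∈ T, x = n + v
      rw [hT]
      by_cases hxn : x < n
      · refine ⟨fun h => absurd (hmk x hxn).2.2.1 h, ?_⟩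
        rintro ⟨v, -, rfl⟩
        omega
      · obtain ⟨y, rfl⟩ := Nat.exists_eq_add_of_le (not_lt.1 hxn)
        rw [(hmk y (by omega)).2.2.2]
        refine ⟨fun h => ⟨y, ⟨by omega, h⟩, rfl⟩, ?_⟩
        rintro ⟨v, hv, hyv⟩
        rw [Nat.add_left_cancel hyv]
        exact hv.2
    · rw [hres₂]
      exact cutVal_congr hcap A
  set m₃ := (forTo 34 (eK + eK + eK) stepCut).run m₂ with hm₃
  have hidx₂ : m₂ IDX = m IDX := (hf₂ _ (by decide)).trans (hf₁ _ (by decide))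
  have hdig₂ : m₂ DIG = m DIG := (hf₂ _ (by decide)).trans (hf₁ _ (by decide))
  have hsep₂ : m₂ SEP = m SEP := (hf₂ _ (by decide)).trans (hf₁ _ (by decide))
  have hb : (eK + eK + eK).eval m₂ = 3 * k := by
    simp [he₂.k_eq]; omega
  have key : Rep n (splitCap n adj Z) (cutRun n adj Z δ (initCut n S T) ((eK + eK + eK).eval m₂))
      m₃ ∧ m₃ IDX 0 = m IDX 0 + (eK + eK + eK).eval m₂ := by
    refine run_forTo (I := fun t m' => Rep n (splitCap n adj Z)
      (cutRun n adj Z δ (initCut n S T) t) m' ∧ m' IDX 0 = m IDX 0 + t) ?_ ?_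
    · exact ⟨hrep.congr (by simp) (by simp) (by simp), by simp [hidx₂]⟩
    · intro j m' hj _ hf ⟨hI1, hI2⟩
      rw [hb] at hj
      have he' : Env n k adj m' :=
        he₂.congr (hf _ (by decide) (by decide)) (hf _ (by decide) (by decide))
          (hf _ (by decide) (by decide)) (hf _ (by decide) (by decide))
      have h1 := run_stepCut he' hI1
        (by rw [hf SEP (by decide) (by decide), hsep₂]; exact hZ)
      rw [hf DIG (by decide) (by decide), hdig₂, hI2, hδ j hj] at h1
      exact ⟨h1.1.congr (by simp) (by simp) (by simp), by simpa [add_assoc] using h1.2⟩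
  rw [hb] at key
  have hf₃ : ∀ a, a ∉ 34 :: stepCut.writes → m₃ a = m₂ a := fun a ha => run_frame ha m₂
  have he₃ : Env n k adj m₃ := he₂.frame (l := 34 :: stepCut.writes) (by decide) hf₃
  set m₄ := searchPath.run m₃ with hm₄
  have hf₄ : ∀ a, a ∉ searchPath.writes → m₄ a = m₃ a := fun a ha => run_frame ha m₃
  have he₄ : Env n k adj m₄ := he₃.run (by decide)
  have hm₅ : phase.run m = (Cmd.ite (var FND) .skip collectCut).run m₄ := rfl
  refine ⟨?_, fun hfound x hx => ?_⟩
  · rw [hm₅, run_frame (by decide), hf₄ _ (by decide), key.2]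
  · rcases run_searchPath he₃ key.1 with ⟨h1, h2, h3⟩ | ⟨-, h2, -⟩
    · have h1' : m₄ FND 0 = 0 := h1
      have h3' := h3
      rw [← hm₄] at h3'
      have h4 : phase.run m = collectCut.run m₄ := by rw [hm₅]; simp [h1']
      have hb₄ : eN.eval m₄ = n := he₄.n_eq
      have hsep₄ : m₄ SEP = m SEP := (hf₄ _ (by decide)).trans ((hf₃ _ (by decide)).trans hsep₂)
      rw [h4, collectCut, run_forTo_pointwise SEP
        (fun j s => if m₄ VIS j = 0 ∧ m₄ VIS (n + j) ≠ 0 then 1 else s) (by decide), hb₄,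
        if_pos hx, hsep₄]
      · have h5 : x ∈ foundCut n k adj Z S T δ ↔ m₄ VIS x = 0 ∧ m₄ VIS (n + x) ≠ 0 := by
          rw [ne_eq, h3' x (by omega), h3' (n + x) (by omega)]
          exact ⟨fun h => ⟨h.2.1, h.2.2⟩, fun h => ⟨hx, h.1, h.2⟩⟩
        rw [Set.mem_union, h5, ← hZ x hx]
        by_cases h6 : m₄ VIS x = 0 ∧ m₄ VIS (n + x) ≠ 0
        · simp [h6]
        · simp [h6]
      · intro j m' hj hmj hf
        have h5 : m' VIS = m₄ VIS := hf _ (by decide) (by decide)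
        have h6 : m' 0 0 = n := by rw [hf 0 (by decide) (by decide), he₄.n_eq]
        simp only [run_ite_apply, run_skip, run_write, eval_read, eval_add, eval_lit, hmj, h5, h6]
        by_cases h7 : m₄ VIS j = 0 <;> by_cases h8 : m₄ VIS (n + j) = 0 <;> simp [h7, h8]
    · exact absurd hfound h2

/-- Assigning labels to the vertices of `TSET` according to the digits; all other vertices get the
label `3`. -/
def setLabels : Cmd :=
  .assign IDX 0 ;; .forTo 25 eN (.ite (.read TSET (var 25))
    (.write LAB (var 25) (.read DIG (var IDX)) ;; .assign IDX (var IDX + 1))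
    (.write LAB (var 25) 3))

open Classical in
theorem run_setLabels {m : Mem} (he : Env n k adj m) {T : Set ℕ}
    (hT : ∀ v < n, (m TSET v ≠ 0 ↔ v ∈ T)) :
    setLabels.run m IDX 0 = Nat.count (· ∈ T) n ∧ ∀ v < n, setLabels.run m LAB v =
      if v ∈ T then m DIG (Nat.count (· ∈ T) v) else 3 := by
  have hb : eN.eval (m.set IDX 0 0) = n := by simp [he.n_eq]
  have key : setLabels.run m IDX 0 = Nat.count (· ∈ T) (eN.eval (m.set IDX 0 0)) ∧
      ∀ v < eN.eval (m.set IDX 0 0), setLabels.run m LAB v =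
      if v ∈ T then m DIG (Nat.count (· ∈ T) v) else 3 := by
    refine run_forTo (m := m.set IDX 0 0) (I := fun t m' => m' IDX 0 = Nat.count (· ∈ T) t ∧
      ∀ v < t, m' LAB v = if v ∈ T then m DIG (Nat.count (· ∈ T) v) else 3) (by simp) ?_
    intro j m' hj hmj hf ⟨hI1, hI2⟩
    rw [hb] at hj
    have h1 : m' TSET = m TSET := (hf _ (by decide) (by decide)).trans (by simp)
    have h2 : m' DIG = m DIG := (hf _ (by decide) (by decide)).trans (by simp)
    have h3 := hT j hj
    by_cases hjT : j ∈ T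
    · have h4 : m TSET j ≠ 0 := h3.2 hjT
      simp only [run_ite, run_seq, run_write, eval_read, eval_add, eval_lit, hmj, h1, h2, if_pos h4,
        hI1]
      refine ⟨by simp [hI1, Nat.count_succ, hjT], fun v hv => ?_⟩
      by_cases hvj : v = j
      · subst hvj; simp [hjT]
      · simpa [hvj] using hI2 v (by omega)
    · have h4 : ¬ m TSET j ≠ 0 := fun h => hjT (h3.1 h)
      simp only [run_ite, run_seq, run_write, eval_read, eval_add, eval_lit, hmj, h1, if_neg h4]
      refine ⟨by simp [hI1, Nat.count_succ, hjT], fun v hv => ?_⟩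
      by_cases hvj : v = j
      · subst hvj; simp [hjT]
      · simpa [hvj] using hI2 v (by omega)
  rwa [hb] at key

/-- Computing the candidate for a balanced separator that belongs to the digits in `DIG`. -/
def findCandidate : Cmd :=
  .forTo 25 eN (.write SEP (var 25) 0) ;; setLabels ;;
    .assign PHASE 2 ;; phase ;; .assign PHASE 1 ;; phase

/-- If there is a balanced separator with at most `k - 1` vertices, then some sequence of `8 * k`
digits makes the program find one. -/
theorem exists_digits_findCandidate (hk : 1 ≤ k) (hkn : k ≤ n)
    (hadj : ∀ u v, adj u v → u < n ∧ v < n) {T : Set ℕ} (hT : ∀ v ∈ T, v < n)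
    (hTc : T.ncard = 2 * k - 1) {Z : Set ℕ} (hZn : ∀ v ∈ Z, v < n) (hZ : Z.ncard ≤ k - 1)
    (h : GoodSep n adj T (k - 1) Z) :
    ∃ dig : ℕ → ℕ, (∀ i, dig i ≤ 2) ∧ ∀ m : Mem, Env n k adj m →
      (∀ v < n, (m TSET v ≠ 0 ↔ v ∈ T)) → (∀ i < 8 * k, m DIG i = dig i) →
      {v | v < n ∧ findCandidate.run m SEP v ≠ 0}.ncard ≤ k - 1 ∧
        GoodSep n adj T (k - 1) {v | v < n ∧ findCandidate.run m SEP v ≠ 0} := by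
  classical
  obtain ⟨lab, δ₁, δ₂, hl, hl3, hδ₁, hδ₂, hF, hc, hg⟩ :=
    exists_candidate hk hkn hadj hT hTc hZn hZ h
  have hcount : Nat.count (· ∈ T) n = 2 * k - 1 := by
    rw [Nat.count_eq_card_filter_range, ← hTc, ← Set.ncard_coe_finset]
    congr 1
    ext v
    simpa using hT v
  -- the digits are the labels of the vertices of `T` in increasing order, followed by the digits of
  -- the two searches
  obtain ⟨dig, hdef⟩ : ∃ dig : ℕ → ℕ, ∀ i, dig i =
      if i < 2 * k - 1 then min 2 (lab (Nat.nth (· ∈ T) i)) else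
      if i < 2 * k - 1 + 3 * k then δ₁ (i - (2 * k - 1)) else δ₂ (i - (2 * k - 1 + 3 * k)) :=
    ⟨_, fun _ => rfl⟩
  refine ⟨dig, fun i => ?_, fun m he hmT hdig => ?_⟩
  · rw [hdef]
    have := hδ₁ (i - (2 * k - 1))
    have := hδ₂ (i - (2 * k - 1 + 3 * k))
    split_ifs <;> omega
  · suffices hsep : ∀ v < n, (findCandidate.run m SEP v ≠ 0 ↔ v ∈ candidate n k adj lab δ₁ δ₂) by
      have : {v | v < n ∧ findCandidate.run m SEP v ≠ 0} = candidate n k adj lab δ₁ δ₂ := by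
        ext v
        exact ⟨fun hv => (hsep v hv.1).1 hv.2, fun hv =>
          ⟨candidate_lt v hv, (hsep v (candidate_lt v hv)).2 hv⟩⟩
      rw [this]
      exact ⟨hc, hg⟩
    set m₁ := (forTo 25 eN (.write SEP (var 25) 0)).run m with hm₁
    have hf₁ : ∀ a, a ∉ ([25, 40] : List ℕ) → m₁ a = m a := fun a ha =>
      run_frame (by simpa [writes] using ha) m
    have he₁ : Env n k adj m₁ := he.frame (l := [25, 40]) (by decide) hf₁
    have hb : eN.eval m = n := he.n_eq
    have hs₁ : ∀ v < n, m₁ SEP v = 0 := by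
      intro v hv
      rw [hm₁, run_forTo_pointwise SEP (fun _ _ => 0) (by decide), hb, if_pos hv]
      intro j m' _ hmj _
      simp [hmj]
    set m₂ := setLabels.run m₁ with hm₂
    have hf₂ : ∀ a, a ∉ setLabels.writes → m₂ a = m₁ a := fun a ha => run_frame ha m₁
    have he₂ : Env n k adj m₂ := he₁.run (by decide)
    obtain ⟨h1, h2⟩ := run_setLabels he₁ (T := T) (by rw [hf₁ TSET (by decide)]; exact hmT)
    rw [← hm₂, hcount] at h1
    have hlab : ∀ v < n, m₂ LAB v = lab v := by
      intro v hv
      rw [hm₂, h2 v hv, hf₁ DIG (by decide)]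
      by_cases hvT : v ∈ T
      · have h3 : Nat.count (· ∈ T) v < 2 * k - 1 := by
          rw [← hcount]
          exact Nat.count_strict_mono hvT hv
        rw [if_pos hvT, hdig _ (by omega), hdef, if_pos h3, Nat.nth_count hvT,
          min_eq_right (hl v hvT)]
      · rw [if_neg hvT, hl3 v hvT]
    have hdig₂ : m₂ DIG = m DIG := (hf₂ _ (by decide)).trans (hf₁ _ (by decide))
    -- the first search
    set m₃ := (Cmd.assign PHASE 2).run m₂ with hm₃
    have hf₃ : ∀ a, a ≠ PHASE → m₃ a = m₂ a := fun a ha => Mem.set_of_ne _ _ _ ha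
    have he₃ : Env n k adj m₃ := he₂.run (by decide)
    have hph₃ : m₃ PHASE 0 = 2 := by simp [hm₃]
    set Z₁ := foundCut n k adj ∅ {v | v < n ∧ lab v = 2} {v | v < n ∧ lab v < 2} δ₁ with hZ₁
    obtain ⟨h3, h4⟩ := run_phase (Z := ∅) (S := {v | v < n ∧ lab v = 2})
      (T := {v | v < n ∧ lab v < 2}) (δ := δ₁) he₃
      (fun v hv => by rw [hf₃ SEP (by decide), hf₂ SEP (by decide), hs₁ v hv]; simp)
      (by
        ext v
        rw [hph₃, hf₃ LAB (by decide)]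
        exact and_congr_right fun hv => by rw [hlab v hv])
      (by
        ext v
        rw [hph₃, hf₃ LAB (by decide)]
        exact and_congr_right fun hv => by rw [hlab v hv])
      (fun j hj => by
        rw [hf₃ DIG (by decide), hf₃ IDX (by decide), hdig₂, h1, hdig _ (by omega), hdef,
          if_neg (by omega), if_pos (by omega), Nat.add_sub_cancel_left])
    have h4' := h4 hF.1
    rw [Set.empty_union, ← hZ₁] at h4'
    rw [hf₃ IDX (by decide), h1] at h3
    set m₄ := phase.run m₃ with hm₄
    have hf₄ : ∀ a, a ∉ phase.writes → m₄ a = m₃ a := fun a ha => run_frame ha m₃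
    have he₄ : Env n k adj m₄ := he₃.run (by decide)
    -- the second search
    set m₅ := (Cmd.assign PHASE 1).run m₄ with hm₅
    have hf₅ : ∀ a, a ≠ PHASE → m₅ a = m₄ a := fun a ha => Mem.set_of_ne _ _ _ ha
    have he₅ : Env n k adj m₅ := he₄.run (by decide)
    have hph₅ : m₅ PHASE 0 = 1 := by simp [hm₅]
    have hlab₅ : m₅ LAB = m₂ LAB :=
      (hf₅ _ (by decide)).trans ((hf₄ _ (by decide)).trans (hf₃ _ (by decide)))
    have hdig₅ : m₅ DIG = m₂ DIG :=
      (hf₅ _ (by decide)).trans ((hf₄ _ (by decide)).trans (hf₃ _ (by decide)))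
    obtain ⟨-, h5⟩ := run_phase (Z := Z₁) (S := {v | v < n ∧ lab v = 1})
      (T := {v | v < n ∧ lab v < 1}) (δ := δ₂) he₅
      (fun v hv => by rw [hf₅ SEP (by decide)]; exact h4' v hv)
      (by
        ext v
        rw [hph₅, hlab₅]
        exact and_congr_right fun hv => by rw [hlab v hv])
      (by
        ext v
        rw [hph₅, hlab₅]
        exact and_congr_right fun hv => by rw [hlab v hv])
      (fun j hj => by
        rw [hf₅ IDX (by decide), h3, hdig₅, hdig₂, hdig _ (by omega), hdef,
          if_neg (by omega), if_neg (by omega), Nat.add_sub_cancel_left])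
    exact h5 hF.2

/-! ### Testing candidates for balanced separators -/

-- `BLK` marks deleted vertices, `RM` is a reachability matrix, `CNT` a counter, and `CARRY` the
-- carry in the addition of `1`. `OKAY` is the result of a test, and `FOUND` tells whether a
-- balanced separator has been found.
notation "BLK" => 50
notation "RM" => 51
notation "OKAY" => 52
notation "CNT" => 53
notation "FOUND" => 54
notation "CARRY" => 56

/-- Computing the entry in row `25` and column `26` of the adjacency matrix of the digraph without
the vertices in `BLK`. -/
def adjBody : Cmd :=
  .ite (eN - var 25) (.ite (eN - var 26) (.ite (.read BLK (var 25))
    (.write RES (.read ROW2 (var 25) + var 26) 0) (.ite (.read BLK (var 26))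
    (.write RES (.read ROW2 (var 25) + var 26) 0)
    (.write RES (.read ROW2 (var 25) + var 26) (.read MAT (.read ROW (var 25) + var 26)))))
    (.write RES (.read ROW2 (var 25) + var 26) 0)) (.write RES (.read ROW2 (var 25) + var 26) 0)

open Classical in
theorem run_adjBody {m : Mem} (he : Env n k adj m) :
    ∀ x < 2 * n, ∀ y < 2 * n,
      res n ((forTo 25 (eN + eN) (forTo 26 (eN + eN) adjBody)).run m) x y =
        if x < n ∧ y < n ∧ m BLK x = 0 ∧ m BLK y = 0 then m MAT (x * n + y) else 0 := by
  refine run_fill he (by decide) _ fun x hx y hy m' hmx hmy hf => ?_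
  have he' : Env n k adj m' := he.congr (hf _ (by decide) (by decide) (by decide))
    (hf _ (by decide) (by decide) (by decide)) (hf _ (by decide) (by decide) (by decide))
    (hf _ (by decide) (by decide) (by decide))
  have hs : m' BLK = m BLK := hf _ (by decide) (by decide) (by decide)
  have hM : m' MAT = m MAT := hf _ (by decide) (by decide) (by decide)
  have h0 : m' 0 0 = n := he'.n_eq
  simp only [adjBody, run_ite_apply, run_write, eval_read, eval_add, eval_sub, eval_lit, hmx,
    hmy, hs, h0, hM, he'.row2 x hx, Mem.set_self]
  by_cases hxn : x < n
  · have h1 : n - x ≠ 0 := by omega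
    rw [if_pos h1, he'.row x hxn]
    by_cases hyn : y < n
    · have h2 : n - y ≠ 0 := by omega
      rw [if_pos h2]
      by_cases h3 : m BLK x = 0 <;> by_cases h4 : m BLK y = 0 <;> simp [h3, h4, hxn, hyn]
    · have h2 : ¬ n - y ≠ 0 := by omega
      rw [if_neg h2, if_neg (fun h => hyn h.2.1)]
  · have h1 : ¬ n - x ≠ 0 := by omega
    rw [if_neg h1, if_neg (fun h => hxn h.1)]

/-- Computing one column of the reachability matrix. -/
def reachBody : Cmd :=
  .forTo 25 (eN + eN) (.write VIS (var 25) (eq (var 25) (var 27))) ;; bfs ;;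
    .forTo 25 eN (.write RM (.read ROW (var 25) + var 27) (.read VIS (var 25)))

/-- Computing the reachability matrix `RM` of the digraph without the vertices in `BLK`. -/
def reachMat : Cmd :=
  .forTo 25 (eN + eN) (.forTo 26 (eN + eN) adjBody) ;; .forTo 27 eN reachBody

theorem run_reachBody {m : Mem} (he : Env n k adj m) {v : ℕ} (hv : m 27 0 = v) (hvn : v < n)
    {u w : ℕ} (hu : u < n) (hw : w < n) :
    (w ≠ v → reachBody.run m RM (u * n + w) = m RM (u * n + w)) ∧
    (reachBody.run m RM (u * n + v) ≠ 0 ↔ ReflTransGen (Pos (2 * n) (res n m)) u v) := by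
  have hb : (eN + eN).eval m = 2 * n := by simp [he.n_eq, two_mul]
  set m₁ := (forTo 25 (eN + eN) (.write VIS (var 25) (eq (var 25) (var 27)))).run m with hm₁
  have hf₁ : ∀ a, a ∉ ([25, 20] : List ℕ) → m₁ a = m a := fun a ha =>
    run_frame (by simpa [writes] using ha) m
  have hv₁ : ∀ x < 2 * n, m₁ VIS x = if x = v then 1 else 0 := by
    intro x hx
    rw [hm₁, run_forTo_pointwise VIS (fun j _ => if j = v then 1 else 0) (by decide), hb, if_pos hx]
    intro j m' _ hmj hf
    simp [hmj, hf 27 (by decide) (by decide), eval_eq, hv]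
  have he₁ : Env n k adj m₁ := he.frame (l := [25, 20]) (by decide) hf₁
  obtain ⟨-, h2⟩ := run_bfs he₁
  have hres : res n m₁ = res n m := by
    funext x y; simp only [res, hf₁ RES (by decide)]
  rw [hres] at h2
  set m₂ := bfs.run m₁ with hm₂
  have hf₂ : ∀ a, a ∉ bfs.writes → m₂ a = m₁ a := fun a ha => run_frame ha m₁
  have he₂ : Env n k adj m₂ := he₁.run (by decide)
  have hb₂ : eN.eval m₂ = n := he₂.n_eq
  have hRM : m₂ RM = m RM := (hf₂ _ (by decide)).trans (hf₁ _ (by decide))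
  have hv₂ : m₂ 27 0 = v := by rw [hf₂ 27 (by decide), hf₁ 27 (by decide), hv]
  have key : ∀ u < n, (∀ w < n, w ≠ v → reachBody.run m RM (u * n + w) = m RM (u * n + w)) ∧
      (u < eN.eval m₂ → reachBody.run m RM (u * n + v) = m₂ VIS u) := by
    refine run_forTo (m := m₂) (I := fun t m' => ∀ u < n,
      (∀ w < n, w ≠ v → m' RM (u * n + w) = m RM (u * n + w)) ∧
      (u < t → m' RM (u * n + v) = m₂ VIS u)) (by simp [hRM]) ?_
    intro j m' hj hmj hf hI u hu
    rw [hb₂] at hj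
    have h3 : m' ROW j = j * n := by rw [hf ROW (by decide) (by decide), he₂.row j hj]
    have h4 : m' 27 0 = v := by rw [hf 27 (by decide) (by decide), hv₂]
    have h5 : m' VIS = m₂ VIS := hf _ (by decide) (by decide)
    simp only [run_write, eval_add, eval_read, eval_lit, hmj, h3, h4, h5,
      Mem.set_of_ne _ _ _ (by decide : RM ≠ 25), Mem.set_self, Function.update_apply]
    refine ⟨fun w hw hwv => ?_, fun huj => ?_⟩
    · rw [if_neg (fun h => hwv ((index_inj hw hvn).1 h).2)]
      exact (hI u hu).1 w hw hwv
    · by_cases h6 : u = j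
      · subst h6; simp
      · rw [if_neg (fun h => h6 ((index_inj hvn hvn).1 h).1)]
        exact (hI u hu).2 (by omega)
  refine ⟨(key u hu).1 w hw, ?_⟩
  rw [(key u hu).2 (by rw [hb₂]; exact hu), h2 u (by omega)]
  refine ⟨?_, fun h => ⟨v, by omega, by simp [hv₁ v (by omega)], h⟩⟩
  rintro ⟨y, hy, hvy, h⟩
  rw [hv₁ y hy] at hvy
  have : y = v := by by_contra h'; simp [h'] at hvy
  rwa [← this]

theorem run_reachMat {m : Mem} (he : Env n k adj m) (hadj : ∀ u v, adj u v → u < n ∧ v < n)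
    {B : Set ℕ} (hB : ∀ x < n, (m BLK x ≠ 0 ↔ x ∈ B)) :
    ∀ u < n, ∀ v < n, (reachMat.run m RM (u * n + v) ≠ 0 ↔ Reach adj B u v) := by
  set m₁ := (forTo 25 (eN + eN) (forTo 26 (eN + eN) adjBody)).run m with hm₁
  have hf₁ : ∀ a, a ∉ ([25, 26, 22] : List ℕ) → m₁ a = m a := fun a ha => run_frame
    (fun h => ha ((by decide : ∀ x ∈ (forTo 25 (eN + eN) (forTo 26 (eN + eN) adjBody)).writes,
      x ∈ ([25, 26, 22] : List ℕ)) a h)) m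
  have he₁ : Env n k adj m₁ := he.frame (l := [25, 26, 22]) (by decide) hf₁
  have hpos : Pos (2 * n) (res n m₁) = AvoidAdj adj B := by
    funext x y
    refine propext ⟨fun ⟨hx, hy, h⟩ => ?_, fun ⟨h1, h2, h3⟩ => ?_⟩
    · rw [run_adjBody he x hx y hy] at h
      split_ifs at h with h'
      · obtain ⟨h1, h2, h3, h4⟩ := h'
        exact ⟨(he.mat x h1 y h2).1 h, fun h' => (hB x h1).2 h' h3, fun h' => (hB y h2).2 h' h4⟩
      · exact absurd rfl h
    · obtain ⟨h4, h5⟩ := hadj x y h1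
      refine ⟨by omega, by omega, ?_⟩
      rw [run_adjBody he x (by omega) y (by omega), if_pos]
      · exact (he.mat x h4 y h5).2 h1
      · refine ⟨h4, h5, ?_, ?_⟩
        · by_contra h'; exact h2 ((hB x h4).1 h')
        · by_contra h'; exact h3 ((hB y h5).1 h')
  have hb : eN.eval m₁ = n := he₁.n_eq
  have key : ∀ u < n, ∀ v < eN.eval m₁, (reachMat.run m RM (u * n + v) ≠ 0 ↔ Reach adj B u v) := by
    refine run_forTo (m := m₁) (I := fun t m' => ∀ u < n, ∀ v < t,
      (m' RM (u * n + v) ≠ 0 ↔ Reach adj B u v)) (by simp) ?_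
    intro j m' hj hmj hf hI u hu v hv
    rw [hb] at hj
    have he' : Env n k adj m' :=
      he₁.congr (hf _ (by decide) (by decide)) (hf _ (by decide) (by decide))
        (hf _ (by decide) (by decide)) (hf _ (by decide) (by decide))
    have hres : res n m' = res n m₁ := by
      funext x y; simp only [res, hf RES (by decide) (by decide)]
    rw [Mem.set_of_ne _ _ _ (by decide)]
    have h1 := run_reachBody he' hmj hj hu (w := v) (by omega)
    by_cases hvj : v = j
    · subst hvj
      rw [h1.2, hres, hpos]
    · rw [h1.1 hvj]
      exact hI u hu v (by omega)
  rwa [hb] at key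

/-- Counting the vertices of `TSET` in the strong component of the vertex `27`. -/
def countComp : Cmd :=
  .assign CNT 0 ;; .forTo 25 eN (.ite (.read TSET (var 25))
    (.ite (.read RM (.read ROW (var 25) + var 27)) (.ite (.read RM (.read ROW (var 27) + var 25))
      (.assign CNT (var CNT + 1)) .skip) .skip) .skip)

/-- Testing whether `SEP` is a balanced separator for `TSET` with at most `k - 1` vertices. -/
def verify : Cmd :=
  .forTo 25 eN (.write BLK (var 25) (.read SEP (var 25))) ;; reachMat ;; .assign OKAY 1 ;;
    .assign CNT 0 ;; .forTo 25 eN (.ite (.read SEP (var 25)) (.assign CNT (var CNT + 1)) .skip) ;;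
    .ite (var CNT + 1 - eK) (.assign OKAY 0) .skip ;;
    .forTo 27 eN (.ite (.read SEP (var 27)) .skip
      (countComp ;; .ite (var CNT + 1 - eK) (.assign OKAY 0) .skip))

/-- The content of `SEP` as a set. -/
def sepSet (n : ℕ) (m : Mem) : Set ℕ := {v | v < n ∧ m SEP v ≠ 0}

theorem ncard_eq_card_filter {P : ℕ → Prop} [DecidablePred P] (n : ℕ) :
    {v | v < n ∧ P v}.ncard = ((range n).filter P).card := by
  rw [← Set.ncard_coe_finset]
  congr 1
  ext v
  simp

theorem run_countComp {m : Mem} (he : Env n k adj m) {Z T : Set ℕ} (hT' : ∀ v ∈ T, v < n)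
    (hT : ∀ v < n, (m TSET v ≠ 0 ↔ v ∈ T))
    (hR : ∀ u < n, ∀ v < n, (m RM (u * n + v) ≠ 0 ↔ Reach adj Z u v)) {v : ℕ} (hv : v < n)
    (hmv : m 27 0 = v) :
    countComp.run m CNT 0 = {u | u ∈ T ∧ Reach adj Z u v ∧ Reach adj Z v u}.ncard := by
  classical
  have hb : eN.eval (m.set CNT 0 0) = n := by simp [he.n_eq]
  have h1 : {u | u ∈ T ∧ Reach adj Z u v ∧ Reach adj Z v u} =
      {u | u < n ∧ (u ∈ T ∧ Reach adj Z u v ∧ Reach adj Z v u)} := by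
    ext u
    exact ⟨fun h => ⟨hT' u h.1, h⟩, fun h => h.2⟩
  rw [h1, ncard_eq_card_filter]
  have h2 := run_forTo_count (i := 25) (b := eN) (m := m.set CNT 0 0)
    (p := .ite (.read TSET (var 25)) (.ite (.read RM (.read ROW (var 25) + var 27))
      (.ite (.read RM (.read ROW (var 27) + var 25))
      (.assign CNT (var CNT + 1)) .skip) .skip) .skip) CNT
      (fun u => u ∈ T ∧ Reach adj Z u v ∧ Reach adj Z v u) (by decide) (by
        intro j m' hj hmj hf
        rw [hb] at hj
        have h3 : m' TSET = m TSET := (hf _ (by decide) (by decide)).trans (by simp)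
        have h4 : m' RM = m RM := (hf _ (by decide) (by decide)).trans (by simp)
        have h5 : m' ROW = m ROW := (hf _ (by decide) (by decide)).trans (by simp)
        have h6 : m' 27 0 = v := by rw [hf 27 (by decide) (by decide)]; simpa using hmv
        have h7 := hT j hj
        have h8 := hR j hj v hv
        have h9 := hR v hv j hj
        simp only [run_ite_apply₂, run_write, run_skip, eval_read, eval_add, eval_lit, hmj, h3, h4,
          h5, h6, he.row j hj, he.row v hv, h7, h8, h9]
        split_ifs <;> simp_all)
  rw [hb] at h2
  have h3 : countComp.run m = (forTo 25 eN (.ite (.read TSET (var 25))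
    (.ite (.read RM (.read ROW (var 25) + var 27)) (.ite (.read RM (.read ROW (var 27) + var 25))
      (.assign CNT (var CNT + 1)) .skip) .skip) .skip)).run (m.set CNT 0 0) := rfl
  rw [h3, h2]
  simp

theorem run_verify {m : Mem} (he : Env n k adj m) (hk : 1 ≤ k)
    (hadj : ∀ u v, adj u v → u < n ∧ v < n) {T : Set ℕ} (hT' : ∀ v ∈ T, v < n)
    (hT : ∀ v < n, (m TSET v ≠ 0 ↔ v ∈ T)) :
    verify.run m OKAY 0 ≠ 0 ↔
      (sepSet n m).ncard ≤ k - 1 ∧ GoodSep n adj T (k - 1) (sepSet n m) := by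
  classical
  set m₁ := (forTo 25 eN (.write BLK (var 25) (.read SEP (var 25)))).run m with hm₁
  have hf₁ : ∀ a, a ∉ ([25, 50] : List ℕ) → m₁ a = m a := fun a ha =>
    run_frame (by simpa [writes] using ha) m
  have he₁ : Env n k adj m₁ := he.frame (l := [25, 50]) (by decide) hf₁
  have hb : eN.eval m = n := he.n_eq
  have hB₁ : ∀ x < n, (m₁ BLK x ≠ 0 ↔ x ∈ sepSet n m) := by
    intro x hx
    rw [hm₁, run_forTo_pointwise BLK (fun j _ => m SEP j) (by decide), hb, if_pos hx]
    · exact ⟨fun h => ⟨hx, h⟩, fun h => h.2⟩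
    · intro j m' _ hmj hf
      simp [hmj, hf SEP (by decide) (by decide)]
  set m₂ := reachMat.run m₁ with hm₂
  have hf₂ : ∀ a, a ∉ reachMat.writes → m₂ a = m₁ a := fun a ha => run_frame ha m₁
  have he₂ : Env n k adj m₂ := he₁.run (by decide)
  have hR : ∀ u < n, ∀ v < n, (m₂ RM (u * n + v) ≠ 0 ↔ Reach adj (sepSet n m) u v) :=
    run_reachMat he₁ hadj hB₁
  set m₃ := (m₂.set OKAY 0 1).set CNT 0 0 with hm₃
  have hf₃ : ∀ a, a ≠ OKAY → a ≠ CNT → m₃ a = m₂ a := fun a h1 h2 => by simp [hm₃, h1, h2]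
  have he₃ : Env n k adj m₃ := he₂.congr (hf₃ _ (by decide) (by decide))
    (hf₃ _ (by decide) (by decide)) (hf₃ _ (by decide) (by decide)) (hf₃ _ (by decide) (by decide))
  have hsep₃ : m₃ SEP = m SEP :=
    (hf₃ _ (by decide) (by decide)).trans ((hf₂ _ (by decide)).trans (hf₁ _ (by decide)))
  have hb₃ : eN.eval m₃ = n := he₃.n_eq
  set m₄ := (forTo 25 eN (.ite (.read SEP (var 25)) (.assign CNT (var CNT + 1)) .skip)).run m₃
    with hm₄
  have hf₄ : ∀ a, a ∉ ([25, 53] : List ℕ) → m₄ a = m₃ a := fun a ha =>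
    run_frame (by simpa [writes] using ha) m₃
  have he₄ : Env n k adj m₄ := he₃.frame (l := [25, 53]) (by decide) hf₄
  have hcnt : m₄ CNT 0 = (sepSet n m).ncard := by
    rw [hm₄, run_forTo_count CNT (fun v => m SEP v ≠ 0) (by decide), hb₃, sepSet,
      ncard_eq_card_filter]
    · simp [hm₃]
    · intro j m' _ hmj hf
      have h3 : m' SEP = m SEP := (hf _ (by decide) (by decide)).trans hsep₃
      simp only [run_ite_apply₂, run_write, run_skip, eval_read, eval_add, eval_lit, hmj, h3]
      split_ifs <;> simp
  set m₅ := (Cmd.ite (var CNT + 1 - eK) (.assign OKAY 0) .skip).run m₄ with hm₅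
  have hf₅ : ∀ a, a ∉ ([52] : List ℕ) → m₅ a = m₄ a := fun a ha =>
    run_frame (by simpa [writes] using ha) m₄
  have he₅ : Env n k adj m₅ := he₄.frame (l := [52]) (by decide) hf₅
  have hok : m₅ OKAY 0 ≠ 0 ↔ (sepSet n m).ncard ≤ k - 1 := by
    have h1 : m₄ OKAY 0 = 1 := by rw [hf₄ OKAY (by decide)]; simp [hm₃]
    simp only [hm₅, run_ite_apply₂, eval_sub, eval_add, eval_read, eval_lit, hcnt, he₄.k_eq,
      run_write, run_skip]
    split_ifs with h2
    · simp; omega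
    · rw [h1]; simp; omega
  have hb₅ : eN.eval m₅ = n := he₅.n_eq
  have hR₅ : m₅ RM = m₂ RM := (hf₅ _ (by decide)).trans ((hf₄ _ (by decide)).trans
    (hf₃ _ (by decide) (by decide)))
  have hsep₅ : m₅ SEP = m SEP := (hf₅ _ (by decide)).trans ((hf₄ _ (by decide)).trans hsep₃)
  have hT₅ : m₅ TSET = m TSET := (hf₅ _ (by decide)).trans ((hf₄ _ (by decide)).trans
    ((hf₃ _ (by decide) (by decide)).trans ((hf₂ _ (by decide)).trans (hf₁ _ (by decide)))))
  have key : verify.run m OKAY 0 ≠ 0 ↔ (sepSet n m).ncard ≤ k - 1 ∧ ∀ v < eN.eval m₅,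
      v ∉ sepSet n m →
      {u | u ∈ T ∧ Reach adj (sepSet n m) u v ∧ Reach adj (sepSet n m) v u}.ncard ≤ k - 1 := by
    refine run_forTo (m := m₅) (I := fun t m' => m' OKAY 0 ≠ 0 ↔ (sepSet n m).ncard ≤ k - 1 ∧
      ∀ v < t, v ∉ sepSet n m →
      {u | u ∈ T ∧ Reach adj (sepSet n m) u v ∧ Reach adj (sepSet n m) v u}.ncard ≤ k - 1) ?_ ?_
    · simpa using hok
    · intro j m' hj hmj hf hI
      rw [hb₅] at hj
      have hsplit : (∀ v < j + 1, v ∉ sepSet n m →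
          {u | u ∈ T ∧ Reach adj (sepSet n m) u v ∧ Reach adj (sepSet n m) v u}.ncard ≤ k - 1) ↔
          (∀ v < j, v ∉ sepSet n m →
          {u | u ∈ T ∧ Reach adj (sepSet n m) u v ∧ Reach adj (sepSet n m) v u}.ncard ≤ k - 1) ∧
          (j ∉ sepSet n m →
          {u | u ∈ T ∧ Reach adj (sepSet n m) u j ∧ Reach adj (sepSet n m) j u}.ncard ≤ k - 1) := by
        refine ⟨fun h => ⟨fun v hv => h v (by omega), h j (by omega)⟩, fun h v hv => ?_⟩
        rcases Nat.lt_succ_iff_lt_or_eq.1 hv with h' | rfl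
        exacts [h.1 v h', h.2]
      rw [hsplit, ← and_assoc, ← hI, Mem.set_of_ne _ _ _ (by decide)]
      have he' : Env n k adj m' :=
        he₅.congr (hf _ (by decide) (by decide)) (hf _ (by decide) (by decide))
          (hf _ (by decide) (by decide)) (hf _ (by decide) (by decide))
      have hs' : m' SEP = m SEP := (hf _ (by decide) (by decide)).trans hsep₅
      have hjs : j ∈ sepSet n m ↔ m SEP j ≠ 0 := ⟨fun h => h.2, fun h => ⟨hj, h⟩⟩
      simp only [run_ite_apply₂, run_skip, eval_read, eval_lit, hmj, hs', hjs]
      by_cases h1 : m SEP j ≠ 0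
      · rw [if_pos h1]
        simp [h1]
      · rw [if_neg h1]
        have h2 := run_countComp he' (Z := sepSet n m) hT'
          (by rw [hf TSET (by decide) (by decide), hT₅]; exact hT)
          (by rw [hf RM (by decide) (by decide), hR₅]; exact hR) hj hmj
        have hf₆ : ∀ a, a ∉ countComp.writes → countComp.run m' a = m' a := fun a ha =>
          run_frame ha m'
        simp only [run_seq, run_ite_apply₂, run_write, run_skip, eval_read, eval_lit, eval_sub,
          eval_add, h2, hf₆ 0 (by decide), hf₆ OKAY (by decide), he'.k_eq, h1, not_false_eq_true,
          forall_true_left]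
        generalize {u | u ∈ T ∧ Reach adj (sepSet n m) u j ∧ Reach adj (sepSet n m) j u}.ncard = c
        split_ifs with h3
        · simp; intro _; omega
        · simp; intro _; omega
  rw [hb₅] at key
  exact key

/-! ### Enumerating the sequences of digits -/

/-- Replacing the digits of a number in base `3` by those of its successor. -/
def increment : Cmd :=
  .assign CARRY 1 ;; .forTo 25 (eK + eK + eK + eK + eK + eK + eK + eK)
    (.ite (var CARRY) (.ite (.read DIG (var 25) - 1) (.write DIG (var 25) 0)
      (.write DIG (var 25) (.read DIG (var 25) + 1) ;; .assign CARRY 0)) .skip)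

theorem run_increment {m : Mem} (he : Env n k adj m) {w : ℕ}
    (hw : ∀ i < 8 * k, m DIG i = w / 3 ^ i % 3) :
    ∀ i < 8 * k, increment.run m DIG i = (w + 1) / 3 ^ i % 3 := by
  have hb : (eK + eK + eK + eK + eK + eK + eK + eK).eval (m.set CARRY 0 1) = 8 * k := by
    simp [he.k_eq]; omega
  let I : ℕ → Mem → Prop := fun t m' => (∀ i < t, m' DIG i = (w + 1) / 3 ^ i % 3) ∧
    (∀ i, t ≤ i → i < 8 * k → m' DIG i = w / 3 ^ i % 3) ∧ (m' CARRY 0 ≠ 0 ↔ 3 ^ t ∣ w + 1)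
  have key : I ((eK + eK + eK + eK + eK + eK + eK + eK).eval (m.set CARRY 0 1))
      (increment.run m) := by
    refine run_forTo (m := m.set CARRY 0 1) (I := I) ?_ ?_
    · exact ⟨by simp, by simpa using hw, by simp⟩
    · intro t m' ht hmt _ ⟨h1, h2, h3⟩
      rw [hb] at ht
      have h4 := h2 t le_rfl ht
      by_cases hc : 3 ^ t ∣ w + 1
      · have h5 : m' CARRY 0 ≠ 0 := h3.2 hc
        have h6 : (w + 1) / 3 ^ t = w / 3 ^ t + 1 := Nat.succ_div_of_dvd hc
        have h7 : 3 ^ (t + 1) ∣ w + 1 ↔ 3 ∣ w / 3 ^ t + 1 := by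
          rw [← h6, pow_succ]
          exact (Nat.dvd_div_iff_mul_dvd hc).symm
        by_cases h8 : w / 3 ^ t % 3 = 2
        · have h9 : m' DIG t - 1 ≠ 0 := by omega
          have h10 : (Cmd.ite (var CARRY) (.ite (.read DIG (var 25) - 1) (.write DIG (var 25) 0)
              (.write DIG (var 25) (.read DIG (var 25) + 1) ;; .assign CARRY 0)) .skip).run m' =
              m'.set DIG t 0 := by simp [h5, hmt, h9]
          rw [h10]
          refine ⟨fun i hi => ?_, fun i hi hi' => ?_, ?_⟩
          · by_cases hit : i = t
            · subst hit; simp [h6]; omega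
            · simpa [hit] using h1 i (by omega)
          · have : i ≠ t := by omega
            simpa [this] using h2 i (by omega) hi'
          · simp only [Mem.set_of_ne _ _ _ (by decide : CARRY ≠ 25),
              Mem.set_of_ne _ _ _ (by decide : CARRY ≠ DIG), h7]
            exact ⟨fun _ => by omega, fun _ => h5⟩
        · have h9 : m' DIG t - 1 = 0 := by omega
          have h10 : (Cmd.ite (var CARRY) (.ite (.read DIG (var 25) - 1) (.write DIG (var 25) 0)
              (.write DIG (var 25) (.read DIG (var 25) + 1) ;; .assign CARRY 0)) .skip).run m' =
              (m'.set DIG t (m' DIG t + 1)).set CARRY 0 0 := by simp [h5, hmt, h9]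
          rw [h10]
          refine ⟨fun i hi => ?_, fun i hi hi' => ?_, ?_⟩
          · by_cases hit : i = t
            · subst hit; simp [h6]; omega
            · simpa [hit] using h1 i (by omega)
          · have : i ≠ t := by omega
            simpa [this] using h2 i (by omega) hi'
          · simp [h7]; omega
      · have h5 : m' CARRY 0 = 0 := by by_contra h; exact hc (h3.1 h)
        have h6 : (w + 1) / 3 ^ t = w / 3 ^ t := Nat.succ_div_of_not_dvd hc
        simp only [run_ite, eval_read, eval_lit, h5, ne_eq, not_true_eq_false, if_false, run_skip]
        refine ⟨fun i hi => ?_, fun i hi hi' => ?_, ?_⟩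
        · by_cases hit : i = t
          · subst hit; simp [h6, h4]
          · simpa using h1 i (by omega)
        · simpa using h2 i (by omega) hi'
        · simp only [Mem.set_of_ne _ _ _ (by decide : CARRY ≠ 25), h5]
          exact ⟨fun h => absurd rfl h, fun h => absurd ((pow_dvd_pow 3 (by omega)).trans h) hc⟩
  rw [hb] at key
  exact key.1

theorem exists_digits_eq (L : ℕ) (dig : ℕ → ℕ) (h : ∀ i, dig i ≤ 2) :
    ∃ w < 3 ^ L, ∀ i < L, w / 3 ^ i % 3 = dig i := by
  induction L generalizing dig with
  | zero => exact ⟨0, by simp, by simp⟩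
  | succ L ih =>
    obtain ⟨w, hw, hwi⟩ := ih (fun i => dig (i + 1)) fun i => h _
    have h0 := h 0
    refine ⟨3 * w + dig 0, by rw [pow_succ]; omega, fun i hi => ?_⟩
    cases i with
    | zero => simp; omega
    | succ i =>
      rw [pow_succ', ← Nat.div_div_eq_div_mul, ← hwi i (by omega)]
      congr 2
      omega

/-- Trying all sequences of digits, until a balanced separator is found. -/
def search : Cmd :=
  .forTo 25 (eK + eK + eK + eK + eK + eK + eK + eK) (.write DIG (var 25) 0) ;;
    .assign FOUND 0 ;; .forTo 55 (.read 0 2) (.ite (var FOUND) .skip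
      (findCandidate ;; verify ;; .assign FOUND (var OKAY) ;; increment))

/-- The search is sound because every candidate is tested, and complete because the candidate of
`exists_digits_findCandidate` is among those that are tried. -/
theorem run_search {m : Mem} (he : Env n k adj m) (hk : 1 ≤ k) (hkn : k ≤ n)
    (hadj : ∀ u v, adj u v → u < n ∧ v < n) {T : Set ℕ} (hT' : ∀ v ∈ T, v < n)
    (hT : ∀ v < n, (m TSET v ≠ 0 ↔ v ∈ T)) (hTc : T.ncard = 2 * k - 1) :
    (search.run m FOUND 0 ≠ 0 ∧ (sepSet n (search.run m)).ncard ≤ k - 1 ∧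
      GoodSep n adj T (k - 1) (sepSet n (search.run m))) ∨
    (search.run m FOUND 0 = 0 ∧ ∀ Z : Set ℕ, (∀ v ∈ Z, v < n) → Z.ncard ≤ k - 1 →
      ¬ GoodSep n adj T (k - 1) Z) := by
  set m₁ := (forTo 25 (eK + eK + eK + eK + eK + eK + eK + eK) (.write DIG (var 25) 0)).run m
    with hm₁
  have hf₁ : ∀ a, a ∉ ([25, 39] : List ℕ) → m₁ a = m a := fun a ha =>
    run_frame (by simpa [writes] using ha) m
  have hd₁ : ∀ i < 8 * k, m₁ DIG i = 0 := by
    intro i hi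
    rw [hm₁, run_forTo_pointwise DIG (fun _ _ => 0) (by decide), if_pos]
    · simp [he.k_eq]; omega
    · intro j m' _ hmj _
      simp [hmj]
  set m₂ := m₁.set FOUND 0 0 with hm₂
  have hf₂ : ∀ a, a ∉ ([25, 39, 54] : List ℕ) → m₂ a = m a := fun a ha => by
    rw [hm₂, Mem.set_of_ne _ _ _ (by rintro rfl; exact ha (by decide))]
    exact hf₁ a fun h => ha (by
      rcases List.mem_cons.1 h with rfl | h
      · decide
      · rw [List.mem_singleton.1 h]; decide)
  have he₂ : Env n k adj m₂ := he.frame (l := [25, 39, 54]) (by decide) hf₂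
  let Good : Mem → Prop := fun m' =>
    (sepSet n m').ncard ≤ k - 1 ∧ GoodSep n adj T (k - 1) (sepSet n m')
  -- the digits of `w` lead to a balanced separator, whatever the rest of the memory contains
  let Win : ℕ → Prop := fun w => ∀ m : Mem, Env n k adj m → (∀ v < n, (m TSET v ≠ 0 ↔ v ∈ T)) →
    (∀ i < 8 * k, m DIG i = w / 3 ^ i % 3) → Good (findCandidate.run m)
  let I : ℕ → Mem → Prop := fun t m' => (m' FOUND 0 ≠ 0 ∧ Good m') ∨
    (m' FOUND 0 = 0 ∧ (∀ i < 8 * k, m' DIG i = t / 3 ^ i % 3) ∧ ∀ w < t, ¬ Win w)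
  have hset : ∀ (m' : Mem) (j : ℕ), sepSet n (m'.set 55 0 j) = sepSet n m' := fun m' j => by
    simp [sepSet]
  have key : I ((Expr.read 0 2).eval m₂) (search.run m) := by
    refine run_forTo (m := m₂) (I := I) (Or.inr ?_) ?_
    · exact ⟨by simp [hm₂], by simpa [hm₂] using hd₁, by simp⟩
    · intro t m' _ _ hf hI
      have he' : Env n k adj m' :=
        he₂.congr (hf _ (by decide) (by decide)) (hf _ (by decide) (by decide))
          (hf _ (by decide) (by decide)) (hf _ (by decide) (by decide))
      have hT₂ : ∀ v < n, (m' TSET v ≠ 0 ↔ v ∈ T) := by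
        rw [hf TSET (by decide) (by decide), hf₂ TSET (by decide)]; exact hT
      rcases hI with ⟨h1, h2⟩ | ⟨h1, h2, h3⟩
      · left
        rw [run_ite, if_pos (by simpa using h1), run_skip]
        exact ⟨by simpa using h1, by simpa only [Good, hset] using h2⟩
      · rw [run_ite, if_neg (by simpa using h1)]
        set a := findCandidate.run m' with ha
        have hea : Env n k adj a := he'.run (by decide)
        set b := verify.run a with hbd
        have heb : Env n k adj b := hea.run (by decide)
        set c := b.set FOUND 0 (b OKAY 0) with hc
        have hec : Env n k adj c := heb.congr (by simp [hc]) (by simp [hc]) (by simp [hc])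
          (by simp [hc])
        have hrun : (findCandidate ;; verify ;; .assign FOUND (var OKAY) ;; increment).run m' =
            increment.run c := by
          simp only [run_seq, run_write, eval_lit, eval_read, hc, hbd, ha]
        rw [hrun]
        have hv := run_verify hea hk hadj hT'
          (by rw [ha, run_frame (by decide) m']; exact hT₂)
        rw [← hbd] at hv
        have hfc : increment.run c FOUND 0 = b OKAY 0 := by
          rw [run_frame (by decide)]; simp [hc]
        have hsep : sepSet n (increment.run c) = sepSet n a := by
          have : increment.run c SEP = a SEP := by
            rw [run_frame (by decide), hc, Mem.set_of_ne _ _ _ (by decide), hbd,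
              run_frame (by decide)]
          simp only [sepSet, this]
        by_cases hok : b OKAY 0 = 0
        · right
          refine ⟨by simpa [hfc] using hok, ?_, fun w hw => ?_⟩
          · have hdig : c DIG = m' DIG := by
              rw [hc, Mem.set_of_ne _ _ _ (by decide), hbd, run_frame (by decide), ha,
                run_frame (by decide)]
            rw [Mem.set_of_ne _ _ _ (by decide)]
            exact run_increment hec (by rw [hdig]; exact h2)
          · rcases Nat.lt_succ_iff_lt_or_eq.1 hw with h' | rfl
            · exact h3 w h'
            · exact fun hwin => (hv.2 (hwin m' he' hT₂ h2)) hok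
        · left
          refine ⟨by simpa [hfc] using hok, ?_⟩
          simp only [Good, hset, hsep]
          exact hv.1 hok
  have hpow : (Expr.read 0 2).eval m₂ = 3 ^ (8 * k) := he₂.pow_eq
  rw [hpow] at key
  refine key.imp id fun ⟨h1, _, h3⟩ => ⟨h1, fun Z hZn hZ hg => ?_⟩
  obtain ⟨dig, hdig, hwin⟩ := exists_digits_findCandidate hk hkn hadj hT' hTc hZn hZ hg
  obtain ⟨w, hw, hwi⟩ := exists_digits_eq (8 * k) dig hdig
  exact h3 w hw fun m' he' hT'' hd => hwin m' he' hT'' fun i hi => by rw [hd i hi, hwi i hi]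

/-! ### Partial arboreal decompositions -/

/-- The strong component of `u` in the digraph without the vertices in `Z`. For `u ∈ Z` the value
is `{u}`. -/
def scc (adj : ℕ → ℕ → Prop) (Z : Set ℕ) (u : ℕ) : Set ℕ :=
  {v | Reach adj Z u v ∧ Reach adj Z v u}

theorem mem_scc_self (Z : Set ℕ) (u : ℕ) : u ∈ scc adj Z u := ⟨.refl, .refl⟩

theorem scc_eq_of_mem {Z : Set ℕ} {u x : ℕ} (h : x ∈ scc adj Z u) :
    scc adj Z x = scc adj Z u :=
  Set.ext fun _ => ⟨fun hv => ⟨h.1.trans hv.1, hv.2.trans h.2⟩,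
    fun hv => ⟨h.2.trans hv.1, hv.2.trans h.1⟩⟩

theorem scc_mono {Z Z' : Set ℕ} (h : Z ⊆ Z') (u : ℕ) : scc adj Z' u ⊆ scc adj Z u :=
  fun _ hv => ⟨hv.1.mono h, hv.2.mono h⟩

theorem notMem_of_mem_scc {Z : Set ℕ} {u v : ℕ} (hu : u ∉ Z) (hv : v ∈ scc adj Z u) : v ∉ Z :=
  hv.1.notMem' hu

/-- A strong component that avoids `X` remains strongly connected without the vertices in `X`. -/
theorem scc_subset_of_disjoint {Y X : Set ℕ} {u : ℕ} (hd : ∀ x ∈ scc adj Y u, x ∉ X) :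
    scc adj Y u ⊆ scc adj X u := by
  have key : ∀ a b, Reach adj Y u a → Reach adj Y b u → Reach adj Y a b → Reach adj X a b := by
    intro a b ha hb h
    induction h using ReflTransGen.head_induction_on with
    | refl => exact .refl
    | @head a c hac hcb ih =>
      have hc := ha.tail hac
      exact .head ⟨hac.1, hd a ⟨ha, .head hac (hcb.trans hb)⟩, hd c ⟨hc, hcb.trans hb⟩⟩ (ih hc)
  exact fun v hv => ⟨key u v .refl hv.2 hv.1, key v u hv.1 .refl hv.2⟩

theorem scc_lt (hadj : ∀ u v, adj u v → u < n ∧ v < n) {Z : Set ℕ} {u v : ℕ} (hu : u < n)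
    (hv : v ∈ scc adj Z u) : v < n := by
  rcases hv.1.cases_tail with rfl | ⟨w, -, hw⟩
  exacts [hu, (hadj _ _ hw.1).2]

/-- A rooted tree with bags and guards on the digraph with vertices `0, …, n - 1`: the nodes are
`0, …, size - 1`, the node `b ≠ 0` has the parent `par b`, the bag of `b` consists of the vertices
`v` with `comp v = b`, and `X b` is the guard of the edge with head `b`. -/
structure BagTree where
  par : ℕ → ℕ
  comp : ℕ → ℕ
  X : ℕ → Set ℕ
  size : ℕ

namespace BagTree

/-- `a` is an ancestor of `b` or equal to `b`. -/
abbrev Anc (S : BagTree) : ℕ → ℕ → Prop := ReflTransGen fun a b => b ≠ 0 ∧ S.par b = a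

/-- The union of the bags of `b` and of its descendants. -/
def below (S : BagTree) (n b : ℕ) : Set ℕ := {v | v < n ∧ S.Anc b (S.comp v)}

/-- The bag of `r`. -/
def bag (S : BagTree) (n r : ℕ) : Set ℕ := {v | v < n ∧ S.comp v = r}

/-- The conditions on the edges in a nice arboreal decomposition, and the bound for the sizes of
the guards. The root has the empty guard for the sake of uniformity. -/
structure IsPartial (S : BagTree) (n k : ℕ) (adj : ℕ → ℕ → Prop) : Prop where
  pos : 0 < S.size
  par_lt : ∀ b < S.size, b ≠ 0 → S.par b < b
  comp_lt : ∀ v < n, S.comp v < S.size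
  nonempty : ∀ r < S.size, (S.bag n r).Nonempty
  strong : ∀ b < S.size, b ≠ 0 → ∃ u < n, u ∉ S.X b ∧ S.below n b = scc adj (S.X b) u
  guard_zero : S.X 0 = ∅
  guard_lt : ∀ b < S.size, ∀ v ∈ S.X b, v < n
  guard_card : ∀ b < S.size, (S.X b).ncard ≤ 2 * k - 1

/-- The guards of the children of `r` are contained in `G`, and their bags avoid `G`. -/
def ChildrenFit (S : BagTree) (n r : ℕ) (G : Set ℕ) : Prop :=
  ∀ b < S.size, b ≠ 0 → S.par b = r → S.X b ⊆ G ∧ ∀ v ∈ S.bag n b, v ∉ G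

/-- The conditions on the node `r` in a nice arboreal decomposition of width at most `3 * k - 2`. -/
def Done (S : BagTree) (n k r : ℕ) : Prop :=
  ∃ G : Set ℕ, G.Finite ∧ G.ncard ≤ 3 * k - 1 ∧ S.bag n r ⊆ G ∧ S.X r ⊆ G ∧ S.ChildrenFit n r G

theorem IsPartial.anc_le {S : BagTree} (h : S.IsPartial n k adj) {a b : ℕ} (hb : b < S.size)
    (hab : S.Anc a b) : a ≤ b := by
  induction hab with
  | refl => exact le_rfl
  | @tail c d _ hcd ih =>
    have := h.par_lt d hb hcd.1
    have h2 := hcd.2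
    have := ih (by omega)
    omega

theorem IsPartial.anc_zero {S : BagTree} (h : S.IsPartial n k adj) {b : ℕ} (hb : b < S.size) :
    S.Anc 0 b := by
  induction b using Nat.strong_induction_on with
  | _ b ih =>
    by_cases h0 : b = 0
    · subst h0; exact .refl
    · have := h.par_lt b hb h0
      exact (ih _ this (by omega)).tail ⟨h0, rfl⟩

theorem IsPartial.size_le {S : BagTree} (h : S.IsPartial n k adj) : S.size ≤ n := by
  have : (range S.size) ⊆ (range n).image S.comp := by
    intro r hr
    obtain ⟨v, hv, rfl⟩ := h.nonempty r (mem_range.1 hr)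
    exact mem_image_of_mem _ (mem_range.2 hv)
  simpa using (Finset.card_le_card this).trans Finset.card_image_le

/-- A strongly connected set that contains a vertex of the bag of `r` and avoids the guards at `r`
is contained in the bag of `r`. -/
theorem IsPartial.scc_subset_bag {S : BagTree} (h : S.IsPartial n k adj)
    (hadj : ∀ u v, adj u v → u < n ∧ v < n) {r u : ℕ} {G Y : Set ℕ} (hu : u ∈ S.bag n r)
    (hXr : S.X r ⊆ G) (hG : S.ChildrenFit n r G) (hY : ∀ x ∈ scc adj Y u, x ∉ G) :
    scc adj Y u ⊆ S.bag n r := by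
  obtain ⟨hun, rfl⟩ := hu
  have hrM := h.comp_lt u hun
  -- the set lies below `r`, but not below a child of `r`
  have hr : scc adj Y u ⊆ S.below n (S.comp u) := by
    by_cases h0 : S.comp u = 0
    · intro x hx
      have := scc_lt hadj hun hx
      exact ⟨this, by rw [h0]; exact h.anc_zero (h.comp_lt x this)⟩
    · obtain ⟨w, -, -, hw⟩ := h.strong _ hrM h0
      rw [hw, ← scc_eq_of_mem (Z := S.X _) (u := w) (x := u) (by rw [← hw]; exact ⟨hun, .refl⟩)]
      exact scc_subset_of_disjoint fun x hx hx' => hY x hx (hXr hx')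
  intro x hx
  refine ⟨(hr hx).1, ?_⟩
  rcases (hr hx).2.cases_head with h1 | ⟨b, ⟨hb0, hbr⟩, hb⟩
  · exact h1.symm
  · exfalso
    have hbM : b < S.size := (h.anc_le (h.comp_lt x (hr hx).1) hb).trans_lt
      (h.comp_lt x (hr hx).1)
    obtain ⟨w, -, -, hw⟩ := h.strong b hbM hb0
    have hxw : x ∈ scc adj (S.X b) w := by rw [← hw]; exact ⟨(hr hx).1, hb⟩
    have h2 : scc adj Y x ⊆ scc adj (S.X b) x := scc_subset_of_disjoint fun y hy hy' => by
      rw [scc_eq_of_mem hx] at hy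
      exact hY y hy ((hG b hbM hb0 hbr).1 hy')
    have hub : u ∈ S.below n b := by
      rw [hw, ← scc_eq_of_mem hxw]
      exact h2 (by rw [scc_eq_of_mem hx]; exact mem_scc_self _ _)
    have h3 := h.anc_le hrM hub.2
    have h4 := h.par_lt b hbM hb0
    omega

/-- `S'` is obtained from `S` by adding a child of `r` with guard `X` whose bag is `C`. -/
structure IsAdd (S S' : BagTree) (n r : ℕ) (X C : Set ℕ) : Prop where
  size_eq : S'.size = S.size + 1
  par_eq : ∀ b < S.size, S'.par b = S.par b
  par_size : S'.par S.size = r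
  comp_of_mem : ∀ v < n, v ∈ C → S'.comp v = S.size
  comp_of_notMem : ∀ v < n, v ∉ C → S'.comp v = S.comp v
  X_eq : ∀ b < S.size, S'.X b = S.X b
  X_size : S'.X S.size = X

theorem IsAdd.bag_subset {S S' : BagTree} {r : ℕ} {X C : Set ℕ} (ha : S.IsAdd S' n r X C) {b : ℕ}
    (hb : b < S.size) : S'.bag n b ⊆ S.bag n b := by
  rintro v ⟨hv, hvb⟩
  by_cases hvC : v ∈ C
  · rw [ha.comp_of_mem v hv hvC] at hvb; omega
  · rw [ha.comp_of_notMem v hv hvC] at hvb; exact ⟨hv, hvb⟩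

theorem IsAdd.bag_size {S S' : BagTree} {r : ℕ} {X C : Set ℕ} (ha : S.IsAdd S' n r X C)
    (hS : S.IsPartial n k adj) : S'.bag n S.size ⊆ C := by
  rintro v ⟨hv, hvb⟩
  by_contra hvC
  rw [ha.comp_of_notMem v hv hvC] at hvb
  have := hS.comp_lt v hv
  omega

/-- Splitting off a child of `r` preserves the conditions on the tree: the vertices of the new bag
move from `r` to a child of `r`, so that nothing changes for the other nodes. Some vertex `p` has to
remain in the bag of `r`. -/
theorem IsAdd.isPartial {S S' : BagTree} {r : ℕ} {X : Set ℕ} {u : ℕ}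
    (ha : S.IsAdd S' n r X (scc adj X u)) (hS : S.IsPartial n k adj)
    (hC : scc adj X u ⊆ S.bag n r) (hr : r < S.size) (hu : u ∉ X)
    (hp : ∃ p ∈ S.bag n r, p ∉ scc adj X u) (hXn : ∀ v ∈ X, v < n) (hX : X.ncard ≤ 2 * k - 1) :
    S'.IsPartial n k adj := by
  have hun : u < n := (hC (mem_scc_self _ _)).1
  have hsize := ha.size_eq
  have hanc : ∀ a, ∀ b < S.size, (S'.Anc a b ↔ S.Anc a b) := by
    intro a b
    induction b using Nat.strong_induction_on with
    | _ b ih =>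
      intro hb
      constructor
      · intro h
        rcases h.cases_tail with rfl | ⟨c, hc, hb0, hcb⟩
        · exact .refl
        · rw [ha.par_eq b hb] at hcb
          have := hS.par_lt b hb hb0
          exact ((ih c (by omega) (by omega)).1 hc).tail ⟨hb0, hcb⟩
      · intro h
        rcases h.cases_tail with rfl | ⟨c, hc, hb0, hcb⟩
        · exact .refl
        · have := hS.par_lt b hb hb0
          exact ((ih c (by omega) (by omega)).2 hc).tail ⟨hb0, by rw [ha.par_eq b hb]; exact hcb⟩
  have hnew : ∀ a, S'.Anc a S.size ↔ a = S.size ∨ S.Anc a r := by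
    intro a
    rw [← hanc a r hr]
    constructor
    · intro h
      rcases h.cases_tail with h | ⟨c, hc, -, hcb⟩
      · exact Or.inl h.symm
      · rw [ha.par_size] at hcb; rw [hcb]; exact Or.inr hc
    · rintro (rfl | h)
      · exact .refl
      · exact h.tail ⟨by have := hS.pos; omega, ha.par_size⟩
  refine ⟨by omega, ?_, ?_, ?_, ?_, ?_, ?_, ?_⟩
  · intro b hb hb0
    rcases Nat.lt_succ_iff_lt_or_eq.1 (hsize ▸ hb) with h | rfl
    · rw [ha.par_eq b h]; exact hS.par_lt b h hb0
    · rw [ha.par_size]; exact hr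
  · intro v hv
    by_cases hvC : v ∈ scc adj X u
    · rw [ha.comp_of_mem v hv hvC]; omega
    · rw [ha.comp_of_notMem v hv hvC]; have := hS.comp_lt v hv; omega
  · intro b hb
    rcases Nat.lt_succ_iff_lt_or_eq.1 (hsize ▸ hb) with h | rfl
    · by_cases hbr : b = r
      · subst hbr
        obtain ⟨p, hpb, hpC⟩ := hp
        exact ⟨p, hpb.1, by rw [ha.comp_of_notMem p hpb.1 hpC]; exact hpb.2⟩
      · obtain ⟨v, hv, hvb⟩ := hS.nonempty b h
        refine ⟨v, hv, ?_⟩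
        rw [ha.comp_of_notMem v hv fun hvC => hbr (hvb.symm.trans (hC hvC).2), hvb]
    · exact ⟨u, hun, ha.comp_of_mem u hun (mem_scc_self _ _)⟩
  · intro b hb hb0
    rcases Nat.lt_succ_iff_lt_or_eq.1 (hsize ▸ hb) with h | rfl
    · rw [ha.X_eq b h]
      obtain ⟨w, hw, hwX, hwb⟩ := hS.strong b h hb0
      refine ⟨w, hw, hwX, ?_⟩
      rw [← hwb]
      ext v
      refine and_congr_right fun hv => ?_
      by_cases hvC : v ∈ scc adj X u
      · rw [ha.comp_of_mem v hv hvC, hnew, (hC hvC).2]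
        exact ⟨fun h' => h'.resolve_left (by omega), Or.inr⟩
      · rw [ha.comp_of_notMem v hv hvC, hanc b _ (hS.comp_lt v hv)]
    · rw [ha.X_size]
      refine ⟨u, hun, hu, ?_⟩
      ext v
      constructor
      · rintro ⟨hv, h⟩
        by_contra hvC
        rw [ha.comp_of_notMem v hv hvC, hanc _ _ (hS.comp_lt v hv)] at h
        have := hS.anc_le (hS.comp_lt v hv) h
        have := hS.comp_lt v hv
        omega
      · intro hv
        have hvn := (hC hv).1
        exact ⟨hvn, by rw [ha.comp_of_mem v hvn hv]⟩
  · rw [ha.X_eq 0 hS.pos, hS.guard_zero]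
  · intro b hb
    rcases Nat.lt_succ_iff_lt_or_eq.1 (hsize ▸ hb) with h | rfl
    · rw [ha.X_eq b h]; exact hS.guard_lt b h
    · rw [ha.X_size]; exact hXn
  · intro b hb
    rcases Nat.lt_succ_iff_lt_or_eq.1 (hsize ▸ hb) with h | rfl
    · rw [ha.X_eq b h]; exact hS.guard_card b h
    · rw [ha.X_size]; exact hX

theorem IsAdd.childrenFit {S S' : BagTree} {r : ℕ} {X C G : Set ℕ} (ha : S.IsAdd S' n r X C)
    (hS : S.IsPartial n k adj) (hG : S.ChildrenFit n r G) (hX : X ⊆ G) (hC : ∀ v ∈ C, v ∉ G) :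
    S'.ChildrenFit n r G := by
  intro b hb hb0 hbr
  rcases Nat.lt_succ_iff_lt_or_eq.1 (ha.size_eq ▸ hb) with h | rfl
  · rw [ha.par_eq b h] at hbr
    rw [ha.X_eq b h]
    exact ⟨(hG b h hb0 hbr).1, fun v hv => (hG b h hb0 hbr).2 v (ha.bag_subset h hv)⟩
  · rw [ha.X_size]
    exact ⟨hX, fun v hv => hC v (ha.bag_size hS hv)⟩

theorem IsAdd.done {S S' : BagTree} {r s : ℕ} {X C : Set ℕ} (ha : S.IsAdd S' n r X C)
    (hs : s < S.size) (hsr : s ≠ r) (h : S.Done n k s) : S'.Done n k s := by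
  obtain ⟨G, h1, h2, h3, h4, h5⟩ := h
  refine ⟨G, h1, h2, (ha.bag_subset hs).trans h3, by rwa [ha.X_eq s hs], ?_⟩
  intro b hb hb0 hbs
  rcases Nat.lt_succ_iff_lt_or_eq.1 (ha.size_eq ▸ hb) with h | rfl
  · rw [ha.par_eq b h] at hbs
    rw [ha.X_eq b h]
    exact ⟨(h5 b h hb0 hbs).1, fun v hv => (h5 b h hb0 hbs).2 v (ha.bag_subset h hv)⟩
  · exact absurd (hbs.symm.trans ha.par_size) hsr

/-- The new guard that is used for a strong component of the digraph without `Z`. -/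
def newGuard (S : BagTree) (adj : ℕ → ℕ → Prop) (r : ℕ) (Z : Set ℕ) (u : ℕ) : Set ℕ :=
  Z ∪ (S.X r ∩ scc adj Z u)

/-- The strong component of a new child avoids all guards at its parent. -/
theorem notMem_of_mem_scc_newGuard {S : BagTree} {r u : ℕ} {Z : Set ℕ}
    (huZ : u ∉ Z) (hux : u ∉ S.X r) {v : ℕ} (hv : v ∈ scc adj (S.newGuard adj r Z u) u) :
    v ∉ Z ∪ S.X r := by
  have h1 : v ∉ S.newGuard adj r Z u :=
    notMem_of_mem_scc (by rintro (h | h); exacts [huZ h, hux h.1]) hv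
  have h2 := scc_mono Set.subset_union_left u hv
  rintro (h | h)
  exacts [h1 (Or.inl h), h1 (Or.inr ⟨h, h2⟩)]

theorem IsPartial.bag_notMem_guard {S : BagTree} (h : S.IsPartial n k adj) {r u : ℕ}
    (hr : r < S.size) (hu : u ∈ S.bag n r) : u ∉ S.X r := by
  by_cases h0 : r = 0
  · rw [h0, h.guard_zero]; exact Set.notMem_empty _
  · obtain ⟨w, -, hw, hwb⟩ := h.strong r hr h0
    have : u ∈ scc adj (S.X r) w := by
      rw [← hwb]; exact ⟨hu.1, by rw [hu.2]⟩
    exact notMem_of_mem_scc hw this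

/-- The size of the new guard: the strong component contains at most `k - 1` vertices of the old
guard since it is contained in a strong component of the digraph without the separator. -/
theorem ncard_newGuard_le {S : BagTree} {r u : ℕ} {Z Z₀ T : Set ℕ} (hk : 1 ≤ k)
    (hT : ∀ v ∈ T, v < n) (hXT : S.X r ⊆ T) (hZ₀ : GoodSep n adj T (k - 1) Z₀) (hZZ : Z₀ ⊆ Z)
    (hZ : Z.ncard ≤ k) (hun : u < n) (hu : u ∉ Z) :
    (S.newGuard adj r Z u).ncard ≤ 2 * k - 1 := by
  have h1 : (S.X r ∩ scc adj Z u).ncard ≤ k - 1 := by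
    refine (Set.ncard_le_ncard ?_ ?_).trans (hZ₀ u hun fun h => hu (hZZ h))
    · intro v hv
      have := scc_mono hZZ u hv.2
      exact ⟨hXT hv.1, this.2, this.1⟩
    · exact (Set.finite_lt_nat n).subset fun v hv => hT v hv.1
  have := Set.ncard_union_le Z (S.X r ∩ scc adj Z u)
  unfold newGuard
  omega

end BagTree

/-! ### Refining a partial arboreal decomposition -/

/-- The tree that is stored in the memory. -/
def treeOf (n : ℕ) (m : Mem) : BagTree where
  par := m PAR
  comp := m COMP
  X b := {v | v < n ∧ m GRD (b * n + v) ≠ 0}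
  size := m OUT 1

theorem treeOf_congr {m m' : Mem} (h1 : m' PAR = m PAR) (h2 : m' COMP = m COMP)
    (h3 : m' GRD = m GRD) (h4 : m' OUT 1 = m OUT 1) : treeOf n m' = treeOf n m := by
  simp only [treeOf, h1, h2, h3, h4]

/-- Copying `SEP` to `BLK`. -/
def copySep : Cmd := .forTo 62 eN (.write BLK (var 62) (.read SEP (var 62)))

/-- Writing the guard of a new node, given the reachability matrix without the vertices in `SEP`. -/
def writeGuard : Cmd := .forTo 62 eN
  (.ite (.read SEP (var 62)) (.write GRD (.read ROW (.read OUT 1) + var 62) 1)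
    (.ite (.read GRD (.read ROW (var 60) + var 62))
      (.ite (.read RM (.read ROW (var 61) + var 62))
        (.write GRD (.read ROW (.read OUT 1) + var 62) (.read RM (.read ROW (var 62) + var 61)))
        (.write GRD (.read ROW (.read OUT 1) + var 62) 0))
      (.write GRD (.read ROW (.read OUT 1) + var 62) 0)))

/-- Copying the guard of the new node to `BLK`. -/
def copyGuard : Cmd :=
  .forTo 62 eN (.write BLK (var 62) (.read GRD (.read ROW (.read OUT 1) + var 62)))

/-- Moving the strong component of the vertex `61` to the bag of the new node. -/
def writeBag : Cmd := .forTo 62 eN (.ite (.read RM (.read ROW (var 61) + var 62))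
  (.ite (.read RM (.read ROW (var 62) + var 61)) (.write COMP (var 62) (.read OUT 1)) .skip) .skip)

/-- Adding a child of the node `60` whose bag is the strong component of the vertex `61`. -/
def addNode : Cmd :=
  copySep ;; reachMat ;; writeGuard ;; copyGuard ;; reachMat ;; writeBag ;;
    .write PAR (.read OUT 1) (var 60) ;; .write OUT 1 (.read OUT 1 + 1)

theorem run_copySep {m : Mem} (he : Env n k adj m) {Z : Set ℕ}
    (hZ : ∀ x < n, (m SEP x ≠ 0 ↔ x ∈ Z)) :
    ∀ x < n, (copySep.run m BLK x ≠ 0 ↔ x ∈ Z) := by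
  intro x hx
  have hb : eN.eval m = n := he.n_eq
  rw [copySep, run_forTo_pointwise BLK (fun j _ => m SEP j) (by decide), hb, if_pos hx, hZ x hx]
  intro j m' _ hmj hf
  simp [hmj, hf SEP (by decide) (by decide)]

theorem run_writeGuard {m : Mem} (he : Env n k adj m) {Z : Set ℕ}
    (hZ : ∀ x < n, (m SEP x ≠ 0 ↔ x ∈ Z))
    (hR : ∀ u < n, ∀ v < n, (m RM (u * n + v) ≠ 0 ↔ Reach adj Z u v)) {r u : ℕ} (hr : m 60 0 = r)
    (hrM : r < m OUT 1) (hu : m 61 0 = u) (hun : u < n) (hM : m OUT 1 < n) :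
    (∀ x < n, (writeGuard.run m GRD (m OUT 1 * n + x) ≠ 0 ↔
      x ∈ Z ∪ ((treeOf n m).X r ∩ scc adj Z u))) ∧
    ∀ b < m OUT 1, ∀ x < n, writeGuard.run m GRD (b * n + x) = m GRD (b * n + x) := by
  have hb : eN.eval m = n := he.n_eq
  have key : (∀ x < n, x < eN.eval m → (writeGuard.run m GRD (m OUT 1 * n + x) ≠ 0 ↔
      x ∈ Z ∪ ((treeOf n m).X r ∩ scc adj Z u))) ∧
      ∀ b < m OUT 1, ∀ x < n, writeGuard.run m GRD (b * n + x) = m GRD (b * n + x) := by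
    refine run_forTo (I := fun t m' => (∀ x < n, x < t → (m' GRD (m OUT 1 * n + x) ≠ 0 ↔
      x ∈ Z ∪ ((treeOf n m).X r ∩ scc adj Z u))) ∧
      ∀ b < m OUT 1, ∀ x < n, m' GRD (b * n + x) = m GRD (b * n + x)) (by simp) ?_
    intro j m' hj hmj hf ⟨h1, h2⟩
    rw [hb] at hj
    have hS : m' SEP = m SEP := hf _ (by decide) (by decide)
    have hW : m' ROW = m ROW := hf _ (by decide) (by decide)
    have hO : m' OUT = m OUT := hf _ (by decide) (by decide)
    have hRM : m' RM = m RM := hf _ (by decide) (by decide)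
    have h60 : m' 60 0 = r := by rw [hf 60 (by decide) (by decide), hr]
    have h61 : m' 61 0 = u := by rw [hf 61 (by decide) (by decide), hu]
    have h3 := h2 r hrM j hj
    obtain ⟨f, hfj, hrun⟩ : ∃ f : ℕ, (f ≠ 0 ↔ j ∈ Z ∪ ((treeOf n m).X r ∩ scc adj Z u)) ∧
        (Cmd.ite (.read SEP (var 62)) (.write GRD (.read ROW (.read OUT 1) + var 62) 1)
          (.ite (.read GRD (.read ROW (var 60) + var 62))
          (.ite (.read RM (.read ROW (var 61) + var 62))
          (.write GRD (.read ROW (.read OUT 1) + var 62) (.read RM (.read ROW (var 62) + var 61)))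
          (.write GRD (.read ROW (.read OUT 1) + var 62) 0))
          (.write GRD (.read ROW (.read OUT 1) + var 62) 0))).run m' GRD =
        Function.update (m' GRD) (m OUT 1 * n + j) f := by
      simp only [run_ite_apply, run_write, eval_read, eval_add, eval_lit, hmj, hS, hW, hO, hRM, h60,
        h61, he.row _ hM, he.row u hun, he.row r (hrM.trans hM), he.row j hj, h3, Mem.set_self]
      have h4 : j ∈ Z ∪ ((treeOf n m).X r ∩ scc adj Z u) ↔
          m SEP j ≠ 0 ∨ (m GRD (r * n + j) ≠ 0 ∧ m RM (u * n + j) ≠ 0 ∧ m RM (j * n + u) ≠ 0) := by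
        rw [hZ j hj, hR u hun j hj, hR j hj u hun]
        simp only [Set.mem_union, Set.mem_inter_iff, treeOf, Set.mem_ofPred_eq, scc, hj, true_and]
      rw [h4]
      by_cases h5 : m SEP j ≠ 0
      · exact ⟨1, by simp [h5], by rw [if_pos h5]⟩
      rw [if_neg h5]
      by_cases h6 : m GRD (r * n + j) ≠ 0
      · rw [if_pos h6]
        by_cases h7 : m RM (u * n + j) ≠ 0
        · exact ⟨m RM (j * n + u), by simp [h5, h6, h7], by rw [if_pos h7]⟩
        · exact ⟨0, by simp [h5, h7], by rw [if_neg h7]⟩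
      · exact ⟨0, by simp [h5, h6], by rw [if_neg h6]⟩
    rw [Mem.set_of_ne _ _ _ (by decide), hrun]
    refine ⟨fun x hx hxj => ?_, fun b hbM x hx => ?_⟩
    · by_cases h5 : x = j
      · subst h5; simpa using hfj
      · rw [Function.update_of_ne fun h => h5 ((index_inj hx hj).1 h).2]
        exact h1 x hx (by omega)
    · rw [Function.update_of_ne fun h => hbM.ne ((index_inj hx hj).1 h).1]
      exact h2 b hbM x hx
  rw [hb] at key
  exact ⟨fun x hx => key.1 x hx hx, key.2⟩

theorem run_copyGuard {m : Mem} (he : Env n k adj m) (hM : m OUT 1 < n) :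
    ∀ x < n, copyGuard.run m BLK x = m GRD (m OUT 1 * n + x) := by
  intro x hx
  have hb : eN.eval m = n := he.n_eq
  rw [copyGuard, run_forTo_pointwise BLK (fun j _ => m GRD (m OUT 1 * n + j)) (by decide), hb,
    if_pos hx]
  intro j m' _ hmj hf
  simp [hmj, hf GRD (by decide) (by decide), hf ROW (by decide) (by decide),
    hf OUT (by decide) (by decide), he.row _ hM]

theorem run_writeBag {m : Mem} (he : Env n k adj m) {X : Set ℕ}
    (hR : ∀ u < n, ∀ v < n, (m RM (u * n + v) ≠ 0 ↔ Reach adj X u v)) {u : ℕ}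
    (hu : m 61 0 = u) (hun : u < n) :
    ∀ x < n, (x ∈ scc adj X u → writeBag.run m COMP x = m OUT 1) ∧
      (x ∉ scc adj X u → writeBag.run m COMP x = m COMP x) := by
  classical
  intro x hx
  have hb : eN.eval m = n := he.n_eq
  rw [writeBag, run_forTo_pointwise COMP (fun j y => if j ∈ scc adj X u then m OUT 1 else y)
    (by decide), hb, if_pos hx]
  · exact ⟨fun h => if_pos h, fun h => if_neg h⟩
  intro j m' hj hmj hf
  rw [hb] at hj
  have h1 : j ∈ scc adj X u ↔ m RM (u * n + j) ≠ 0 ∧ m RM (j * n + u) ≠ 0 := by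
    rw [hR u hun j hj, hR j hj u hun]; rfl
  simp only [run_ite_apply, run_write, run_skip, eval_read, eval_add, eval_lit, hmj,
    hf ROW (by decide) (by decide), hf RM (by decide) (by decide), hf OUT (by decide) (by decide),
    hf 61 (by decide) (by decide), hu, he.row u hun, he.row j hj, h1, Mem.set_self]
  by_cases h2 : m RM (u * n + j) ≠ 0 <;> by_cases h3 : m RM (j * n + u) ≠ 0 <;> simp [h2, h3]

/-- The first reachability matrix, without the vertices in `Z`, yields the guard; the second one,
without the vertices in the guard, yields the bag. -/
theorem run_addNode {m : Mem} (he : Env n k adj m) (hadj : ∀ u v, adj u v → u < n ∧ v < n)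
    {Z : Set ℕ} (hZn : ∀ v ∈ Z, v < n) (hZ : ∀ x < n, (m SEP x ≠ 0 ↔ x ∈ Z)) {r u : ℕ}
    (hr : m 60 0 = r) (hrM : r < m OUT 1) (hu : m 61 0 = u) (hun : u < n) (hM : m OUT 1 < n) :
    (treeOf n m).IsAdd (treeOf n (addNode.run m)) n r ((treeOf n m).newGuard adj r Z u)
      (scc adj ((treeOf n m).newGuard adj r Z u) u) := by
  set m₁ := copySep.run m with hm₁
  have hf₁ : ∀ a, a ∉ ([62, 50] : List ℕ) → m₁ a = m a := fun a ha =>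
    run_frame (by simpa [writes, copySep] using ha) m
  have he₁ : Env n k adj m₁ := he.run (by decide)
  have hB₁ := run_copySep he hZ
  rw [← hm₁] at hB₁
  set m₂ := reachMat.run m₁ with hm₂
  have hf₂ : ∀ a, a ∉ reachMat.writes → m₂ a = m₁ a := fun a ha => run_frame ha m₁
  have he₂ : Env n k adj m₂ := he₁.run (by decide)
  have hR₂ := run_reachMat he₁ hadj hB₁
  rw [← hm₂] at hR₂
  have h₂ : ∀ a, a ∉ (62 :: 50 :: reachMat.writes) → m₂ a = m a := fun a ha => by
    rw [hf₂ a fun h => ha (by simp [h]), hf₁ a fun h => ha (by simp at h; simp; tauto)]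
  have hO₂ : m₂ OUT = m OUT := h₂ _ (by decide)
  have ht₂ : treeOf n m₂ = treeOf n m := treeOf_congr (h₂ _ (by decide)) (h₂ _ (by decide))
    (h₂ _ (by decide)) (by rw [hO₂])
  set m₃ := writeGuard.run m₂ with hm₃
  have hf₃ : ∀ a, a ∉ writeGuard.writes → m₃ a = m₂ a := fun a ha => run_frame ha m₂
  have he₃ : Env n k adj m₃ := he₂.run (by decide)
  have hG := run_writeGuard he₂ (Z := Z) (r := r) (u := u) (by rw [h₂ SEP (by decide)]; exact hZ)
    hR₂ (by rw [h₂ 60 (by decide), hr]) (by rw [hO₂]; exact hrM) (by rw [h₂ 61 (by decide), hu]) hun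
    (by rw [hO₂]; exact hM)
  rw [← hm₃, ht₂, hO₂] at hG
  have hO₃ : m₃ OUT = m OUT := (hf₃ _ (by decide)).trans hO₂
  set X := (treeOf n m).newGuard adj r Z u with hX
  have hXn : ∀ v ∈ X, v < n := by
    rintro v (h | h)
    exacts [hZn v h, h.1.1]
  set m₄ := copyGuard.run m₃ with hm₄
  have hf₄ : ∀ a, a ∉ copyGuard.writes → m₄ a = m₃ a := fun a ha => run_frame ha m₃
  have he₄ : Env n k adj m₄ := he₃.run (by decide)
  have hB₄ : ∀ x < n, (m₄ BLK x ≠ 0 ↔ x ∈ X) := by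
    intro x hx
    rw [hm₄, run_copyGuard he₃ (by rw [hO₃]; exact hM) x hx, hO₃]
    exact hG.1 x hx
  set m₅ := reachMat.run m₄ with hm₅
  have hf₅ : ∀ a, a ∉ reachMat.writes → m₅ a = m₄ a := fun a ha => run_frame ha m₄
  have he₅ : Env n k adj m₅ := he₄.run (by decide)
  have hR₅ := run_reachMat he₄ hadj hB₄
  rw [← hm₅] at hR₅
  have h₅ : ∀ a, a ∉ (copyGuard.writes ++ reachMat.writes) → m₅ a = m₃ a := fun a ha => by
    rw [hf₅ a fun h => ha (by simp [h]), hf₄ a fun h => ha (by simp [h])]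
  have h₅' : ∀ a, a ∉ (62 :: 50 :: GRD :: reachMat.writes) → m₅ a = m a := fun a ha => by
    rw [h₅ a fun h => ha (by simp [copyGuard, writes] at h; simp; tauto),
      hf₃ a fun h => ha (by simp [writeGuard, writes] at h; simp; tauto),
      h₂ a fun h => ha (by simp at h; simp; tauto)]
  set m₆ := writeBag.run m₅ with hm₆
  have hf₆ : ∀ a, a ∉ writeBag.writes → m₆ a = m₅ a := fun a ha => run_frame ha m₅
  have hC := run_writeBag he₅ hR₅ (u := u) (by rw [h₅' 61 (by decide), hu]) hun
  rw [← hm₆, h₅' OUT (by decide), h₅' COMP (by decide)] at hC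
  have hO₆ : m₆ OUT = m OUT := (hf₆ _ (by decide)).trans (h₅' _ (by decide))
  have h60 : m₆ 60 0 = r := by rw [hf₆ 60 (by decide), h₅' 60 (by decide), hr]
  have hP₆ : m₆ PAR = m PAR := (hf₆ _ (by decide)).trans (h₅' _ (by decide))
  have hG₆ : m₆ GRD = m₃ GRD := (hf₆ _ (by decide)).trans (h₅ _ (by decide))
  have hrun : addNode.run m = (m₆.set PAR (m OUT 1) r).set OUT 1 (m OUT 1 + 1) := by
    have : addNode.run m = (m₆.set PAR (m₆ OUT 1) (m₆ 60 0)).set OUT 1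
        ((m₆.set PAR (m₆ OUT 1) (m₆ 60 0)) OUT 1 + 1) := by
      simp only [addNode, run_seq, run_write, eval_read, eval_add, eval_lit, hm₆, hm₅, hm₄, hm₃,
        hm₂, hm₁]
    rw [this, Mem.set_of_ne _ _ _ (by decide), hO₆, h60]
  rw [hrun]
  refine ⟨by simp [treeOf], ?_, by simp [treeOf], ?_, ?_, ?_, ?_⟩
  · intro b hb
    have : b ≠ m OUT 1 := ne_of_lt hb
    simp [treeOf, hP₆, this]
  · intro v hv hvC
    simpa [treeOf] using (hC v hv).1 hvC
  · intro v hv hvC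
    simpa [treeOf] using (hC v hv).2 hvC
  · intro b hb
    ext v
    simp only [treeOf, Set.mem_ofPred_eq]
    refine and_congr_right fun hv => ?_
    simp only [Mem.set_of_ne _ _ _ (by decide : GRD ≠ OUT),
      Mem.set_of_ne _ _ _ (by decide : GRD ≠ PAR), hG₆]
    rw [hG.2 b hb v hv, h₂ GRD (by decide)]
  · ext v
    simp only [treeOf, Set.mem_ofPred_eq, Mem.set_of_ne _ _ _ (by decide : GRD ≠ OUT),
      Mem.set_of_ne _ _ _ (by decide : GRD ≠ PAR), hG₆]
    exact ⟨fun h => (hG.1 v h.1).1 h.2, fun h => ⟨hXn v h, (hG.1 v (hXn v h)).2 h⟩⟩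

/-! ### Processing a node -/

/-- Splitting the bag of the node `60` with the separator in `SEP`. A vertex of the bag is added to
the separator, so that the new bag of the node is not empty. -/
def refineNode : Cmd :=
  .forTo 62 eN (.ite (eq (.read COMP (var 62)) (var 60)) (.assign 63 (var 62)) .skip) ;;
    .write SEP (var 63) 1 ;;
    .forTo 61 eN (.ite (eq (.read COMP (var 61)) (var 60)) (.ite (.read SEP (var 61)) .skip addNode)
      .skip)

theorem run_addNode_out (m : Mem) : addNode.run m OUT 0 = m OUT 0 := by
  have : addNode.run m = (Cmd.write OUT 1 (.read OUT 1 + 1)).run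
      ((copySep ;; reachMat ;; writeGuard ;; copyGuard ;; reachMat ;; writeBag ;;
        .write PAR (.read OUT 1) (var 60)).run m) := by
    simp only [addNode, run_seq]
  rw [this, run_write, Mem.set_self, Function.update_of_ne (by simp), run_frame (by decide)]

/-- After the refinement the node `r` is finished. The loop invariant says that the guards of the
children of `r` are contained in `Z ∪ X` and their bags avoid this set, where `Z` is the enlarged
separator and `X` the guard of `r`, and that vertices that remain in the bag of `r` after their turn
belong to `Z`. -/
theorem run_refineNode {m : Mem} (he : Env n k adj m) (hk : 1 ≤ k)
    (hadj : ∀ u v, adj u v → u < n ∧ v < n) {r : ℕ} (hr : m 60 0 = r)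
    (hS : (treeOf n m).IsPartial n k adj) (hrM : r < (treeOf n m).size)
    (hdone : ∀ s < r, (treeOf n m).Done n k s)
    (hpar : ∀ b < (treeOf n m).size, b ≠ 0 → (treeOf n m).par b < r) {T : Set ℕ}
    (hT : ∀ v ∈ T, v < n) (hXT : (treeOf n m).X r ⊆ T) (hZ : (sepSet n m).ncard ≤ k - 1)
    (hg : GoodSep n adj T (k - 1) (sepSet n m)) :
    (treeOf n (refineNode.run m)).IsPartial n k adj ∧
    (∀ s ≤ r, (treeOf n (refineNode.run m)).Done n k s) ∧
    (∀ b < (treeOf n (refineNode.run m)).size, b ≠ 0 → (treeOf n (refineNode.run m)).par b ≤ r) ∧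
    refineNode.run m OUT 0 = m OUT 0 := by
  have hb : eN.eval m = n := he.n_eq
  set m₁ := (forTo 62 eN (.ite (eq (.read COMP (var 62)) (var 60)) (.assign 63 (var 62))
    .skip)).run m with hm₁
  have hf₁ : ∀ a, a ∉ ([62, 63] : List ℕ) → m₁ a = m a := fun a ha =>
    run_frame (by simpa [writes] using ha) m
  have he₁ : Env n k adj m₁ := he.frame (l := [62, 63]) (by decide) hf₁
  have hp₁ : m₁ 63 0 < n ∧ m COMP (m₁ 63 0) = r := by
    have key : ∀ v < eN.eval m, m COMP v = r → m₁ 63 0 < n ∧ m COMP (m₁ 63 0) = r := by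
      refine run_forTo (I := fun t m' => ∀ v < t, m COMP v = r → m' 63 0 < n ∧
        m COMP (m' 63 0) = r) (by simp) ?_
      intro j m' hj hmj hf hI v hv hvr
      rw [hb] at hj
      rw [Mem.set_of_ne _ _ _ (by decide)]
      simp only [run_ite_apply₂, run_write, run_skip, eval_eq, eval_read, eval_lit, hmj,
        hf COMP (by decide) (by decide), hf 60 (by decide) (by decide), hr]
      by_cases h1 : m COMP j = r
      · simp [h1, hj]
      · rw [if_neg h1, if_neg (by simp)]
        refine hI v ?_ hvr
        rcases Nat.lt_succ_iff_lt_or_eq.1 hv with h | rfl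
        exacts [h, absurd hvr h1]
    obtain ⟨v, hv, hvr⟩ := hS.nonempty r hrM
    exact key v (by rw [hb]; exact hv) hvr
  set p := m₁ 63 0 with hp
  obtain ⟨hpn, hpr⟩ := hp₁
  set m₂ := m₁.set SEP p 1 with hm₂
  have hf₂ : ∀ a, a ∉ ([62, 63, 40] : List ℕ) → m₂ a = m a := fun a ha => by
    rw [hm₂, Mem.set_of_ne _ _ _ (by rintro rfl; exact ha (by decide)), hf₁ a]
    exact fun h => ha (by simp at h ⊢; tauto)
  have he₂ : Env n k adj m₂ := he.frame (l := [62, 63, 40]) (by decide) hf₂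
  have ht₂ : treeOf n m₂ = treeOf n m := treeOf_congr (hf₂ _ (by decide)) (hf₂ _ (by decide))
    (hf₂ _ (by decide)) (by rw [hf₂ _ (by decide)])
  set Z : Set ℕ := insert p (sepSet n m) with hZdef
  have hfin : (sepSet n m).Finite := (Set.finite_lt_nat n).subset fun v hv => hv.1
  have hZn : ∀ v ∈ Z, v < n := by
    rintro v (rfl | h)
    exacts [hpn, h.1]
  have hZk : Z.ncard ≤ k := by
    exact (Set.ncard_insert_le p (sepSet n m)).trans (by omega)
  have hsep₂ : ∀ x < n, (m₂ SEP x ≠ 0 ↔ x ∈ Z) := by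
    intro x hx
    rw [hm₂, Mem.set_self, hf₁ SEP (by decide), hZdef, Set.mem_insert_iff]
    by_cases hxp : x = p
    · simp [hxp]
    · rw [Function.update_of_ne hxp, or_iff_right hxp]
      exact ⟨fun h => ⟨hx, h⟩, fun h => h.2⟩
  set X := (treeOf n m).X r with hX
  have hXn : ∀ v ∈ X, v < n := fun v h => h.1
  let I : ℕ → Mem → Prop := fun t m' => (treeOf n m').IsPartial n k adj ∧
    r < (treeOf n m').size ∧ (∀ s < r, (treeOf n m').Done n k s) ∧
    (∀ b < (treeOf n m').size, b ≠ 0 → (treeOf n m').par b ≤ r) ∧ m' OUT 0 = m OUT 0 ∧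
    (treeOf n m').X r = X ∧ (treeOf n m').ChildrenFit n r (Z ∪ X) ∧ p ∈ (treeOf n m').bag n r ∧
    ∀ v < t, v ∈ (treeOf n m').bag n r → v ∈ Z
  have hset : ∀ (m' : Mem) (j : ℕ), treeOf n (m'.set 61 0 j) = treeOf n m' := fun m' j =>
    treeOf_congr (by simp) (by simp) (by simp) (by simp)
  have key : I (eN.eval m₂) (refineNode.run m) := by
    refine run_forTo (m := m₂) (I := I) ?_ ?_
    · simp only [I, hset, ht₂]
      refine ⟨hS, hrM, hdone, fun b hbM hb0 => (hpar b hbM hb0).le, ?_, rfl, ?_, ⟨hpn, hpr⟩,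
        by simp⟩
      · rw [Mem.set_of_ne _ _ _ (by decide), hf₂ OUT (by decide)]
      · intro b hbM hb0 hbr
        have := hpar b hbM hb0
        omega
    · intro j m' hj hmj hf hI
      have hb₂ : eN.eval m₂ = n := he₂.n_eq
      rw [hb₂] at hj
      have he' : Env n k adj m' :=
        he₂.congr (hf _ (by decide) (by decide)) (hf _ (by decide) (by decide))
          (hf _ (by decide) (by decide)) (hf _ (by decide) (by decide))
      have hsep' : ∀ x < n, (m' SEP x ≠ 0 ↔ x ∈ Z) := by
        rw [hf SEP (by decide) (by decide)]; exact hsep₂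
      have h60 : m' 60 0 = r := by rw [hf 60 (by decide) (by decide), hf₂ 60 (by decide), hr]
      obtain ⟨h1, h2, h3, h4, h5, h6, h7, h8, h9⟩ := hI
      have hstay : (j ∈ (treeOf n m').bag n r → j ∈ Z) → I (j + 1) (m'.set 61 0 (j + 1)) := by
        intro h
        simp only [I, hset]
        refine ⟨h1, h2, h3, h4, by simpa using h5, h6, h7, h8, fun v hv hvr => ?_⟩
        rcases Nat.lt_succ_iff_lt_or_eq.1 hv with h' | rfl
        exacts [h9 v h' hvr, h hvr]
      rw [run_ite]
      by_cases hjr : m' COMP j = r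
      swap
      · rw [if_neg (by simp [eval_eq, hmj, h60, hjr]), run_skip]
        exact hstay fun h => absurd h.2 hjr
      rw [if_pos (by simp [eval_eq, hmj, h60, hjr]), run_ite]
      by_cases hjZ : j ∈ Z
      · rw [if_pos (by simpa [hmj] using (hsep' j hj).2 hjZ), run_skip]
        exact hstay fun _ => hjZ
      rw [if_neg (by simpa [hmj] using fun h => hjZ ((hsep' j hj).1 h))]
      -- the strong component of `j` is split off
      have hjb : j ∈ (treeOf n m').bag n r := ⟨hj, hjr⟩
      set S := treeOf n m' with hSdef
      set Y := S.newGuard adj r Z j with hY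
      have hjX : j ∉ S.X r := h1.bag_notMem_guard h2 hjb
      have hC : ∀ v ∈ scc adj Y j, v ∉ Z ∪ X := fun v hv => by
        rw [← h6]; exact BagTree.notMem_of_mem_scc_newGuard hjZ hjX hv
      have hpC : p ∉ scc adj Y j := fun h => hC p h (Or.inl (Set.mem_insert _ _))
      have hCr : scc adj Y j ⊆ S.bag n r := h1.scc_subset_bag hadj hjb
        (by rw [h6]; exact Set.subset_union_right) h7 hC
      have hYn : ∀ v ∈ Y, v < n := by
        rintro v (h | h)
        exacts [hZn v h, h.1.1]
      have hYc : Y.ncard ≤ 2 * k - 1 := BagTree.ncard_newGuard_le hk hT (by rw [h6]; exact hXT) hg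
        (Set.subset_insert _ _) hZk hj hjZ
      have hYG : Y ⊆ Z ∪ X := by
        rintro v (h | h)
        exacts [Or.inl h, Or.inr (h6 ▸ h.1)]
      have hjY : j ∉ Y := by
        rintro (h | h)
        exacts [hjZ h, hjX h.1]
      -- the bags of the nodes are not empty, and `p` remains in the bag of `r`
      have hMn : S.size < n := by
        have h10 : range S.size ⊆ ((range n).erase p).image S.comp := by
          intro s hs
          by_cases hsr : s = r
          · subst hsr
            exact mem_image.2 ⟨j, mem_erase.2 ⟨fun h => hjZ (h ▸ Set.mem_insert _ _),
              mem_range.2 hj⟩, hjr⟩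
          · obtain ⟨v, hv, hvs⟩ := h1.nonempty s (mem_range.1 hs)
            exact mem_image.2 ⟨v, mem_erase.2 ⟨fun h => hsr (by rw [← hvs, h, h8.2]),
              mem_range.2 hv⟩, hvs⟩
        have h11 := (Finset.card_le_card h10).trans Finset.card_image_le
        rw [card_range, card_erase_of_mem (mem_range.2 hpn), card_range] at h11
        omega
      have ha := run_addNode he' hadj hZn hsep' h60 h2 hmj hj hMn
      rw [← hSdef, ← hY] at ha
      set S' := treeOf n (addNode.run m') with hS'
      have hsize := ha.size_eq
      simp only [I, hset]
      rw [← hS']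
      refine ⟨ha.isPartial h1 hCr h2 hjY ⟨p, h8, hpC⟩ hYn hYc, by omega,
        fun s hs => ha.done (by omega) hs.ne (h3 s hs), ?_, ?_, by rw [ha.X_eq r h2, h6],
        ha.childrenFit h1 h7 hYG hC, ?_, ?_⟩
      · intro b hbM hb0
        rcases Nat.lt_succ_iff_lt_or_eq.1 (hsize ▸ hbM) with h | rfl
        · rw [ha.par_eq b h]; exact h4 b h hb0
        · rw [ha.par_size]
      · rw [Mem.set_of_ne _ _ _ (by decide), ← h5]
        exact run_addNode_out m'
      · exact ⟨hpn, by rw [ha.comp_of_notMem p hpn hpC, h8.2]⟩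
      · intro v hv hvr
        rcases Nat.lt_succ_iff_lt_or_eq.1 hv with h' | rfl
        · exact h9 v h' (ha.bag_subset h2 hvr)
        · exfalso
          have := hvr.2
          rw [ha.comp_of_mem v hj (mem_scc_self _ _)] at this
          omega
  have hb₂ : eN.eval m₂ = n := he₂.n_eq
  rw [hb₂] at key
  obtain ⟨h1, h2, h3, h4, h5, h6, h7, h8, h9⟩ := key
  refine ⟨h1, fun s hs => ?_, h4, h5⟩
  rcases hs.lt_or_eq with h | rfl
  · exact h3 s h
  · have hfinZ : (Z ∪ X).Finite := (Set.finite_lt_nat n).subset (by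
      rintro v (h | h)
      exacts [hZn v h, hXn v h])
    refine ⟨Z ∪ X, hfinZ, ?_, fun v hv => Or.inl (h9 v hv.1 hv), ?_, h7⟩
    · have h10 := Set.ncard_union_le Z X
      have h11 : X.ncard ≤ 2 * k - 1 := hS.guard_card s hrM
      omega
    · rw [h6]; exact Set.subset_union_right

/-! ### The construction of the decomposition -/

/-- The content of `TSET` as a set. -/
def terminals (n : ℕ) (m : Mem) : Set ℕ := {v | v < n ∧ m TSET v ≠ 0}

/-- Choosing a set of `2 * k - 1` vertices that contains the guard of the node `60` and is
contained in the union of this guard with the bag. -/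
def selectTerminals : Cmd :=
  .forTo 62 eN (.write TSET (var 62) (.read GRD (.read ROW (var 60) + var 62))) ;;
    .assign CNT 0 ;; .forTo 62 eN (.ite (.read TSET (var 62)) (.assign CNT (var CNT + 1)) .skip) ;;
    .forTo 62 eN (.ite (.read TSET (var 62)) .skip (.ite (eq (.read COMP (var 62)) (var 60))
      (.ite (eK + eK - 1 - var CNT) (.write TSET (var 62) 1 ;; .assign CNT (var CNT + 1)) .skip)
      .skip))

theorem run_selectTerminals {m : Mem} (he : Env n k adj m) {r : ℕ} (hr : m 60 0 = r) (hrn : r < n)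
    (hX : ((treeOf n m).X r).ncard ≤ 2 * k - 1)
    (hW : 3 * k ≤ ((treeOf n m).bag n r ∪ (treeOf n m).X r).ncard) :
    (terminals n (selectTerminals.run m)).ncard = 2 * k - 1 ∧
      (treeOf n m).X r ⊆ terminals n (selectTerminals.run m) := by
  classical
  have hb : eN.eval m = n := he.n_eq
  set m₁ := (forTo 62 eN (.write TSET (var 62) (.read GRD (.read ROW (var 60) + var 62)))).run m
    with hm₁
  have hf₁ : ∀ a, a ∉ ([62, 3] : List ℕ) → m₁ a = m a := fun a ha =>
    run_frame (by simpa [writes] using ha) m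
  have he₁ : Env n k adj m₁ := he.frame (l := [62, 3]) (by decide) hf₁
  have hT₁ : terminals n m₁ = (treeOf n m).X r := by
    ext x
    refine and_congr_right fun hx => ?_
    rw [hm₁, run_forTo_pointwise TSET (fun j _ => m GRD (r * n + j)) (by decide), hb, if_pos hx]
    intro j m' _ hmj hf
    simp [hmj, hf GRD (by decide) (by decide), hf ROW (by decide) (by decide),
      hf 60 (by decide) (by decide), hr, he.row r hrn]
  set m₂ := m₁.set CNT 0 0 with hm₂
  have he₂ : Env n k adj m₂ := he₁.congr (by simp [hm₂]) (by simp [hm₂]) (by simp [hm₂])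
    (by simp [hm₂])
  have hb₂ : eN.eval m₂ = n := he₂.n_eq
  set m₃ := (forTo 62 eN (.ite (.read TSET (var 62)) (.assign CNT (var CNT + 1)) .skip)).run m₂
    with hm₃
  have hf₃ : ∀ a, a ∉ ([62, 53] : List ℕ) → m₃ a = m₂ a := fun a ha =>
    run_frame (by simpa [writes] using ha) m₂
  have he₃ : Env n k adj m₃ := he₂.frame (l := [62, 53]) (by decide) hf₃
  have hT₃ : m₃ TSET = m₁ TSET := by rw [hf₃ TSET (by decide), hm₂, Mem.set_of_ne _ _ _ (by decide)]
  have hcnt : m₃ CNT 0 = (terminals n m₃).ncard := by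
    rw [terminals, hT₃, ncard_eq_card_filter, hm₃, run_forTo_count CNT (fun v => m₁ TSET v ≠ 0)
      (by decide), hb₂]
    · simp [hm₂]
    · intro j m' _ hmj hf
      have h3 : m' TSET = m₁ TSET := by
        rw [hf TSET (by decide) (by decide), hm₂, Mem.set_of_ne _ _ _ (by decide)]
      simp only [run_ite_apply₂, run_write, run_skip, eval_read, eval_add, eval_lit, hmj, h3]
      split_ifs <;> simp
  have h60 : m₃ 60 0 = r := by
    rw [hf₃ 60 (by decide), hm₂, Mem.set_of_ne _ _ _ (by decide), hf₁ 60 (by decide), hr]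
  have hC₃ : m₃ COMP = m COMP := by
    rw [hf₃ COMP (by decide), hm₂, Mem.set_of_ne _ _ _ (by decide), hf₁ COMP (by decide)]
  have hb₃ : eN.eval m₃ = n := he₃.n_eq
  have hfin : ∀ m', (terminals n m').Finite := fun m' =>
    (Set.finite_lt_nat n).subset fun v hv => hv.1
  have hT₃' : terminals n m₃ = (treeOf n m).X r := by rw [← hT₁]; simp only [terminals, hT₃]
  have key : selectTerminals.run m CNT 0 = (terminals n (selectTerminals.run m)).ncard ∧
      selectTerminals.run m CNT 0 ≤ 2 * k - 1 ∧
      (treeOf n m).X r ⊆ terminals n (selectTerminals.run m) ∧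
      (selectTerminals.run m CNT 0 = 2 * k - 1 ∨ ∀ v < eN.eval m₃, v ∈ (treeOf n m).bag n r →
        v ∈ terminals n (selectTerminals.run m)) := by
    refine run_forTo (m := m₃) (I := fun t m' => m' CNT 0 = (terminals n m').ncard ∧
      m' CNT 0 ≤ 2 * k - 1 ∧ (treeOf n m).X r ⊆ terminals n m' ∧
      (m' CNT 0 = 2 * k - 1 ∨ ∀ v < t, v ∈ (treeOf n m).bag n r → v ∈ terminals n m')) ?_ ?_
    · have h1 : terminals n (m₃.set 62 0 0) = terminals n m₃ := by simp [terminals]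
      rw [h1, Mem.set_of_ne _ _ _ (by decide), hT₃']
      refine ⟨by rw [hcnt, hT₃'], by rw [hcnt, hT₃']; exact hX, subset_rfl, Or.inr (by simp)⟩
    · intro j m' hj hmj hf ⟨h1, h2, h3, h4⟩
      rw [hb₃] at hj
      have h5 : ∀ (m'' : Mem) (i : ℕ), terminals n (m''.set 62 0 i) = terminals n m'' := by
        intro m'' i; simp [terminals]
      have h6 : m' COMP = m COMP := (hf _ (by decide) (by decide)).trans hC₃
      have h7 : m' 60 0 = r := by rw [hf 60 (by decide) (by decide), h60]
      have h8 : m' 0 1 = k := by rw [hf 0 (by decide) (by decide), he₃.k_eq]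
      rw [h5, Mem.set_of_ne _ _ _ (by decide)]
      have hstay : (m' CNT 0 ≠ 2 * k - 1 → j ∈ (treeOf n m).bag n r → j ∈ terminals n m') →
          m' CNT 0 = (terminals n m').ncard ∧
          m' CNT 0 ≤ 2 * k - 1 ∧ (treeOf n m).X r ⊆ terminals n m' ∧
          (m' CNT 0 = 2 * k - 1 ∨ ∀ v < j + 1, v ∈ (treeOf n m).bag n r →
            v ∈ terminals n m') := by
        intro h
        refine ⟨h1, h2, h3, ?_⟩
        by_cases h9 : m' CNT 0 = 2 * k - 1
        · exact Or.inl h9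
        · refine Or.inr fun v hv hvr => ?_
          rcases Nat.lt_succ_iff_lt_or_eq.1 hv with h' | rfl
          exacts [h4.resolve_left h9 v h' hvr, h h9 hvr]
      rw [run_ite]
      by_cases h9 : m' TSET j = 0
      swap
      · rw [if_pos (by simpa [hmj] using h9), run_skip]
        exact hstay fun _ _ => ⟨hj, h9⟩
      rw [if_neg (by simpa [hmj] using h9), run_ite]
      by_cases h10 : m COMP j = r
      swap
      · rw [if_neg (by simp [eval_eq, hmj, h6, h7, h10]), run_skip]
        exact hstay fun _ h => absurd h.2 h10
      rw [if_pos (by simp [eval_eq, hmj, h6, h7, h10]), run_ite]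
      by_cases h11 : m' CNT 0 = 2 * k - 1
      · rw [if_neg (by simp [h8, h11]; omega), run_skip]
        exact hstay fun h => absurd h11 h
      rw [if_pos (by simp [h8]; omega)]
      have h12 : ((Cmd.write TSET (var 62) 1 ;; .assign CNT (var CNT + 1)).run m') =
          (m'.set TSET j 1).set CNT 0 (m' CNT 0 + 1) := by
        simp [hmj]
      have h13 : terminals n ((m'.set TSET j 1).set CNT 0 (m' CNT 0 + 1)) =
          insert j (terminals n m') := by
        ext x
        by_cases hxj : x = j
        · simp [terminals, hxj, hj]
        · simp [terminals, hxj]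
      rw [h12, h13, Mem.set_self, Function.update_self,
        Set.ncard_insert_of_notMem (fun h => h.2 h9) (hfin m'), h1]
      refine ⟨rfl, by omega, h3.trans (Set.subset_insert _ _), ?_⟩
      rw [← h1]
      refine Or.inr fun v hv hvr => ?_
      rcases Nat.lt_succ_iff_lt_or_eq.1 hv with h' | rfl
      · exact Or.inr (h4.resolve_left h11 v h' hvr)
      · exact Set.mem_insert _ _
  rw [hb₃] at key
  obtain ⟨h1, h2, h3, h4⟩ := key
  refine ⟨?_, h3⟩
  rw [← h1]
  refine h4.elim id fun h4 => ?_
  have : (treeOf n m).bag n r ∪ (treeOf n m).X r ⊆ terminals n (selectTerminals.run m) :=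
    Set.union_subset (fun v hv => h4 v hv.1 hv) h3
  have := Set.ncard_le_ncard this (hfin _)
  omega

/-- Processing the node `60`. -/
def processNode : Cmd :=
  .assign CNT 0 ;; .forTo 62 eN
    (.ite (eq (.read COMP (var 62)) (var 60) + .read GRD (.read ROW (var 60) + var 62))
      (.assign CNT (var CNT + 1)) .skip) ;;
    .ite (var CNT + 1 - (eK + eK + eK))
      (selectTerminals ;; search ;; .ite (var FOUND) refineNode (.write OUT 0 0)) .skip

/-- The result of the algorithm: a decomposition all of whose nodes `r < t` are finished, or a
linked set. -/
def Progress (n k : ℕ) (adj : ℕ → ℕ → Prop) (t : ℕ) (m : Mem) : Prop :=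
  (m OUT 0 = 1 ∧ (treeOf n m).IsPartial n k adj ∧
    (∀ r < (treeOf n m).size, r < t → (treeOf n m).Done n k r) ∧
    ∀ b < (treeOf n m).size, b ≠ 0 → (treeOf n m).par b < t) ∨
  (m OUT 0 = 0 ∧ (terminals n m).ncard = 2 * k - 1 ∧
    ∀ Z : Set ℕ, (∀ v ∈ Z, v < n) → Z.ncard ≤ k - 1 → ¬ GoodSep n adj (terminals n m) (k - 1) Z)

/-- A node whose bag and guard have at most `3 * k - 1` elements in total is finished already, since
it has no children before it is processed. -/
theorem run_processNode {m : Mem} (he : Env n k adj m) (hk : 1 ≤ k)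
    (hadj : ∀ u v, adj u v → u < n ∧ v < n) {r : ℕ} (hr : m 60 0 = r) (hout : m OUT 0 = 1)
    (hP : Progress n k adj r m) (hrM : r < (treeOf n m).size) :
    Progress n k adj (r + 1) (processNode.run m) := by
  classical
  rcases hP with ⟨-, hS, hdone, hpar⟩ | ⟨h, -⟩
  swap
  · omega
  have hrn : r < n := hrM.trans_le hS.size_le
  have hb : eN.eval (m.set CNT 0 0) = n := by simp [he.n_eq]
  set m₁ := (forTo 62 eN
    (.ite (eq (.read COMP (var 62)) (var 60) + .read GRD (.read ROW (var 60) + var 62))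
      (.assign CNT (var CNT + 1)) .skip)).run (m.set CNT 0 0) with hm₁
  have hf₁ : ∀ a, a ∉ ([62, 53] : List ℕ) → m₁ a = m a := fun a ha => by
    rw [hm₁, run_frame (by simpa [writes] using ha), Mem.set_of_ne]
    rintro rfl
    exact ha (by decide)
  have he₁ : Env n k adj m₁ := he.frame (l := [62, 53]) (by decide) hf₁
  have ht₁ : treeOf n m₁ = treeOf n m := treeOf_congr (hf₁ _ (by decide)) (hf₁ _ (by decide))
    (hf₁ _ (by decide)) (by rw [hf₁ _ (by decide)])
  have hcnt : m₁ CNT 0 = ((treeOf n m).bag n r ∪ (treeOf n m).X r).ncard := by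
    have h1 : (treeOf n m).bag n r ∪ (treeOf n m).X r =
        {v | v < n ∧ (m COMP v = r ∨ m GRD (r * n + v) ≠ 0)} := by
      ext v
      simp only [BagTree.bag, treeOf, Set.mem_union, Set.mem_ofPred_eq]
      tauto
    rw [h1, ncard_eq_card_filter, hm₁, run_forTo_count CNT
      (fun v => m COMP v = r ∨ m GRD (r * n + v) ≠ 0) (by decide), hb]
    · simp
    · intro j m' _ hmj hf
      have h2 : m' COMP = m COMP := (hf _ (by decide) (by decide)).trans (by simp)
      have h3 : m' GRD = m GRD := (hf _ (by decide) (by decide)).trans (by simp)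
      have h4 : m' ROW = m ROW := (hf _ (by decide) (by decide)).trans (by simp)
      have h5 : m' 60 0 = r := by rw [hf 60 (by decide) (by decide)]; simpa using hr
      simp only [run_ite_apply₂, run_write, run_skip, eval_read, eval_add, eval_lit, eval_eq, hmj,
        h2, h3, h4, h5, he.row r hrn]
      by_cases h6 : m COMP j = r <;> by_cases h7 : m GRD (r * n + j) = 0 <;> simp [h6, h7]
  have hrun : processNode.run m = (Cmd.ite (var CNT + 1 - (eK + eK + eK))
      (selectTerminals ;; search ;; .ite (var FOUND) refineNode (.write OUT 0 0))
      .skip).run m₁ := by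
    rw [processNode, run_seq, run_seq, run_write]
    rfl
  rw [hrun, run_ite]
  by_cases hw : ((treeOf n m).bag n r ∪ (treeOf n m).X r).ncard ≤ 3 * k - 1
  · -- the node is small enough, and has no children
    rw [if_neg (by simp [hcnt, he₁.k_eq]; omega), run_skip]
    refine Or.inl ⟨by rw [hf₁ _ (by decide), hout], by rwa [ht₁], ?_, ?_⟩
    · rw [ht₁]
      intro s hs hsr
      rcases Nat.lt_succ_iff_lt_or_eq.1 hsr with h | rfl
      · exact hdone s hs h
      · refine ⟨_, ?_, hw, Set.subset_union_left, Set.subset_union_right, ?_⟩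
        · refine (Set.finite_lt_nat n).subset ?_
          rintro v (h | h)
          exacts [h.1, h.1]
        · intro b hb hb0 hbs
          have := hpar b hb hb0
          omega
    · rw [ht₁]
      exact fun b hb hb0 => (hpar b hb hb0).trans (Nat.lt_succ_self r)
  · rw [if_pos (by simp [hcnt, he₁.k_eq]; omega), run_seq, run_seq]
    have hkn : k ≤ n := by
      have h1 : ((treeOf n m).bag n r ∪ (treeOf n m).X r).ncard ≤ n := by
        have h2 : (treeOf n m).bag n r ∪ (treeOf n m).X r ⊆ ↑(range n) := by
          rintro v (h | h)
          exacts [by simpa using h.1, by simpa using h.1]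
        have h3 := Set.ncard_le_ncard h2 (Finset.finite_toSet _)
        rwa [Set.ncard_coe_finset, card_range] at h3
      omega
    have hsel := run_selectTerminals he₁ (r := r) (by rw [hf₁ 60 (by decide), hr]) hrn
      (by rw [ht₁]; exact hS.guard_card r hrM) (by rw [ht₁]; omega)
    set m₂ := selectTerminals.run m₁ with hm₂
    rw [ht₁] at hsel
    have hf₂ : ∀ a, a ∉ selectTerminals.writes → m₂ a = m₁ a := fun a ha => run_frame ha m₁
    have he₂ : Env n k adj m₂ := he₁.run (by decide)
    have hT' : ∀ v ∈ terminals n m₂, v < n := fun v hv => hv.1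
    have hsearch := run_search he₂ hk hkn hadj (T := terminals n m₂) hT'
      (fun v hv => ⟨fun h => ⟨hv, h⟩, fun h => h.2⟩) hsel.1
    set m₃ := search.run m₂ with hm₃
    have hf₃ : ∀ a, a ∉ search.writes → m₃ a = m₂ a := fun a ha => run_frame ha m₂
    have he₃ : Env n k adj m₃ := he₂.run (by decide)
    have hT₃ : terminals n m₃ = terminals n m₂ := by
      simp only [terminals, hf₃ TSET (by decide)]
    have h₃ : ∀ a, a ∉ selectTerminals.writes ++ search.writes → m₃ a = m₁ a := fun a ha => by
      rw [hf₃ a fun h => ha (by simp [h]), hf₂ a fun h => ha (by simp [h])]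
    have ht₃ : treeOf n m₃ = treeOf n m := by
      rw [← ht₁]
      exact treeOf_congr (h₃ _ (by decide)) (h₃ _ (by decide)) (h₃ _ (by decide))
        (by rw [h₃ _ (by decide)])
    rw [run_ite]
    rcases hsearch with ⟨h1, h2, h3⟩ | ⟨h1, h2⟩
    · rw [if_pos (by simpa using h1)]
      have h4 := run_refineNode he₃ hk hadj (r := r)
        (by rw [h₃ 60 (by decide), hf₁ 60 (by decide), hr]) (by rwa [ht₃]) (by rwa [ht₃])
        (by rw [ht₃]; exact fun s hs => hdone s (hs.trans hrM) hs) (by rwa [ht₃]) hT'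
        (by rw [ht₃]; exact hsel.2) h2 h3
      obtain ⟨h5, h6, h7, h8⟩ := h4
      refine Or.inl ⟨?_, h5, fun s _ hs => h6 s (by omega), fun b hb hb0 => ?_⟩
      · rw [h8, h₃ OUT (by decide), hf₁ OUT (by decide), hout]
      · exact Nat.lt_succ_of_le (h7 b hb hb0)
    · rw [if_neg (by simpa using h1), run_write]
      have h3 : terminals n (m₃.set OUT 0 0) = terminals n m₂ := by
        rw [← hT₃]; simp [terminals]
      refine Or.inr ⟨by simp, ?_⟩
      simp only [eval_lit]
      rw [h3]
      exact ⟨hsel.1, h2⟩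

/-- Processing all nodes. New nodes are appended at the end. -/
def mainLoop : Cmd :=
  .forTo 60 eN (.ite (var OUT) (.ite (.read OUT 1 - var 60) processNode .skip) .skip)

theorem run_mainLoop {m : Mem} (he : Env n k adj m) (hk : 1 ≤ k)
    (hadj : ∀ u v, adj u v → u < n ∧ v < n) (h0 : Progress n k adj 0 m) :
    Progress n k adj n (mainLoop.run m) := by
  have hb : eN.eval m = n := he.n_eq
  have hset : ∀ t (m' : Mem) (j : ℕ), Progress n k adj t (m'.set 60 0 j) ↔
      Progress n k adj t m' := fun t m' j => by
    have h1 : treeOf n (m'.set 60 0 j) = treeOf n m' :=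
      treeOf_congr (by simp) (by simp) (by simp) (by simp)
    have h2 : terminals n (m'.set 60 0 j) = terminals n m' := by simp [terminals]
    simp only [Progress, h1, h2, Mem.set_of_ne _ _ _ (by decide : OUT ≠ 60)]
  have key : Progress n k adj (eN.eval m) (mainLoop.run m) := by
    refine run_forTo (I := fun t m' => Progress n k adj t m') ((hset _ _ _).2 h0) ?_
    intro j m' hj hmj hf hI
    have he' : Env n k adj m' :=
      he.congr (hf _ (by decide) (by decide)) (hf _ (by decide) (by decide))
        (hf _ (by decide) (by decide)) (hf _ (by decide) (by decide))
    rw [hset, run_ite]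
    by_cases h1 : m' OUT 0 = 0
    · rw [if_neg (by simpa using h1), run_skip]
      rcases hI with h | h
      · exact absurd h.1 (by omega)
      · exact Or.inr h
    rw [if_pos (by simpa using h1), run_ite]
    have h2 : m' OUT 0 = 1 := by
      rcases hI with h | h
      exacts [h.1, absurd h.1 h1]
    by_cases h3 : j < (treeOf n m').size
    · rw [if_pos (by simpa [hmj, Nat.sub_eq_zero_iff_le, treeOf] using h3)]
      exact run_processNode he' hk hadj hmj h2 hI h3
    · rw [if_neg (by simpa [hmj, Nat.sub_eq_zero_iff_le, treeOf] using h3), run_skip]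
      rcases hI with ⟨h4, h5, h6, h7⟩ | h
      · exact Or.inl ⟨h4, h5, fun r hr _ => h6 r hr (by omega),
          fun b hb hb0 => (h7 b hb hb0).trans (Nat.lt_succ_self j)⟩
      · exact absurd h.1 h1
  rwa [hb] at key

/-! ### Initialization and running time -/

/-- Writing the tables, and the decomposition with only one node. Array `0` is written in the very
end, since the bounds of the loops are read from it. -/
def setup : Cmd :=
  .assign 64 0 ;; .forTo 62 eN (.write ROW (var 62) (var 64) ;; .assign 64 (var 64 + eN)) ;;
    .assign 64 0 ;; .forTo 62 (eN + eN)
      (.write ROW2 (var 62) (var 64) ;; .assign 64 (var 64 + (eN + eN))) ;;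
    .write OUT 0 1 ;; .write OUT 1 1 ;; .assign 64 1 ;;
    .forTo 62 (eK + eK + eK + eK + eK + eK + eK + eK) (.assign 64 (var 64 + var 64 + var 64)) ;;
    .write 0 2 (var 64)

theorem run_table {m : Mem} {a : ℕ} (ha : a ∉ ([0, 62, 64] : List ℕ)) {e : Expr}
    (he : e.pure0 = true) (h0 : m 64 0 = 0) :
    ∀ x < e.eval m, (forTo 62 e (.write a (var 62) (var 64) ;; .assign 64 (var 64 + e))).run m a x =
      x * e.eval m := by
  simp only [List.mem_cons, List.not_mem_nil, or_false, not_or] at ha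
  have key : (forTo 62 e (.write a (var 62) (var 64) ;; .assign 64 (var 64 + e))).run m 64 0 =
      e.eval m * e.eval m ∧ ∀ x < e.eval m,
      (forTo 62 e (.write a (var 62) (var 64) ;; .assign 64 (var 64 + e))).run m a x =
      x * e.eval m := by
    refine run_forTo (I := fun t m' => m' 64 0 = t * e.eval m ∧ ∀ x < t, m' a x = x * e.eval m)
      (by simp [h0]) ?_
    intro j m' _ hmj hf ⟨h1, h2⟩
    have h3 : m' 0 = m 0 := hf 0 (by decide) (by simp [writes, Ne.symm ha.1])
    have h4 : ∀ y, e.eval (m'.set a j y) = e.eval m := fun y => by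
      rw [eval_pure0 he, Mem.set_of_ne _ _ _ (Ne.symm ha.1), h3, ← eval_pure0 he]
    have h5 : (64 : ℕ) ≠ a := Ne.symm ha.2.2
    simp only [run_seq, run_write, eval_read, eval_lit, eval_add, hmj, h4,
      Mem.set_of_ne _ _ _ h5, Mem.set_of_ne _ _ _ (by decide : 64 ≠ 62),
      Mem.set_of_ne _ _ _ ha.2.1, Mem.set_of_ne _ _ _ ha.2.2, Mem.set_self, Function.update_self,
      h1, Function.update_apply]
    refine ⟨by ring, fun x hx => ?_⟩
    split_ifs with h6
    · rw [h6]
    · exact h2 x (by omega)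
  exact key.2

theorem run_setup {m : Mem} (hn : m 0 0 = n) (hk : m 0 1 = k)
    (hM : ∀ u < n, ∀ v < n, (m MAT (u * n + v) ≠ 0 ↔ adj u v)) :
    Env n k adj (setup.run m) ∧ setup.run m OUT 0 = 1 ∧ setup.run m OUT 1 = 1 ∧
      ∀ a, a ∉ setup.writes → setup.run m a = m a := by
  set m₁ := m.set 64 0 0 with hm₁
  set m₂ := (forTo 62 eN (.write ROW (var 62) (var 64) ;; .assign 64 (var 64 + eN))).run m₁ with hm₂
  set m₃ := m₂.set 64 0 0 with hm₃
  set m₄ := (forTo 62 (eN + eN)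
      (.write ROW2 (var 62) (var 64) ;; .assign 64 (var 64 + (eN + eN)))).run m₃ with hm₄
  set m₅ := ((m₄.set OUT 0 1).set OUT 1 1).set 64 0 1 with hm₅
  set m₆ := (forTo 62 (eK + eK + eK + eK + eK + eK + eK + eK)
    (.assign 64 (var 64 + var 64 + var 64))).run m₅ with hm₆
  have hf₂ : ∀ a, a ∉ ([62, ROW, 64] : List ℕ) → m₂ a = m₁ a := fun a ha =>
    run_frame (by simpa [writes] using ha) m₁
  have hf₄ : ∀ a, a ∉ ([62, ROW2, 64] : List ℕ) → m₄ a = m₃ a := fun a ha =>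
    run_frame (by simpa [writes] using ha) m₃
  have hf₆ : ∀ a, a ∉ ([62, 64] : List ℕ) → m₆ a = m₅ a := fun a ha =>
    run_frame (by simpa [writes] using ha) m₅
  have hrun : setup.run m = m₆.set 0 2 (m₆ 64 0) := by
    simp only [setup, run_seq, run_write, eval_lit, eval_read, hm₆, hm₅, hm₄, hm₃, hm₂, hm₁]
  have h1 : m₁ 0 = m 0 := by simp [hm₁]
  have h2 : m₂ 0 = m 0 := by rw [hf₂ 0 (by decide), h1]
  have h3 : m₃ 0 = m 0 := by rw [hm₃, Mem.set_of_ne _ _ _ (by decide), h2]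
  have h4 : m₄ 0 = m 0 := by rw [hf₄ 0 (by decide), h3]
  have h5 : m₅ 0 = m 0 := by simp [hm₅, h4]
  have h6 : m₆ 0 = m 0 := by rw [hf₆ 0 (by decide), h5]
  have hpow : m₆ 64 0 = 3 ^ (8 * k) := by
    have hb : (eK + eK + eK + eK + eK + eK + eK + eK).eval m₅ = 8 * k := by
      simp [h5, hk]; omega
    rw [← hb]
    refine run_forTo (I := fun t m' => m' 64 0 = 3 ^ t) (by simp [hm₅]) ?_
    intro j m' _ _ _ hI
    simp [hI]
    ring
  refine ⟨⟨by simp [hrun, h6, hn], by simp [hrun, h6, hk], by simp [hrun, hpow], ?_, ?_, ?_⟩,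
    ?_, ?_, fun a ha => run_frame ha m⟩
  · rw [run_frame (by decide)]; exact hM
  · intro u hu
    have h7 : setup.run m ROW = m₂ ROW := by
      rw [hrun, Mem.set_of_ne _ _ _ (by decide), hf₆ ROW (by decide)]
      simp [hm₅, hf₄ ROW (by decide), hm₃]
    have h8 : eN.eval m₁ = n := by simp [h1, hn]
    rw [h7, hm₂, run_table (by decide) (by decide) (by simp [hm₁]) u (by rw [h8]; exact hu), h8]
  · intro u hu
    have h7 : setup.run m ROW2 = m₄ ROW2 := by
      rw [hrun, Mem.set_of_ne _ _ _ (by decide), hf₆ ROW2 (by decide)]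
      simp [hm₅]
    have h8 : (eN + eN).eval m₃ = 2 * n := by simp [h3, hn, two_mul]
    rw [h7, hm₄, run_table (by decide) (by decide) (by simp [hm₃]) u (by rw [h8]; exact hu), h8]
  · rw [hrun, Mem.set_of_ne _ _ _ (by decide), hf₆ OUT (by decide)]
    simp [hm₅]
  · rw [hrun, Mem.set_of_ne _ _ _ (by decide), hf₆ OUT (by decide)]
    simp [hm₅]

/-- The decomposition with only one node. -/
theorem progress_setup {m : Mem} (hn : 1 ≤ n)
    (h0 : m OUT 0 = 1) (h1 : m OUT 1 = 1) (hc : ∀ v, m COMP v = 0) (hg : ∀ v, m GRD v = 0) :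
    Progress n k adj 0 m := by
  have hX : ∀ b, (treeOf n m).X b = ∅ := fun b => by
    ext v
    simp [treeOf, hg]
  have hs : (treeOf n m).size = 1 := h1
  refine Or.inl ⟨h0, ⟨by omega, ?_, ?_, ?_, ?_, hX 0, ?_, ?_⟩, by simp, ?_⟩
  · intro b hb hb0; omega
  · intro v _
    rw [hs]
    exact (hc v).trans_lt Nat.one_pos
  · intro r hr
    exact ⟨0, hn, (hc 0).trans (by omega)⟩
  · intro b hb hb0; omega
  · intro b _ v hv
    rw [hX] at hv
    exact absurd hv (Set.notMem_empty v)
  · intro b _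
    rw [hX, Set.ncard_empty]
    exact Nat.zero_le _
  · intro b hb hb0; omega

theorem boundsLe_setup {z : ℕ → ℕ} {S : ℕ} (h : 8 * (z 0 + z 1) ≤ S) :
    setup.BoundsLe S z := by
  have h1 : eN.eval (fun _ => z) ≤ S := by simp; omega
  have h2 : (eN + eN).eval (fun _ => z) ≤ S := by simp; omega
  have h3 : (eK + eK + eK + eK + eK + eK + eK + eK).eval (fun _ => z) ≤ S := by simp; omega
  simp only [setup, BoundsLe, h1, h2, h3, and_self]

theorem boundsLe_mainLoop {z : ℕ → ℕ} {S : ℕ} (h : 8 * (z 0 + z 1) ≤ S) (h' : z 2 ≤ S) :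
    mainLoop.BoundsLe S z := by
  have h1 : eN.eval (fun _ => z) ≤ S := by simp; omega
  have h2 : (eN + eN).eval (fun _ => z) ≤ S := by simp; omega
  have h3 : (eK + eK + eK + eK + eK + eK + eK + eK).eval (fun _ => z) ≤ S := by simp; omega
  have h4 : (eK + eK + eK).eval (fun _ => z) ≤ S := by simp; omega
  have h5 : (Expr.read 0 2).eval (fun _ => z) ≤ S := h'
  have hbfs : bfs.BoundsLe S z := by simp only [bfs, bfsRound, bfsBody, BoundsLe, h2, and_self]
  have hreach : reachMat.BoundsLe S z := by
    simp only [reachMat, reachBody, adjBody, BoundsLe, h1, h2, hbfs, and_self]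
  have hphase : phase.BoundsLe S z := by
    simp only [phase, capBody, initMarks, stepCut, searchPath, findSrc, augment, augmentBody,
      pickBranch, collectCut, BoundsLe, h1, h2, h4, hbfs, and_self]
  have hcand : findCandidate.BoundsLe S z := by
    simp only [findCandidate, setLabels, BoundsLe, h1, hphase, and_self]
  have hsearch : search.BoundsLe S z := by
    simp only [search, verify, countComp, increment, BoundsLe, h1, h3, h5, hreach, hcand, and_self]
  have hrefine : refineNode.BoundsLe S z := by
    simp only [refineNode, addNode, copySep, writeGuard, copyGuard, writeBag, BoundsLe, h1, hreach,
      and_self]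
  simp only [mainLoop, processNode, selectTerminals, BoundsLe, h1, hsearch, hrefine, and_self]

/-- The combination of the two bounds: polynomial time in the largest bound of a loop, and the size
of that bound. -/
theorem time_bound (K d : ℕ) : ∃ c : ℕ, ∀ n k : ℕ, 1 ≤ n → 1 ≤ k →
    ((K * (8 * (n + k) + 3 ^ (8 * k) + 1) ^ d : ℕ) : ℝ) ≤
      c * (2 : ℝ) ^ (c * (k * Real.logb 2 k) : ℝ) * (n : ℝ) ^ c := by
  refine ⟨K * 3 ^ (9 * d) + 18 * d, fun n k hn hk => ?_⟩
  set c := K * 3 ^ (9 * d) + 18 * d with hc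
  have h3 : (8 * (n + k) + 3 ^ (8 * k) + 1) ≤ n * 3 ^ (9 * k) := by
    have h4 : 1 + 16 * k ≤ 3 ^ (8 * k) := by
      have : ((1 + ((8 * k : ℕ) : ℤ) * 2 : ℤ)) ≤ (1 + 2) ^ (8 * k) :=
        one_add_mul_le_pow (by norm_num) _
      zify
      push_cast at this
      linarith
    have h5 : 3 ^ (8 * k) * 3 ≤ 3 ^ (9 * k) := by
      rw [← pow_succ]; exact Nat.pow_le_pow_right (by omega) (by omega)
    have h6 : n * (3 ^ (8 * k) * 3) ≤ n * 3 ^ (9 * k) := Nat.mul_le_mul_left _ h5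
    have h7 : 8 * (n + k) + 3 ^ (8 * k) + 1 ≤ n * (8 * k + 8 + 3 ^ (8 * k) + 1) := by
      nlinarith [Nat.one_le_pow (8 * k) 3 (by omega)]
    refine h7.trans (le_trans (Nat.mul_le_mul_left _ ?_) h6)
    omega
  have h4 : K * (8 * (n + k) + 3 ^ (8 * k) + 1) ^ d ≤ K * (n ^ d * 3 ^ (9 * k * d)) := by
    refine Nat.mul_le_mul_left _ ?_
    rw [pow_mul 3 (9 * k) d, ← mul_pow]
    exact Nat.pow_le_pow_left h3 d
  have hn1 : (1 : ℝ) ≤ n := by exact_mod_cast hn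
  have h5 : (n : ℝ) ^ d ≤ (n : ℝ) ^ c := pow_le_pow_right₀ hn1 (by omega)
  have h6 : (K : ℝ) * 3 ^ (9 * k * d) ≤ c * (2 : ℝ) ^ (c * (k * Real.logb 2 k) : ℝ) := by
    rcases hk.eq_or_lt with rfl | hk2
    · have : (K : ℝ) * 3 ^ (9 * 1 * d) ≤ c := by
        rw [mul_one]
        exact_mod_cast Nat.le_add_right _ _
      simpa using this
    · -- `k ≤ k * log k` holds from `k = 2` on
      have hlog : 1 ≤ Real.logb 2 k := by
        rw [Real.le_logb_iff_rpow_le (by norm_num) (by positivity)]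
        rw [Real.rpow_one]
        exact_mod_cast hk2
      have h7 : (3 : ℝ) ^ (9 * k * d) ≤ (2 : ℝ) ^ (c * (k * Real.logb 2 k) : ℝ) := by
        have h8 : (3 : ℝ) ^ (9 * k * d) ≤ (2 : ℝ) ^ (18 * d * k) := by
          have : (2 : ℝ) ^ (18 * d * k) = (4 : ℝ) ^ (9 * k * d) := by
            rw [show 18 * d * k = 2 * (9 * k * d) by ring, pow_mul]; norm_num
          rw [this]
          gcongr
          norm_num
        refine h8.trans ?_
        rw [← Real.rpow_natCast]
        refine Real.rpow_le_rpow_of_exponent_le (by norm_num) ?_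
        push_cast
        refine mul_le_mul ?_ ?_ (by positivity) (by positivity)
        · exact_mod_cast (Nat.le_add_left _ _ : 18 * d ≤ c)
        · exact le_mul_of_one_le_right (by positivity) hlog
      have h9 : (K : ℝ) ≤ c := by
        have : K ≤ c := (Nat.le_mul_of_pos_right K (by positivity)).trans (Nat.le_add_right _ _)
        exact_mod_cast this
      exact mul_le_mul h9 h7 (by positivity) (by positivity)
  calc ((K * (8 * (n + k) + 3 ^ (8 * k) + 1) ^ d : ℕ) : ℝ)
      ≤ ((K * (n ^ d * 3 ^ (9 * k * d)) : ℕ) : ℝ) := by exact_mod_cast h4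
    _ = ((K : ℝ) * 3 ^ (9 * k * d)) * (n : ℝ) ^ d := by push_cast; ring
    _ ≤ _ := mul_le_mul h6 h5 (by positivity) (by positivity)

/-! ### Walks and strong components -/

section Walks

variable {V : Type*} {D : Digraph V}

/-- Reachability in the subdigraph induced by `A`. -/
abbrev ReachIn (D : Digraph V) (A : Set V) : V → V → Prop :=
  ReflTransGen fun u v => D.Adj u v ∧ u ∈ A ∧ v ∈ A

theorem ReachIn.mono {A B : Set V} (h : A ⊆ B) {u v : V} (huv : ReachIn D A u v) :
    ReachIn D B u v :=
  ReflTransGen.mono (fun _ _ h' => ⟨h'.1, h h'.2.1, h h'.2.2⟩) _ _ huv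

theorem ReachIn.mem {A : Set V} {u v : V} (huv : ReachIn D A u v) (hu : u ∈ A) : v ∈ A := by
  rcases huv.cases_tail with rfl | ⟨w, -, hw⟩
  exacts [hu, hw.2.2]

theorem IsWalkIn.reachIn_ends {A : Set V} {u v : V} {l : List V} (h : IsWalkIn D A u v l) :
    ReachIn D A u v := by
  induction l generalizing u with
  | nil => simp [IsWalkIn] at h
  | cons a l ih =>
    obtain ⟨h1, h2, h3, h4⟩ := h
    obtain rfl : a = u := by simpa using h1
    cases l with
    | nil =>
      obtain rfl : a = v := by simpa using h2
      exact .refl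
    | cons b l =>
      rw [List.isChain_cons_cons] at h3
      exact .head ⟨h3.1, h4 a (by simp), h4 b (by simp)⟩
        (ih ⟨rfl, by simpa using h2, h3.2, fun y hy => h4 y (List.mem_cons_of_mem _ hy)⟩)

theorem IsWalkIn.reachIn {A : Set V} {u v : V} {l : List V} (h : IsWalkIn D A u v l) {x : V}
    (hx : x ∈ l) : ReachIn D A u x ∧ ReachIn D A x v := by
  obtain ⟨l₁, l₂, rfl⟩ := List.append_of_mem hx
  obtain ⟨h1, h2, h3, h4⟩ := h
  have h5 : IsWalkIn D A u x (l₁ ++ [x]) := by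
    refine ⟨?_, by simp, ?_, fun y hy => h4 y ?_⟩
    · cases l₁ <;> simpa using h1
    · rw [← List.singleton_append, ← List.append_assoc] at h3
      exact h3.left_of_append
    · simp at hy ⊢; tauto
  have h6 : IsWalkIn D A x v (x :: l₂) :=
    ⟨rfl, by simpa using h2, h3.right_of_append, fun y hy => h4 y (by simp at hy ⊢; tauto)⟩
  exact ⟨h5.reachIn_ends, h6.reachIn_ends⟩

theorem ReachIn.exists_walk {A : Set V} {u v : V} (h : ReachIn D A u v) (hv : v ∈ A) :
    ∃ l, IsWalkIn D A u v l := by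
  induction h using ReflTransGen.head_induction_on with
  | refl => exact ⟨[v], rfl, rfl, by simp, by simpa using hv⟩
  | @head a c hac _ ih =>
    obtain ⟨l, h1, h2, h3, h4⟩ := ih
    cases l with
    | nil => simp at h1
    | cons b l =>
      obtain rfl : b = c := by simpa using h1
      refine ⟨a :: b :: l, rfl, by simpa using h2, List.isChain_cons_cons.2 ⟨hac.1, h3⟩, ?_⟩
      rintro x (_ | ⟨_, hx⟩)
      exacts [hac.2.1, h4 x hx]

/-- The vertices that are mutually reachable with `u` without the vertices in `Z`. -/
def reachClass (D : Digraph V) (Z : Set V) (u : V) : Set V :=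
  {v | ReachIn D Zᶜ u v ∧ ReachIn D Zᶜ v u}

theorem isStrongComponent_reachClass {Z : Set V} {u : V} (hu : u ∉ Z) :
    IsStrongComponent D Z (reachClass D Z u) := by
  have hmem : ∀ x ∈ reachClass D Z u, x ∈ Zᶜ := fun x hx => hx.1.mem hu
  refine ⟨⟨⟨u, .refl, .refl⟩, Set.disjoint_left.2 hmem, fun a ha b hb => ?_⟩, ?_⟩
  · obtain ⟨l, hl⟩ := ReachIn.exists_walk (ha.2.trans hb.1) (hmem b hb)
    exact ⟨l, hl.1, hl.2.1, hl.2.2.1, fun x hx => ⟨ha.1.trans (hl.reachIn hx).1,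
      (hl.reachIn hx).2.trans hb.2⟩⟩
  · rintro A ⟨-, hAZ, hA⟩ hle a ha
    have hsub : A ⊆ Zᶜ := fun x hx => Set.disjoint_left.1 hAZ hx
    have huA : u ∈ A := hle ⟨.refl, .refl⟩
    obtain ⟨l, hl⟩ := hA u huA a ha
    obtain ⟨l', hl'⟩ := hA a ha u huA
    exact ⟨hl.reachIn_ends.mono hsub, hl'.reachIn_ends.mono hsub⟩

theorem isGuarded_reachClass {Z : Set V} {u : V} (hu : u ∉ Z) :
    IsGuarded D Z (reachClass D Z u) :=
  ⟨Set.disjoint_left.2 fun _ hx => hx.1.mem hu, fun _ ha _ hb _ hl _ hx =>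
    ⟨ha.1.trans (hl.reachIn hx).1, (hl.reachIn hx).2.trans hb.2⟩⟩

end Walks

/-- The adjacency relation of `ofMult μ` as a relation between natural numbers. -/
def multAdj (μ : Fin n → Fin n → ℕ) (u v : ℕ) : Prop :=
  ∃ (hu : u < n) (hv : v < n), μ ⟨u, hu⟩ ⟨v, hv⟩ ≠ 0

theorem reach_iff_reachIn (μ : Fin n → Fin n → ℕ) (Z : Set ℕ) (u v : Fin n) :
    Reach (multAdj μ) Z u v ↔ ReachIn (ofMult μ) {x : Fin n | (x : ℕ) ∈ Z}ᶜ u v := by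
  constructor
  · intro h
    have key : ∀ a, Reach (multAdj μ) Z a v → ∀ ha : a < n,
        ReachIn (ofMult μ) {x : Fin n | (x : ℕ) ∈ Z}ᶜ ⟨a, ha⟩ v := by
      intro a h
      induction h using ReflTransGen.head_induction_on with
      | refl => exact fun _ => .refl
      | head hac _ ih =>
        obtain ⟨⟨ha, hc, h1⟩, h2, h3⟩ := hac
        exact fun _ => .head ⟨h1, h2, h3⟩ (ih hc)
    exact key u h u.2
  · intro h
    exact ReflTransGen.lift (fun x : Fin n => (x : ℕ))
      (fun a b h' => ⟨⟨a.2, b.2, h'.1⟩, h'.2.1, h'.2.2⟩) _ _ h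

theorem mem_scc_iff_mem_reachClass (μ : Fin n → Fin n → ℕ) (Z : Set ℕ) (u v : Fin n) :
    (v : ℕ) ∈ scc (multAdj μ) Z u ↔ v ∈ reachClass (ofMult μ) {x : Fin n | (x : ℕ) ∈ Z} u :=
  and_congr (reach_iff_reachIn μ Z u v) (reach_iff_reachIn μ Z v u)

theorem IsBalancedSeparator.goodSep {μ : Fin n → Fin n → ℕ} {T Z : Set (Fin n)} {r : ℕ}
    (h : IsBalancedSeparator (ofMult μ) T r Z) :
    GoodSep n (multAdj μ) (Fin.val '' T) r (Fin.val '' Z) := by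
  intro v hv hvZ
  have hZ : {x : Fin n | (x : ℕ) ∈ Fin.val '' Z} = Z := by
    ext x
    exact ⟨fun ⟨y, hy, hyx⟩ => Fin.val_injective hyx ▸ hy, fun hx => ⟨x, hx, rfl⟩⟩
  have h1 := h _ (isStrongComponent_reachClass (u := (⟨v, hv⟩ : Fin n))
    fun h' => hvZ ⟨_, h', rfl⟩)
  rw [← Set.ncard_image_of_injective _ Fin.val_injective] at h1
  refine (Set.ncard_le_ncard ?_ ((Set.toFinite _).image _)).trans h1
  rintro _ ⟨⟨u, hu, rfl⟩, h2, h3⟩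
  have := (mem_scc_iff_mem_reachClass μ (Fin.val '' Z) ⟨v, hv⟩ u).1 ⟨h3, h2⟩
  rw [hZ] at this
  exact ⟨u, ⟨this, hu⟩, rfl⟩

/-! ### Reading the output -/

theorem image_outputSet (m : Mem) : Fin.val '' outputSet n m = terminals n m := by
  ext v
  exact ⟨fun ⟨u, hu, h⟩ => h ▸ ⟨u.2, hu⟩, fun h => ⟨⟨v, h.1⟩, h.2, rfl⟩⟩

theorem linked_of_forall_not_goodSep {μ : Fin n → Fin n → ℕ} {m : Mem}
    (h : ∀ Z : Set ℕ, (∀ v ∈ Z, v < n) → Z.ncard ≤ k - 1 →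
      ¬ GoodSep n (multAdj μ) (terminals n m) (k - 1) Z) {Z : Set (Fin n)}
    (hZ : IsBalancedSeparator (ofMult μ) (outputSet n m) (k - 1) Z) : k - 1 < Z.ncard := by
  by_contra hlt
  refine h (Fin.val '' Z) ?_ ?_ (by rw [← image_outputSet]; exact hZ.goodSep)
  · rintro _ ⟨v, -, rfl⟩
    exact v.2
  · rw [Set.ncard_image_of_injective _ Fin.val_injective]
    omega

theorem reachIn_outputTree_iff {m : Mem} (h : (treeOf n m).IsPartial n k adj)
    (a b : Fin (m OUT 1)) :
    ReachIn (outputTree n m).R Set.univ a b ↔ (treeOf n m).Anc a b := by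
  constructor
  · intro h'
    exact ReflTransGen.lift (fun x : Fin (m OUT 1) => (x : ℕ)) (fun a b h' => h'.1) _ _ h'
  · intro h'
    have key : ∀ c, (treeOf n m).Anc a c → ∀ hc : c < m OUT 1,
        ReachIn (outputTree n m).R Set.univ a ⟨c, hc⟩ := by
      intro c h'
      induction h' with
      | refl => exact fun _ => .refl
      | @tail c d _ hcd ih =>
        intro hd
        have h1 := h.par_lt d hd hcd.1
        rw [hcd.2] at h1
        exact (ih (h1.trans hd)).tail ⟨hcd, trivial, trivial⟩
    exact key b h' b.2

theorem exists_walk_outputTree_iff {m : Mem} (h : (treeOf n m).IsPartial n k adj)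
    (a b : Fin (m OUT 1)) :
    (∃ l, IsWalkIn (outputTree n m).R Set.univ a b l) ↔ (treeOf n m).Anc a b := by
  rw [← reachIn_outputTree_iff h]
  exact ⟨fun ⟨_, hl⟩ => hl.reachIn_ends, fun h' => h'.exists_walk trivial⟩

theorem mem_below_outputTree_iff {m : Mem} (h : (treeOf n m).IsPartial n k adj)
    (b : Fin (m OUT 1)) (v : Fin n) :
    v ∈ (outputTree n m).below b ↔ (v : ℕ) ∈ (treeOf n m).below n b := by
  simp only [TreeData.below, Set.mem_iUnion, Set.mem_ofPred_eq, exists_prop,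
    exists_walk_outputTree_iff h]
  constructor
  · rintro ⟨r, hr, hv⟩
    exact ⟨v.2, by rw [show (treeOf n m).comp v = r from hv]; exact hr⟩
  · rintro ⟨-, hv⟩
    exact ⟨⟨_, h.comp_lt v v.2⟩, hv, rfl⟩

theorem isArborescence_outputTree {m : Mem} (h : (treeOf n m).IsPartial n k adj) :
    IsArborescence (outputTree n m).R ⟨0, h.pos⟩ := by
  have hlt : ∀ a b, (outputTree n m).R.Adj a b → a < b := by
    rintro a b ⟨h1, h2⟩
    have : (a : ℕ) < b := h2 ▸ h.par_lt b b.2 h1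
    exact this
  have hreach : ∀ r, ReachIn (outputTree n m).R Set.univ ⟨0, h.pos⟩ r := fun r =>
    (reachIn_outputTree_iff h _ r).2 (h.anc_zero r.2)
  refine ⟨?_, fun a b hab hba => lt_asymm (hlt a b hab) (hlt b a hba), fun r =>
    (hreach r).exists_walk trivial⟩
  set G := (outputTree n m).R.toSimpleGraphInclusive with hG
  have hadj : ∀ a b, (outputTree n m).R.Adj a b → G.Adj a b := fun a b hab =>
    ⟨(hlt a b hab).ne, Or.inl hab⟩
  have hconn : G.Connected := by
    have h0 : ∀ r, G.Reachable ⟨0, h.pos⟩ r := by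
      intro r
      have := hreach r
      induction this with
      | refl => exact .refl _
      | tail _ hcd ih => exact ih.trans (hadj _ _ hcd.1).reachable
    exact { preconnected := fun a b => (h0 a).symm.trans (h0 b), nonempty := ⟨⟨0, h.pos⟩⟩ }
  rw [SimpleGraph.isTree_iff_connected_and_card]
  refine ⟨hconn, le_antisymm ?_ hconn.card_vert_le_card_edgeSet_add_one⟩
  -- the edges are determined by their heads
  have hsub : G.edgeSet ⊆ (fun b : Fin (m OUT 1) =>
      s(⟨m PAR b % m OUT 1, Nat.mod_lt _ h.pos⟩, b)) '' ({⟨0, h.pos⟩}ᶜ) := by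
    intro e
    induction e using Sym2.ind with
    | _ a b =>
      have key : ∀ a b, (outputTree n m).R.Adj a b → s(a, b) ∈ (fun b : Fin (m OUT 1) =>
          s(⟨m PAR b % m OUT 1, Nat.mod_lt _ h.pos⟩, b)) '' ({⟨0, h.pos⟩}ᶜ) := by
        rintro a b ⟨h1, h2⟩
        refine ⟨b, fun h3 => h1 (congrArg Fin.val h3), ?_⟩
        have : (⟨m PAR b % m OUT 1, Nat.mod_lt _ h.pos⟩ : Fin (m OUT 1)) = a := by
          apply Fin.ext
          change m PAR b % m OUT 1 = a
          rw [show m PAR b = a from h2, Nat.mod_eq_of_lt a.2]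
        simp only [this]
      rintro ⟨-, hab | hba⟩
      · exact key a b hab
      · rw [Sym2.eq_swap]; exact key b a hba
  have h1 := (Set.ncard_le_ncard hsub (Set.toFinite _)).trans (Set.ncard_image_le (Set.toFinite _))
  have h2 := Set.ncard_add_ncard_compl ({⟨0, h.pos⟩} : Set (Fin (m OUT 1)))
  rw [Set.ncard_singleton] at h2
  have h3 : Nat.card G.edgeSet = G.edgeSet.ncard := rfl
  omega

theorem isStrongComponent_outputTree {μ : Fin n → Fin n → ℕ} {m : Mem}
    (h : (treeOf n m).IsPartial n k (multAdj μ)) {a b : Fin (m OUT 1)}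
    (hab : (outputTree n m).R.Adj a b) :
    IsStrongComponent (ofMult μ) ((outputTree n m).X a b) ((outputTree n m).below b) ∧
      IsGuarded (ofMult μ) ((outputTree n m).X a b) ((outputTree n m).below b) := by
  obtain ⟨u, hu, huX, hub⟩ := h.strong b b.2 hab.1
  have hX : (outputTree n m).X a b = {x : Fin n | (x : ℕ) ∈ (treeOf n m).X b} := by
    ext x
    exact ⟨fun hx => ⟨x.2, hx⟩, fun hx => hx.2⟩
  have hbelow : (outputTree n m).below b =
      reachClass (ofMult μ) ((outputTree n m).X a b) ⟨u, hu⟩ := by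
    ext v
    rw [mem_below_outputTree_iff h, hub, hX]
    exact mem_scc_iff_mem_reachClass μ _ ⟨u, hu⟩ v
  rw [hbelow]
  have hu' : (⟨u, hu⟩ : Fin n) ∉ (outputTree n m).X a b := by
    rw [hX]; exact huX
  exact ⟨isStrongComponent_reachClass hu', isGuarded_reachClass hu'⟩

theorem isArborealDecomposition_outputTree {μ : Fin n → Fin n → ℕ} {m : Mem}
    (h : (treeOf n m).IsPartial n k (multAdj μ)) :
    (outputTree n m).IsArborealDecomposition (ofMult μ) := by
  refine ⟨⟨_, isArborescence_outputTree h⟩, ⟨?_, ?_, ?_⟩,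
    fun a b hab => (isStrongComponent_outputTree h hab).2⟩
  · intro r
    obtain ⟨v, hv, hvr⟩ := h.nonempty r r.2
    exact ⟨⟨v, hv⟩, hvr⟩
  · intro r r' hrr
    rw [Set.disjoint_left]
    intro v hv hv'
    exact hrr (Fin.ext (Eq.trans (Eq.symm hv) hv'))
  · rw [Set.eq_univ_iff_forall]
    intro v
    exact Set.mem_iUnion.2 ⟨⟨_, h.comp_lt v v.2⟩, rfl⟩

theorem guardsAt_outputTree_subset {m : Mem} {r : Fin (m OUT 1)} {G : Set ℕ}
    (hX : (treeOf n m).X r ⊆ G) (hG : (treeOf n m).ChildrenFit n r G) :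
    (outputTree n m).guardsAt r ⊆ {x : Fin n | (x : ℕ) ∈ G} := by
  intro x hx
  simp only [TreeData.guardsAt, Set.mem_iUnion] at hx
  obtain ⟨a, b, ⟨hab, har | hbr⟩, hx⟩ := hx
  · exact (hG b b.2 hab.1 (hab.2.trans (congrArg Fin.val har))).1 ⟨x.2, hx⟩
  · subst hbr
    exact hX ⟨x.2, hx⟩

theorem isNice_outputTree {μ : Fin n → Fin n → ℕ} {m : Mem}
    (h : (treeOf n m).IsPartial n k (multAdj μ))
    (hd : ∀ r < (treeOf n m).size, (treeOf n m).Done n k r) :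
    (outputTree n m).IsNice (ofMult μ) := by
  refine ⟨fun a b hab => (isStrongComponent_outputTree h hab).1, fun r => ?_⟩
  obtain ⟨G, -, -, -, hX, hG⟩ := hd r r.2
  rw [Set.disjoint_left]
  intro v hv hv'
  simp only [Set.mem_iUnion] at hv
  obtain ⟨b, hb, hvb⟩ := hv
  exact (hG b b.2 hb.1 hb.2).2 v ⟨v.2, hvb⟩ (guardsAt_outputTree_subset hX hG hv')

theorem width_outputTree_le {m : Mem} (hk : 1 ≤ k)
    (hd : ∀ r < (treeOf n m).size, (treeOf n m).Done n k r) :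
    (outputTree n m).width ≤ 3 * (k : ℤ) - 2 := by
  have : (Finset.univ.sup fun r => ((outputTree n m).W r ∪ (outputTree n m).guardsAt r).ncard) ≤
      3 * k - 1 := by
    refine Finset.sup_le fun r _ => ?_
    obtain ⟨G, hfin, hcard, hW, hX, hG⟩ := hd r r.2
    refine le_trans ?_ hcard
    rw [← Set.ncard_image_of_injective _ Fin.val_injective]
    refine Set.ncard_le_ncard ?_ hfin
    rintro _ ⟨v, hv | hv, rfl⟩
    · exact hW ⟨v.2, hv⟩
    · exact guardsAt_outputTree_subset hX hG hv
  unfold TreeData.width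
  omega

theorem input_mat (μ : Fin n → Fin n → ℕ) {u v : ℕ} (hu : u < n) (hv : v < n) :
    input n k μ MAT (u * n + v) = μ ⟨u, hu⟩ ⟨v, hv⟩ := by
  have h : u * n + v < n * n := by nlinarith
  have h1 : (u * n + v) / n = u := by
    rw [mul_comm, Nat.mul_add_div (by omega), Nat.div_eq_of_lt hv, add_zero]
  have h2 : (u * n + v) % n = v := by
    rw [mul_comm, Nat.mul_add_mod, Nat.mod_eq_of_lt hv]
  have h3 : Fin.divNat ⟨u * n + v, h⟩ = ⟨u, hu⟩ := Fin.ext h1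
  have h4 : Fin.modNat ⟨u * n + v, h⟩ = ⟨v, hv⟩ := Fin.ext h2
  simp [input, h, h3, h4]

/-! ### The algorithm -/

/-- The algorithm halts within the bound given by `Cmd.time`, and all nodes are finished then unless
a linked set has been found: there are at most `n` nodes. -/
theorem exists_exec {n k : ℕ} (μ : Fin n → Fin n → ℕ) (hn : 1 ≤ n) (hk : 1 ≤ k) :
    ∃ t, Exec (.seq setup.compile mainLoop.compile) (input n k μ) t
        (mainLoop.run (setup.run (input n k μ))) ∧
      t ≤ setup.time (8 * (n + k) + 3 ^ (8 * k)) + mainLoop.time (8 * (n + k) + 3 ^ (8 * k)) ∧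
      Progress n k (multAdj μ) n (mainLoop.run (setup.run (input n k μ))) := by
  obtain ⟨he, h0, h1, hf⟩ := run_setup (m := input n k μ) (n := n) (k := k) (adj := multAdj μ)
    (by simp [input]) (by simp [input]) fun u hu v hv => by
      rw [input_mat μ hu hv]
      exact ⟨fun h => ⟨hu, hv, h⟩, fun ⟨_, _, h⟩ => h⟩
  obtain ⟨t, h2, h3⟩ := exec_compile (p := setup) (S := 8 * (n + k) + 3 ^ (8 * k))
    (m := input n k μ) (by decide) (boundsLe_setup (by simp [input]))
  obtain ⟨t', h4, h5⟩ := exec_compile (p := mainLoop) (S := 8 * (n + k) + 3 ^ (8 * k))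
    (m := setup.run (input n k μ)) (by decide)
    (boundsLe_mainLoop (by rw [he.n_eq, he.k_eq]; exact Nat.le_add_right _ _)
      (by rw [he.pow_eq]; exact Nat.le_add_left _ _))
  refine ⟨t + t', .seq h2 h4, add_le_add h3 h5, run_mainLoop he hk (fun u v ⟨hu, hv, _⟩ => ⟨hu, hv⟩)
    (progress_setup hn h0 h1 (fun v => ?_) fun v => ?_)⟩
  · rw [hf COMP (by decide)]; simp [input]
  · rw [hf GRD (by decide)]; simp [input]

end DirectedTreewidth

theorem mainTheorem1 :
    ∃ (P : RAM.Prog) (c : ℕ), ∀ (n k : ℕ) (μ : Fin n → Fin n → ℕ), 1 ≤ n → 1 ≤ k →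
      ∃ (t : ℕ) (m : RAM.Mem), RAM.Exec P (DirectedTreewidth.input n k μ) t m ∧
        (t : ℝ) ≤ c * (2 : ℝ) ^ (c * (k * Real.logb 2 k) : ℝ) * (n : ℝ) ^ c ∧
        ((DirectedTreewidth.outputKind m = 1 ∧
            (DirectedTreewidth.outputTree n m).IsArborealDecomposition (DirectedTreewidth.ofMult μ) ∧
            (DirectedTreewidth.outputTree n m).IsNice (DirectedTreewidth.ofMult μ) ∧
            (DirectedTreewidth.outputTree n m).width ≤ 3 * (k : ℤ) - 2) ∨
          (DirectedTreewidth.outputKind m = 0 ∧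
            DirectedTreewidth.IsLinked (DirectedTreewidth.ofMult μ) (k - 1) (k - 1) (DirectedTreewidth.outputSet n m) ∧
            (DirectedTreewidth.outputSet n m).ncard = 2 * k - 1 ∧
            ¬ ∃ Z : Set (Fin n), Z.ncard ≤ k - 1 ∧
              DirectedTreewidth.IsBalancedSeparator (DirectedTreewidth.ofMult μ)
                (DirectedTreewidth.outputSet n m) (k - 1) Z)) := by
  open DirectedTreewidth in
  obtain ⟨K, d, h1⟩ := setup.exists_time_le
  obtain ⟨K', d', h2⟩ := mainLoop.exists_time_le
  obtain ⟨c, hc⟩ := time_bound (K + K') (d + d')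
  refine ⟨.seq setup.compile mainLoop.compile, c, fun n k μ hn hk => ?_⟩
  obtain ⟨t, hexec, ht, hP⟩ := exists_exec μ hn hk
  refine ⟨t, _, hexec, ?_, ?_⟩
  · refine le_trans ?_ (hc n k hn hk)
    set S := 8 * (n + k) + 3 ^ (8 * k)
    have h3 : (S + 1) ^ d ≤ (S + 1) ^ (d + d') := Nat.pow_le_pow_right (Nat.succ_pos S) (by omega)
    have h4 : (S + 1) ^ d' ≤ (S + 1) ^ (d + d') := Nat.pow_le_pow_right (Nat.succ_pos S) (by omega)
    have h5 : t ≤ (K + K') * (S + 1) ^ (d + d') := by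
      refine (ht.trans (add_le_add (h1 S) (h2 S))).trans ?_
      rw [add_mul]
      exact add_le_add (Nat.mul_le_mul_left _ h3) (Nat.mul_le_mul_left _ h4)
    exact_mod_cast h5
  · rcases hP with ⟨h3, h4, h5, -⟩ | ⟨h3, h4, h5⟩
    · have h6 : ∀ r < (treeOf n _).size, (treeOf n _).Done n k r := fun r hr =>
        h5 r hr (hr.trans_le h4.size_le)
      exact Or.inl ⟨h3, isArborealDecomposition_outputTree h4, isNice_outputTree h4 h6,
        width_outputTree_le hk h6⟩
    · refine Or.inr ⟨h3, fun Z hZ => linked_of_forall_not_goodSep h5 hZ, ?_, ?_⟩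
      · rw [← image_outputSet, Set.ncard_image_of_injective _ Fin.val_injective] at h4
        exact h4
      · rintro ⟨Z, hZ, hZ'⟩
        have := linked_of_forall_not_goodSep h5 hZ'
        omega
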